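/- **Model.** Let $K\ge 2$, $z\in[K]^n$, and let $P\in(0,1)^{K\times K}$ be symmetric. In the stochastic block model the adjacency matrix $A\in\{0,1\}^{n\times n}$ is symmetric with zero diagonal, and the entries $A_{ij}\sim\mathrm{Bern}(P_{z_iz_j})$, $i>j$, are independent. Put $n_k=|\{i:z_i=k\}|$, $p^*=\max_{k,\ell}P_{k\ell}$, $p_{kj}=P_{kz_j}$, and let $\varphi_k$ be the probability mass function of $\bigotimes_{j=1}^n\mathrm{Bern}(p_{kj})$ on $\{0,1\}^n$. For $k\ne\ell$ let $$D_{k\ell}=\sup_{\alpha\in(0,1)}\Big(-\log\sum_x\varphi_k(x)^{1-\alpha}\varphi_\ell(x)^{\alpha}\Big),\qquad \eta_{k\ell}=\sum_x\min(\varphi_k(x),\varphi_\ell(x)),$$ $D^*=\min_{k\ne\ell}D_{k\ell}$, $\eta^*=\max_{k\ne\ell}\eta_{k\ell}$, and $$\rho^*=\max_{k\ne\ell}\Big(\sqrt{np^*}\,\max_{j\in[n]}\Big|\log\frac{p_{kj}(1-p_{\ell j})}{p_{\ell j}(1-p_{kj})}\Big|\Big)^{-1}e^{-D_{k\ell}}.$$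 For labels $\hat z$ let $\mathrm{mis}(\hat z,z)=\min_{\pi\in S_K}\frac1n|\{i:\pi(\hat z_i)\ne z_i\}|$. For constants $\beta>1$, $\varepsilon\in(0,1)$, $\omega>1$ the model is called $(\beta,\varepsilon,\omega)$-admissible if $n_k\in[\frac{n}{\beta K},\frac{\beta n}{K}]$ for all $k$, $p^*\le1-\varepsilon$, and $\max_{k,\ell} P_{k\ell}\le\omega\min_{k,\ell} P_{k\ell}$. **Algorithm.** For labels $y$ let $\mathcal B(A,y)_{k\ell}$ be the proportion of pairs joined by an edge among the pairs $i\ne j$ with $y_i=k$, $y_j=\ell$. For a $K\times K$ matrix $Q$, a set $S$ of nodes with labels $y$, and a node $i$, let $\mathcal L_i(A,Q,S,y)$ be a maximizer over $k\in[K]$ of $\sum_{j\in S,j\ne i}A_{ij}\log Q_{ky_j}+(1-A_{ij})\log(1-Q_{ky_j})$. Let $\mathrm{SC}$ be a spectral clustering procedure: it truncates the degrees of the graph at some level, forms the matrix $\hat U\hat\Sigma$ from the top $K$ singular values and vectors of the truncated adjacency matrix, and applies $K$-means to its rows. 1. $\tilde z=\mathrm{SC}(A)$ and $\tilde P=\mathcal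 B(A,\tilde z)$. Choose $I\subset[n]$ uniformly among the sets with $|I|=\lfloor n/2\rfloor$, independently of $A$, and let $J=[n]\setminus I$. 2. For each $j\in[n]$: let $I'=I\setminus\{j\}$, $J'=J\setminus\{j\}$. Compute $\mathrm{SC}(A_{I'\times I'})$ and $\mathrm{SC}(A_{J'\times J'})$, and permute the labels of each of them so that it disagrees with $\tilde z$ on as few nodes as possible; call the result $y$. Let $w_i=\mathcal L_i(A,\tilde P,J',y)$ for $i\in I'$, $w_i=\mathcal L_i(A,\tilde P,I',y)$ for $i\in J'$, and $w_j=\tilde z_j$. Let $\hat P=\mathcal B(A,w)$ and $\hat z_j=\mathcal L_j(A,\hat P,[n],w)$. Ties are broken arbitrarily. The output is $\hat z$. **Theorem.** Fix $\beta>1$, $\varepsilon\in(0,1)$, $\omega>1$, $K^*\in\mathbb N$ and a function $c:(1,\infty)\to\mathbb R$ (the implied constants of spectral clustering). There are $C_1,C_2>0$ depending only on these data such that for every $r>0$ there is a constant $C>0$, depending only on these data and on $r$, with the following property. Let $2\le K\le K^*$, let a $(\beta,\varepsilon,\omega)$-admissible model be given, and suppose that spectral clustering has the following guarantee: for every $\beta'>1$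 and every $(\beta',\varepsilon,\omega)$-admissible model with $K$ communities and any number $m\ge 1$ of nodes, its output $\tilde z$ satisfies $\mathrm{mis}(\tilde z,z)\le c(\beta')/D^*$ with probability at least $1-m^{-(r+1)}$ (where $z$ and $D^*$ belong to that model). If $C_1\le np^*\le C_2(D^*)^2$, then: (a) if $D^*\le(1+r/2)\log n$, then $\mathbb E[\mathrm{mis}(\hat z,z)]\le C\eta^*$ and $\mathbb E[\mathrm{mis}(\hat z,z)]\le C\rho^*$; (b) for all $s>0$, if $D^*\ge(1+2s)\log n$, then $\mathbb P(\mathrm{mis}(\hat z,z)\ge\eta^*)\le Cn^{-\min(r,s)}$ and $\mathbb P(\mathrm{mis}(\hat z,z)\ge\rho^*)\le Cn^{-\min(r,s)}$. -/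

import Mathlib

noncomputable section

open scoped Classical

namespace SBM

/-! ### Product Bernoulli laws, Chernoff information, total variation affinity -/

/-- Probability mass function of `⨂ⱼ Bern(p j)` on `V → Bool`. -/
def bernProd {V : Type} [Fintype V] (p : V → ℝ) (x : V → Bool) : ℝ :=
  ∏ j, if x j = true then p j else 1 - p j

/-- Chernoff `α`-divergence `-log ∑ φ₀^(1-α) φ₁^α` of two mass functions on a finite set. -/
def chernoffDiv {X : Type} [Fintype X] (α : ℝ) (φ₀ φ₁ : X → ℝ) : ℝ :=
  -Real.log (∑ x, φ₀ x ^ (1 - α) * φ₁ x ^ α)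

/-- Chernoff information: the supremum over `α ∈ (0,1)` of the Chernoff `α`-divergences. -/
def chernoffInfo {X : Type} [Fintype X] (φ₀ φ₁ : X → ℝ) : ℝ :=
  ⨆ α : Set.Ioo (0 : ℝ) 1, chernoffDiv (α : ℝ) φ₀ φ₁

/-- Total variation affinity. -/
def affinity {X : Type} [Fintype X] (φ₀ φ₁ : X → ℝ) : ℝ :=
  ∑ x, min (φ₀ x) (φ₁ x)

/-! ### The stochastic block model -/

/-- Ordered pairs of distinct communities. -/
abbrev Pairs (K : ℕ) : Type := {kl : Fin K × Fin K // kl.1 ≠ kl.2}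

/-- The parameter vector `p_{k*} = (P_{k z_j})_j`. -/
def pRow {V : Type} {K : ℕ} (z : V → Fin K) (P : Matrix (Fin K) (Fin K) ℝ) (k : Fin K) : V → ℝ :=
  fun j => P k (z j)

/-- `p* = max P_{kl}`. -/
def pStar {K : ℕ} (P : Matrix (Fin K) (Fin K) ℝ) : ℝ :=
  ⨆ kl : Fin K × Fin K, P kl.1 kl.2

/-- Chernoff information between the laws with parameter vectors `p_{k*}` and `p_{l*}`. -/
def pairInfo {V : Type} [Fintype V] {K : ℕ} (z : V → Fin K) (P : Matrix (Fin K) (Fin K) ℝ)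
    (k l : Fin K) : ℝ :=
  chernoffInfo (bernProd (pRow z P k)) (bernProd (pRow z P l))

/-- `D* = min_{k ≠ l}` of the Chernoff informations. -/
def dStar {V : Type} [Fintype V] {K : ℕ} (z : V → Fin K) (P : Matrix (Fin K) (Fin K) ℝ) : ℝ :=
  ⨅ kl : Pairs K, pairInfo z P kl.1.1 kl.1.2

/-- `η* = max_{k ≠ l}` of the total variation affinities. -/
def etaStar {V : Type} [Fintype V] {K : ℕ} (z : V → Fin K) (P : Matrix (Fin K) (Fin K) ℝ) : ℝ :=
  ⨆ kl : Pairs K, affinity (bernProd (pRow z P kl.1.1)) (bernProd (pRow z P kl.1.2))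

/-- `max_j |log (p_{kj} (1 - p_{lj}) / (p_{lj} (1 - p_{kj})))|`. -/
def maxLogOdds {V : Type} {K : ℕ} (z : V → Fin K) (P : Matrix (Fin K) (Fin K) ℝ)
    (k l : Fin K) : ℝ :=
  ⨆ j : V, |Real.log (pRow z P k j * (1 - pRow z P l j) / (pRow z P l j * (1 - pRow z P k j)))|

/-- The explicit Chernoff-type rate. -/
def chernoffRate {V : Type} [Fintype V] {K : ℕ} (z : V → Fin K)
    (P : Matrix (Fin K) (Fin K) ℝ) : ℝ :=
  ⨆ kl : Pairs K,
    (Real.sqrt ((Fintype.card V : ℝ) * pStar P) * maxLogOdds z P kl.1.1 kl.1.2)⁻¹ *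
      Real.exp (-pairInfo z P kl.1.1 kl.1.2)

/-- Size of community `k`. -/
def commSize {V : Type} [Fintype V] {K : ℕ} (z : V → Fin K) (k : Fin K) : ℕ :=
  (Finset.univ.filter fun i => z i = k).card

/-- The admissible parameters of the model for the constants `β`, `ε`, `ω`. -/
structure Admissible {V : Type} [Fintype V] {K : ℕ} (β ε ω : ℝ) (z : V → Fin K)
    (P : Matrix (Fin K) (Fin K) ℝ) : Prop where
  symm : P.IsSymm
  pos : ∀ k l, 0 < P k l
  size_lower : ∀ k, (Fintype.card V : ℝ) / (β * K) ≤ commSize z k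
  size_upper : ∀ k, (commSize z k : ℝ) ≤ β * Fintype.card V / K
  sparse : pStar P ≤ 1 - ε
  ratio : ∀ k l k' l', P k l / P k' l' ≤ ω

/-- Probability of the graph `G` under the stochastic block model: the indicators of the edges
`{i, j}`, `i > j`, are independent with law `Bern(P_{z_i z_j})`, and there are no self-loops. -/
def graphProb {V : Type} [Fintype V] [LinearOrder V] {K : ℕ} (z : V → Fin K)
    (P : Matrix (Fin K) (Fin K) ℝ) (G : SimpleGraph V) : ℝ :=
  ∏ ij ∈ (Finset.univ : Finset (V × V)).filter (fun ij => ij.2 < ij.1),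
    if G.Adj ij.1 ij.2 then P (z ij.1) (z ij.2) else 1 - P (z ij.1) (z ij.2)

/-- Probability of an event of graphs under the stochastic block model. -/
def sbmProb {V : Type} [Fintype V] [LinearOrder V] {K : ℕ} (z : V → Fin K)
    (P : Matrix (Fin K) (Fin K) ℝ) (E : SimpleGraph V → Prop) : ℝ :=
  ∑ G : SimpleGraph V, if E G then graphProb z P G else 0

/-- Misclassification rate, minimized over the permutations of the labels. -/
def mis {V : Type} [Fintype V] {K : ℕ} (zhat z : V → Fin K) : ℝ :=
  ⨅ π : Equiv.Perm (Fin K),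
    ((Finset.univ.filter fun i => π (zhat i) ≠ z i).card : ℝ) / Fintype.card V

/-! ### Spectral clustering -/

/-- A procedure that labels the nodes of every finite graph with `K` labels. -/
def Clustering (K : ℕ) : Type 1 :=
  ∀ (V : Type) [Fintype V], SimpleGraph V → V → Fin K

/-- `B` is a degree truncation of `A` at some level `τ`: the weights at nodes of degree above `τ`
are reduced so that all degrees are at most `τ`; the other weights are kept. -/
def IsDegreeTruncation {V : Type} [Fintype V] (A B : Matrix V V ℝ) : Prop :=
  ∃ τ : ℝ, B.IsSymm ∧ (∀ i j, 0 ≤ B i j ∧ B i j ≤ A i j) ∧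
    (∀ i j, ∑ v, A i v ≤ τ → ∑ v, A j v ≤ τ → B i j = A i j) ∧
    ∀ i, ∑ v, B i v ≤ τ

/-- `X = Û Σ̂`, with the top `K` singular values of the symmetric matrix `B` and the corresponding
singular vectors. The columns beyond the number of nodes, if any, vanish. -/
def IsSpectralEmbedding {V : Type} [Fintype V] {K : ℕ} (B : Matrix V V ℝ)
    (X : Matrix V (Fin K) ℝ) : Prop :=
  ∃ (U : Matrix V V ℝ) (ev : V → ℝ) (e : Fin (Fintype.card V) ≃ V),
    U ∈ Matrix.orthogonalGroup V ℝ ∧ B = U * Matrix.diagonal ev * U.transpose ∧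
    Antitone (fun a => |ev (e a)|) ∧
    ∀ i (k : Fin K), X i k =
      if h : (k : ℕ) < Fintype.card V then U i (e ⟨k, h⟩) * |ev (e ⟨k, h⟩)| else 0

/-- Sum of the squared distances of the rows of `X` to the centres of their clusters. -/
def kMeansCost {V : Type} [Fintype V] {K : ℕ} (X : Matrix V (Fin K) ℝ) (y : V → Fin K)
    (c : Fin K → Fin K → ℝ) : ℝ :=
  ∑ i, ∑ a, (X i a - c (y i) a) ^ 2

/-- `y` is a `K`-means clustering of the rows of `X`. -/
def IsKMeans {V : Type} [Fintype V] {K : ℕ} (X : Matrix V (Fin K) ℝ) (y : V → Fin K) : Prop :=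
  ∃ c, ∀ y' c', kMeansCost X y c ≤ kMeansCost X y' c'

/-- Spectral clustering: degree truncation of the adjacency matrix, truncated singular value
decomposition, `K`-means. -/
def IsSpectralClustering {K : ℕ} (SC : Clustering K) : Prop :=
  ∀ (V : Type) [Fintype V] (G : SimpleGraph V),
    ∃ (B : Matrix V V ℝ) (X : Matrix V (Fin K) ℝ),
      IsDegreeTruncation (G.adjMatrix ℝ) B ∧ IsSpectralEmbedding B X ∧ IsKMeans X (SC V G)

/-- On every block model that is admissible for `β`, `ε`, `ω`, with `m` nodes, the labels returned
by `SC` satisfy `mis ≤ C / D*` with probability at least `1 - m^{-(r+1)}`. -/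
def ClusteringGuarantee {K : ℕ} (β ε ω r C : ℝ) (SC : Clustering K) : Prop :=
  ∀ (V : Type) [Fintype V] [LinearOrder V] [Nonempty V] (z : V → Fin K)
    (P : Matrix (Fin K) (Fin K) ℝ), Admissible β ε ω z P →
    1 - (Fintype.card V : ℝ) ^ (-(r + 1)) ≤
      sbmProb z P (fun G => dStar z P * mis (SC V G) z ≤ C)

/-! ### The two-step likelihood-ratio algorithm -/

/-- Number of ordered pairs of distinct nodes with labels `k`, `l`. -/
def pairCount {V : Type} [Fintype V] {K : ℕ} (y : V → Fin K) (k l : Fin K) : ℕ :=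
  ((Finset.univ : Finset (V × V)).filter
    fun ij => ij.1 ≠ ij.2 ∧ y ij.1 = k ∧ y ij.2 = l).card

/-- Number of ordered pairs of adjacent nodes with labels `k`, `l`. -/
def edgeCount {V : Type} [Fintype V] {K : ℕ} (G : SimpleGraph V) (y : V → Fin K)
    (k l : Fin K) : ℕ :=
  ((Finset.univ : Finset (V × V)).filter
    fun ij => G.Adj ij.1 ij.2 ∧ y ij.1 = k ∧ y ij.2 = l).card

/-- The estimate of the connectivity matrix from the labels `y`: edge frequencies between (and
within) the label classes. -/
def blockEstimate {V : Type} [Fintype V] {K : ℕ} (G : SimpleGraph V) (y : V → Fin K) :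
    Matrix (Fin K) (Fin K) ℝ :=
  fun k l => (edgeCount G y k l : ℝ) / pairCount y k l

/-- Likelihood of the label `k` for node `i`, from the edges between `i` and the nodes of `S` with
labels `y`. This is the exponential of
`∑_{j ∈ S, j ≠ i} A_{ij} log Q_{k y_j} + (1 - A_{ij}) log (1 - Q_{k y_j})`
(with `log 0 = -∞`). -/
def likelihood {V : Type} [Fintype V] {K : ℕ} (G : SimpleGraph V)
    (Q : Matrix (Fin K) (Fin K) ℝ) (S : Finset V) (y : V → Fin K) (i : V) (k : Fin K) : ℝ :=
  ∏ j ∈ S.filter (fun j => j ≠ i), if G.Adj i j then Q k (y j) else 1 - Q k (y j)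

/-- `k` is an output of the likelihood-ratio classifier for node `i`. -/
def IsLRLabel {V : Type} [Fintype V] {K : ℕ} (G : SimpleGraph V)
    (Q : Matrix (Fin K) (Fin K) ℝ) (S : Finset V) (y : V → Fin K) (i : V) (k : Fin K) : Prop :=
  ∀ l, likelihood G Q S y i l ≤ likelihood G Q S y i k

/-- The subgraph on the nodes of `S`. -/
def subGraph {V : Type} (G : SimpleGraph V) (S : Finset V) : SimpleGraph {v // v ∈ S} :=
  G.comap (fun v => (v : V))

/-- On `S`, the labels `y` are the labels `raw` after a permutation of the label set that makes
them agree with the reference labels `ref` on as many nodes of `S` as possible. -/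
def IsMatched {V : Type} {K : ℕ} (S : Finset V) (ref : V → Fin K)
    (raw : {v // v ∈ S} → Fin K) (y : V → Fin K) : Prop :=
  ∃ π : Equiv.Perm (Fin K), (∀ i : {v // v ∈ S}, y i = π (raw i)) ∧
    ∀ π' : Equiv.Perm (Fin K),
      (Finset.univ.filter fun i : {v // v ∈ S} => ref i ≠ π (raw i)).card ≤
        (Finset.univ.filter fun i : {v // v ∈ S} => ref i ≠ π' (raw i)).card

/-- `k` is an output of the `j`-th iteration of the algorithm, on the graph `G` and with the
splitting `I`, `J = Iᶜ` of the nodes. Here `SC V G` are the initial labels on the whole graph,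
`y` are the matched spectral labels on `I' = I \ {j}` and `J' = J \ {j}`, and `w` are the labels
after the first likelihood-ratio step. -/
def IsIterationOutput {V : Type} [Fintype V] {K : ℕ} (SC : Clustering K) (G : SimpleGraph V)
    (I : Finset V) (j : V) (k : Fin K) : Prop :=
  ∃ y w : V → Fin K,
    IsMatched (I.erase j) (SC V G) (SC _ (subGraph G (I.erase j))) y ∧
    IsMatched (Iᶜ.erase j) (SC V G) (SC _ (subGraph G (Iᶜ.erase j))) y ∧
    (∀ i ∈ I.erase j, IsLRLabel G (blockEstimate G (SC V G)) (Iᶜ.erase j) y i (w i)) ∧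
    (∀ i ∈ Iᶜ.erase j, IsLRLabel G (blockEstimate G (SC V G)) (I.erase j) y i (w i)) ∧
    w j = SC V G j ∧
    IsLRLabel G (blockEstimate G w) Finset.univ w j k

/-- `zhat` is an implementation of the algorithm: for each graph and each set `I` of `⌊n/2⌋` nodes
it returns possible outputs of all the iterations (ties being broken in any way). -/
def IsAlgorithm {V : Type} [Fintype V] {K : ℕ} (SC : Clustering K)
    (zhat : SimpleGraph V → Finset V → V → Fin K) : Prop :=
  ∀ (G : SimpleGraph V) (I : Finset V), I.card = Fintype.card V / 2 →
    ∀ j, IsIterationOutput SC G I j (zhat G I j)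

/-- Expectation of `f G I`, for `G` from the stochastic block model and, independently, `I` uniform
among the sets of `⌊n/2⌋` nodes. -/
def expect {V : Type} [Fintype V] [LinearOrder V] {K : ℕ} (z : V → Fin K)
    (P : Matrix (Fin K) (Fin K) ℝ) (f : SimpleGraph V → Finset V → ℝ) : ℝ :=
  (∑ I ∈ (Finset.univ : Finset V).powersetCard (Fintype.card V / 2),
      ∑ G : SimpleGraph V, graphProb z P G * f G I) /
    ((Fintype.card V).choose (Fintype.card V / 2) : ℝ)

/-- Probability of an event of `G` and `I`. -/
def prob {V : Type} [Fintype V] [LinearOrder V] {K : ℕ} (z : V → Fin K)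
    (P : Matrix (Fin K) (Fin K) ℝ) (E : SimpleGraph V → Finset V → Prop) : ℝ :=
  expect z P (fun G I => if E G I then 1 else 0)

end SBM

end

/-! Write `D` for `D*`. The heart of the matter is a bound `C (n^{-(r+1)} + η*)` on the probability
that node `j` is mislabelled in iteration `j`, up to the permutation `align` of the initial labels
(`Scales.exists_bP_node_le`).

Suppose that before the final step all nodes are labelled correctly outside a set `M` with `|M| ≤
3τ/p*`. On a regular graph the estimated connectivities are then off by `O(τ/n)`. Both defects
change the log-likelihood ratio at `j` by at most a linear statistic of the row of `j`
(`RowErr.exists_le`). The error probability is thus bounded by an exponential tilt of the pointwise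
minimum of `φ_k` and `φ_l`. Under that minimum the odds of an edge are at most `p*/ε`, so the tilt
costs only a factor `exp (E τ)` (`sum_mul_exp_le`, `BlockBounds.bP_rowErr_le_affinity`). The bound
is a multiple of the affinity itself, with no loss in the exponent.

For this, `M` must not depend on the edges at `j`. The spectral labels on the two halves without `j`
satisfy this; the initial labels do not. The latter enter through a matching permutation, handled by
a union bound over `K!` choices, and through an estimate of `P`, handled by letting errors count for
every `Q` near `P`. That `M` is small follows from the splitting: labels on one half are independent
of the edges to the other half, so errors in the first step are independent across nodes and their
number satisfies a Chernoff bound (`Scales.bP_firstStep_le`).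

The scale `τ` is chosen by cases (`Scales.exists_tau`). If `D² ≤ √n`, the assumption `n p* ≤ C₂ D²`
forces `p*` to be small and `τ = 1` works. Otherwise `D` exceeds `n^{1/4}` and the crude `τ = κ D`
suffices. All other failures are exponentially small in `n^{1/4}`, apart from the `n^{-(r+1)}` of
spectral clustering.

Two comparisons of rates finish the proof. Tilting to the optimal Chernoff exponent centres the
log-likelihood ratio. Its variance is `O(D)`, whence `η* ≥ exp (-D - O(√D))`; for `D ≤ (1 + r/2) log
n` this absorbs `n^{-(r+1)}` (`BlockBounds.rpow_le_etaStar`). Conversely, a whole community shares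
the largest log-odds difference, and a Stein-type anticoncentration bound gives `η* ≤ C ρ*`
(`bE_exp_neg_abs_le`, `BlockBounds.etaStar_le_chernoffRate`). Part (b) is a union bound over the
nodes, since `η* ≤ exp (-D)`. -/

noncomputable section

open scoped Classical

namespace SBM

/-! ### Expectations under product Bernoulli laws -/

section Bernoulli

variable {ι κ : Type} [Fintype ι] [Fintype κ]

/-- Weight of `b` under `Bern(p)`. -/
def bw (p : ℝ) (b : Bool) : ℝ := if b = true then p else 1 - p

/-- Expectation under `⨂ᵢ Bern(p i)`. -/
def bE (p : ι → ℝ) (f : (ι → Bool) → ℝ) : ℝ := ∑ x, bernProd p x * f x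

/-- Probability under `⨂ᵢ Bern(p i)`. -/
def bP (p : ι → ℝ) (A : (ι → Bool) → Prop) : ℝ := bE p fun x => if A x then 1 else 0

/-- The value of a bit as a real number. -/
def bit (b : Bool) : ℝ := if b = true then 1 else 0

@[simp] lemma bw_true (p : ℝ) : bw p true = p := by simp [bw]
@[simp] lemma bw_false (p : ℝ) : bw p false = 1 - p := by simp [bw]
@[simp] lemma bit_true : bit true = 1 := by simp [bit]
@[simp] lemma bit_false : bit false = 0 := by simp [bit]

lemma bit_nonneg (b : Bool) : 0 ≤ bit b := by cases b <;> simp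

lemma bernProd_eq (p : ι → ℝ) (x : ι → Bool) : bernProd p x = ∏ i, bw (p i) (x i) := rfl

lemma bw_nonneg {p : ℝ} (h0 : 0 ≤ p) (h1 : p ≤ 1) (b : Bool) : 0 ≤ bw p b := by
  cases b <;> simp <;> linarith

lemma bw_pos {p : ℝ} (h0 : 0 < p) (h1 : p < 1) (b : Bool) : 0 < bw p b := by
  cases b <;> simp <;> linarith

lemma bernProd_nonneg {p : ι → ℝ} (hp : ∀ i, 0 ≤ p i ∧ p i ≤ 1) (x : ι → Bool) :
    0 ≤ bernProd p x :=
  Finset.prod_nonneg fun i _ => bw_nonneg (hp i).1 (hp i).2 _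

lemma bernProd_pos {p : ι → ℝ} (hp : ∀ i, 0 < p i ∧ p i < 1) (x : ι → Bool) :
    0 < bernProd p x :=
  Finset.prod_pos fun i _ => bw_pos (hp i).1 (hp i).2 _

lemma bE_prod (p : ι → ℝ) (g : ι → Bool → ℝ) :
    bE p (fun x => ∏ i, g i (x i)) = ∏ i, (p i * g i true + (1 - p i) * g i false) := by
  rw [bE]
  calc _ = ∑ x : ι → Bool, ∏ i, bw (p i) (x i) * g i (x i) := by
        refine Finset.sum_congr rfl fun x _ => ?_
        rw [bernProd_eq, Finset.prod_mul_distrib]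
    _ = _ := by
        have h2 := Finset.prod_univ_sum (fun _ : ι => (Finset.univ : Finset Bool))
          (fun i b => bw (p i) b * g i b)
        rw [Fintype.piFinset_univ] at h2
        rw [← h2]
        refine Finset.prod_congr rfl fun i _ => ?_
        simp

lemma bE_const (p : ι → ℝ) (c : ℝ) : bE p (fun _ => c) = c := by
  have h := bE_prod p (fun _ _ => 1)
  simp only [Finset.prod_const_one, mul_one, add_sub_cancel] at h
  rw [bE] at h ⊢
  rw [← Finset.sum_mul]
  simp only [mul_one] at h
  rw [h, one_mul]

lemma sum_bernProd (p : ι → ℝ) : ∑ x, bernProd p x = 1 := by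
  simpa [bE] using bE_const p 1

lemma bE_add (p : ι → ℝ) (f g : (ι → Bool) → ℝ) :
    bE p (fun x => f x + g x) = bE p f + bE p g := by
  simp [bE, mul_add, Finset.sum_add_distrib]

lemma bE_sub (p : ι → ℝ) (f g : (ι → Bool) → ℝ) :
    bE p (fun x => f x - g x) = bE p f - bE p g := by
  simp [bE, mul_sub, Finset.sum_sub_distrib]

lemma bE_const_mul (p : ι → ℝ) (c : ℝ) (f : (ι → Bool) → ℝ) :
    bE p (fun x => c * f x) = c * bE p f := by
  simp only [bE, Finset.mul_sum]
  exact Finset.sum_congr rfl fun x _ => by ring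

lemma bE_sum (p : ι → ℝ) {σ : Type*} (T : Finset σ) (f : σ → (ι → Bool) → ℝ) :
    bE p (fun x => ∑ t ∈ T, f t x) = ∑ t ∈ T, bE p (f t) := by
  simp only [bE, Finset.mul_sum]
  exact Finset.sum_comm

lemma bE_mono {p : ι → ℝ} (hp : ∀ i, 0 ≤ p i ∧ p i ≤ 1) {f g : (ι → Bool) → ℝ}
    (h : ∀ x, f x ≤ g x) : bE p f ≤ bE p g :=
  Finset.sum_le_sum fun x _ => mul_le_mul_of_nonneg_left (h x) (bernProd_nonneg hp x)

lemma bE_nonneg {p : ι → ℝ} (hp : ∀ i, 0 ≤ p i ∧ p i ≤ 1) {f : (ι → Bool) → ℝ}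
    (h : ∀ x, 0 ≤ f x) : 0 ≤ bE p f :=
  Finset.sum_nonneg fun x _ => mul_nonneg (bernProd_nonneg hp x) (h x)

lemma bP_nonneg {p : ι → ℝ} (hp : ∀ i, 0 ≤ p i ∧ p i ≤ 1) (A : (ι → Bool) → Prop) : 0 ≤ bP p A :=
  bE_nonneg hp fun x => by split_ifs <;> norm_num

lemma bP_mono {p : ι → ℝ} (hp : ∀ i, 0 ≤ p i ∧ p i ≤ 1) {A B : (ι → Bool) → Prop}
    (h : ∀ x, A x → B x) : bP p A ≤ bP p B :=
  bE_mono hp fun x => by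
    by_cases hA : A x
    · simp [hA, h x hA]
    · simp only [hA, if_false]; split_ifs <;> norm_num

lemma bP_or_le {p : ι → ℝ} (hp : ∀ i, 0 ≤ p i ∧ p i ≤ 1) (A B : (ι → Bool) → Prop) :
    bP p (fun x => A x ∨ B x) ≤ bP p A + bP p B := by
  rw [bP, bP, bP, ← bE_add]
  refine bE_mono hp fun x => ?_
  by_cases hA : A x <;> by_cases hB : B x <;> simp [hA, hB]

lemma bP_exists_le {p : ι → ℝ} (hp : ∀ i, 0 ≤ p i ∧ p i ≤ 1) {σ : Type*} (T : Finset σ)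
    (A : σ → (ι → Bool) → Prop) :
    bP p (fun x => ∃ t ∈ T, A t x) ≤ ∑ t ∈ T, bP p (A t) := by
  simp only [bP]
  rw [← bE_sum]
  refine bE_mono hp fun x => ?_
  split_ifs with h
  · obtain ⟨t, ht, hA⟩ := h
    calc (1 : ℝ) = if A t x then 1 else 0 := by simp [hA]
      _ ≤ _ := Finset.single_le_sum (f := fun t => if A t x then (1 : ℝ) else 0)
          (fun t _ => by split_ifs <;> norm_num) ht
  · exact Finset.sum_nonneg fun t _ => by split_ifs <;> norm_num

lemma bP_not (p : ι → ℝ) (A : (ι → Bool) → Prop) : bP p (fun x => ¬ A x) = 1 - bP p A := by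
  have h : bP p (fun x => ¬ A x) = bE p (fun x => 1 - if A x then 1 else 0) := by
    rw [bP]; congr 1; ext x; by_cases hA : A x <;> simp [hA]
  rw [h, bE_sub, bE_const, bP]

/-- Markov's inequality. -/
lemma bP_le_bE {p : ι → ℝ} (hp : ∀ i, 0 ≤ p i ∧ p i ≤ 1) {A : (ι → Bool) → Prop}
    {f : (ι → Bool) → ℝ} (h0 : ∀ x, 0 ≤ f x) (h1 : ∀ x, A x → 1 ≤ f x) : bP p A ≤ bE p f :=
  bE_mono hp fun x => by
    split_ifs with h
    · exact h1 x h
    · exact h0 x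

/-- The vector that agrees with `y` on `s` and with `x` elsewhere. -/
def mix (s : Set ι) (x y : ι → Bool) : ι → Bool := fun i => if i ∈ s then y i else x i

/-- Swapping the coordinates in `s` between two independent copies is a measure-preserving
involution. With `x` frozen, the inner expectation is a conditional expectation given the
coordinates outside `s`; the independence arguments below rest on it. -/
lemma bE_resample (p : ι → ℝ) (s : Set ι) (f : (ι → Bool) → ℝ) :
    bE p f = bE p fun x => bE p fun y => f (mix s x y) := by
  have hinv : ∀ x y : ι → Bool, bernProd p (mix s x y) * bernProd p (mix s y x) =
      bernProd p x * bernProd p y := by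
    intro x y
    simp only [bernProd_eq, ← Finset.prod_mul_distrib]
    refine Finset.prod_congr rfl fun i _ => ?_
    by_cases hi : i ∈ s <;> simp [mix, hi, mul_comm]
  let Φ : (ι → Bool) × (ι → Bool) → (ι → Bool) × (ι → Bool) :=
    fun w => (mix s w.1 w.2, mix s w.2 w.1)
  have hΦ : Function.Involutive Φ := by
    rintro ⟨x, y⟩
    simp only [Φ, Prod.mk.injEq]
    constructor <;> ext i <;> by_cases hi : i ∈ s <;> simp [mix, hi]
  have h1 : bE p f = ∑ w : (ι → Bool) × (ι → Bool), bernProd p w.1 * bernProd p w.2 * f w.1 := by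
    rw [Fintype.sum_prod_type, bE]
    refine Finset.sum_congr rfl fun x _ => ?_
    dsimp only
    rw [← Finset.sum_mul, ← Finset.mul_sum, sum_bernProd, mul_one]
  rw [h1, ← Equiv.sum_comp hΦ.toPerm, Fintype.sum_prod_type, bE]
  refine Finset.sum_congr rfl fun x _ => ?_
  rw [bE, Finset.mul_sum]
  refine Finset.sum_congr rfl fun y _ => ?_
  simp only [Function.Involutive.coe_toPerm, Φ, hinv]
  ring

lemma bP_resample (p : ι → ℝ) (s : Set ι) (A : (ι → Bool) → Prop) :
    bP p A = bE p fun x => bP p fun y => A (mix s x y) :=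
  bE_resample p s _

lemma mix_of_mem {ι : Type} {s : Set ι} (x y : ι → Bool) {i : ι} (hi : i ∈ s) : mix s x y i = y i := by
  simp [mix, hi]

lemma mix_of_notMem {ι : Type} {s : Set ι} (x y : ι → Bool) {i : ι} (hi : i ∉ s) : mix s x y i = x i := by
  simp [mix, hi]

lemma bE_mul_of_dependsOn (p : ι → ℝ) {s : Set ι} {f g : (ι → Bool) → ℝ}
    (hf : DependsOn f s) (hg : DependsOn g sᶜ) :
    bE p (fun x => f x * g x) = bE p f * bE p g := by
  rw [bE_resample p s]
  have : ∀ x y, f (mix s x y) * g (mix s x y) = g x * f y := by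
    intro x y
    rw [hf (x := mix s x y) (y := y) fun i hi => mix_of_mem x y hi,
      hg (x := mix s x y) (y := x) fun i hi => mix_of_notMem x y hi, mul_comm]
  simp only [this, bE_const_mul]
  simp_rw [mul_comm _ (bE p f), bE_const_mul]

lemma dependsOn_prod {ι : Type} {σ : Type*} (T : Finset σ) {h : σ → (ι → Bool) → ℝ} {s : σ → Set ι}
    {t : Set ι} (hd : ∀ a ∈ T, DependsOn (h a) (s a)) (hs : ∀ a ∈ T, s a ⊆ t) :
    DependsOn (fun x => ∏ a ∈ T, h a x) t := fun _ _ hxy =>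
  Finset.prod_congr rfl fun a ha => hd a ha fun i hi => hxy i (hs a ha hi)

lemma bE_prod_of_dependsOn (p : ι → ℝ) {σ : Type*} (T : Finset σ) {h : σ → (ι → Bool) → ℝ}
    {s : σ → Set ι} (hd : ∀ a ∈ T, DependsOn (h a) (s a))
    (hs : ∀ a ∈ T, ∀ b ∈ T, a ≠ b → Disjoint (s a) (s b)) :
    bE p (fun x => ∏ a ∈ T, h a x) = ∏ a ∈ T, bE p (h a) := by
  induction T using Finset.induction_on with
  | empty => simp [bE_const]
  | insert a T ha ih =>
    simp only [Finset.prod_insert ha]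
    rw [bE_mul_of_dependsOn p (s := s a) (hd a (by simp)), ih]
    · exact fun b hb => hd b (by simp [hb])
    · exact fun b hb c hc => hs b (by simp [hb]) c (by simp [hc])
    · refine dependsOn_prod T (s := s) (fun b hb => hd b (by simp [hb])) fun b hb => ?_
      have hne : a ≠ b := fun h => ha (h ▸ hb)
      exact (hs a (by simp) b (by simp [hb]) hne).subset_compl_left

/-- The marginal of a product law along an injection is the product of the selected factors. This
makes rows of the adjacency matrix and induced subgraphs product laws of their own. -/
lemma bE_comp (p : ι → ℝ) {e : κ → ι} (he : Function.Injective e) (f : (κ → Bool) → ℝ) :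
    bE p (fun x => f (fun k => x (e k))) = bE (fun k => p (e k)) f := by
  have key : ∀ y : κ → Bool,
      bE p (fun x => if (fun k => x (e k)) = y then 1 else 0) = bernProd (fun k => p (e k)) y := by
    intro y
    -- Off the range of `e` the inner product is empty, so the indicator becomes a product over all
    -- coordinates, as `bE_prod` requires.
    have h1 : ∀ x : ι → Bool, (if (fun k => x (e k)) = y then (1 : ℝ) else 0) =
        ∏ i, ∏ k ∈ Finset.univ.filter (fun k => e k = i), if x i = y k then (1 : ℝ) else 0 := by
      intro x
      have h2 : (∏ i, ∏ k ∈ Finset.univ.filter (fun k => e k = i),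
          if x i = y k then (1 : ℝ) else 0) = ∏ k, if x (e k) = y k then (1 : ℝ) else 0 := by
        rw [← Finset.prod_fiberwise (s := Finset.univ) (g := e)]
        refine Finset.prod_congr rfl fun i _ => Finset.prod_congr rfl fun k hk => ?_
        rw [(Finset.mem_filter.1 hk).2]
      rw [h2]
      split_ifs with h
      · rw [Finset.prod_eq_one]
        intro k _
        rw [if_pos (congrFun h k)]
      · obtain ⟨k, hk⟩ := Function.ne_iff.1 h
        exact (Finset.prod_eq_zero (Finset.mem_univ k) (if_neg hk)).symm
    simp only [h1]
    rw [bE_prod p (fun i b => ∏ k ∈ Finset.univ.filter (fun k => e k = i),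
      if b = y k then (1 : ℝ) else 0), bernProd_eq]
    symm
    apply Fintype.prod_of_injective e he
    · intro i hi
      have : Finset.univ.filter (fun k => e k = i) = ∅ := by
        ext k; simp only [Finset.mem_filter, Finset.mem_univ, true_and, Finset.notMem_empty,
          iff_false]
        exact fun h => hi ⟨k, h⟩
      simp [this]
    · intro k
      have : Finset.univ.filter (fun k' => e k' = e k) = {k} := by
        ext k'; simp [he.eq_iff]
      rw [this]
      cases h : y k <;> simp [bw, h]
  have h3 : ∀ x : ι → Bool, f (fun k => x (e k)) =
      ∑ y, f y * if (fun k => x (e k)) = y then (1 : ℝ) else 0 := by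
    intro x; simp
  simp only [h3]
  rw [bE_sum]
  simp only [bE_const_mul, key]
  rw [bE]
  exact Finset.sum_congr rfl fun y _ => mul_comm _ _

lemma bP_comp (p : ι → ℝ) {e : κ → ι} (he : Function.Injective e) (A : (κ → Bool) → Prop) :
    bP p (fun x => A (fun k => x (e k))) = bP (fun k => p (e k)) A :=
  bE_comp p he fun y => if A y then 1 else 0

lemma bE_coord (p : ι → ℝ) (j : ι) (h : Bool → ℝ) :
    bE p (fun x => h (x j)) = p j * h true + (1 - p j) * h false := by
  have := bE_comp p (κ := Unit) (e := fun _ => j) (fun _ _ _ => rfl) (fun y => h (y ()))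
  rw [this]
  have h2 := bE_prod (ι := Unit) (fun _ => p j) (fun _ b => h b)
  simpa using h2

lemma bE_update (p : ι → ℝ) (j : ι) (f : (ι → Bool) → ℝ) :
    bE p f = bE p fun x => p j * f (Function.update x j true) +
      (1 - p j) * f (Function.update x j false) := by
  rw [bE_resample p {j}]
  congr 1; ext x
  have : ∀ y : ι → Bool, f (mix {j} x y) = (fun b => f (Function.update x j b)) (y j) := by
    intro y
    show _ = f _
    congr 1; ext i
    by_cases hi : i = j
    · subst hi; simp [mix]
    · simp [mix, hi]
  simp only [this]
  exact bE_coord p j (fun b => f (Function.update x j b))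

/-- Integration by parts for Bernoulli variables. -/
lemma bE_centered_mul (p : ι → ℝ) (j : ι) (f : (ι → Bool) → ℝ) :
    bE p (fun x => (bit (x j) - p j) * f x) = p j * (1 - p j) *
      bE p (fun x => f (Function.update x j true) - f (Function.update x j false)) := by
  rw [bE_update p j, ← bE_const_mul]
  congr 1; ext x
  simp only [Function.update_self, bit_true, bit_false]
  ring

/-- Integration by parts in each coordinate: the discrete derivative of the linear statistic in
direction `j` is the constant `a j`, so no cross terms appear. -/
lemma bE_variance (p a : ι → ℝ) :
    bE p (fun x => (∑ j, a j * (bit (x j) - p j)) ^ 2) = ∑ j, a j ^ 2 * (p j * (1 - p j)) := by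
  have h : ∀ x : ι → Bool, (∑ j, a j * (bit (x j) - p j)) ^ 2 =
      ∑ j, a j * ((bit (x j) - p j) * ∑ i, a i * (bit (x i) - p i)) := by
    intro x
    rw [sq, Finset.sum_mul]
    exact Finset.sum_congr rfl fun j _ => by ring
  simp only [h, bE_sum, bE_const_mul]
  refine Finset.sum_congr rfl fun j _ => ?_
  rw [bE_centered_mul p j (fun x => ∑ i, a i * (bit (x i) - p i))]
  have h2 : ∀ x : ι → Bool, (∑ i, a i * (bit (Function.update x j true i) - p i)) -
      ∑ i, a i * (bit (Function.update x j false i) - p i) = a j := by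
    intro x
    rw [← Finset.sum_sub_distrib, Finset.sum_eq_single j]
    · simp; ring
    · intro i _ hi; simp [hi]
    · simp
  simp only [h2, bE_const]
  ring

/-- The variance of `|f|` is nonnegative. -/
lemma bE_abs_le {p : ι → ℝ} (hp : ∀ i, 0 ≤ p i ∧ p i ≤ 1) (f : (ι → Bool) → ℝ) :
    bE p (fun x => |f x|) ≤ Real.sqrt (bE p fun x => f x ^ 2) := by
  apply Real.le_sqrt_of_sq_le
  have h := bE_nonneg hp (f := fun x => (|f x| - bE p fun x => |f x|) ^ 2) fun x => sq_nonneg _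
  set m := bE p fun x => |f x|
  have h2 : ∀ x, (|f x| - m) ^ 2 = f x ^ 2 - 2 * m * |f x| + m ^ 2 := by
    intro x; rw [sub_sq, sq_abs]; ring
  simp only [h2, bE_add, bE_sub, bE_const_mul, bE_const] at h
  change 0 ≤ _ - 2 * m * m + m ^ 2 at h
  linarith

/-- Jensen's inequality for the exponential. -/
lemma exp_bE_le {p : ι → ℝ} (hp : ∀ i, 0 ≤ p i ∧ p i ≤ 1) (f : (ι → Bool) → ℝ) :
    Real.exp (bE p f) ≤ bE p fun x => Real.exp (f x) := by
  have h : ∀ x, Real.exp (bE p f) * (f x - bE p f + 1) ≤ Real.exp (f x) := by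
    intro x
    have := Real.add_one_le_exp (f x - bE p f)
    calc _ ≤ Real.exp (bE p f) * Real.exp (f x - bE p f) :=
          mul_le_mul_of_nonneg_left this (Real.exp_pos _).le
      _ = _ := by rw [← Real.exp_add]; congr 1; ring
  have h2 := bE_mono hp h
  rw [bE_const_mul, bE_add, bE_sub, bE_const, bE_const] at h2
  linarith

/-- Flipping coordinate `j` is an involution. This permits coordinatewise arguments for weights that
are not products, such as the minimum of two product masses. -/
lemma sum_update (j : ι) (f : (ι → Bool) → ℝ) :
    2 * ∑ x, f x = ∑ x, (f (Function.update x j true) + f (Function.update x j false)) := by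
  have hinv : Function.Involutive (fun x : ι → Bool => Function.update x j (!x j)) := by
    intro x; ext i; by_cases hi : i = j
    · subst hi; simp
    · simp [hi]
  have h1 : ∑ x, f x = ∑ x, f (Function.update x j (!x j)) :=
    (Equiv.sum_comp hinv.toPerm f).symm
  rw [two_mul]
  conv_lhs => rw [h1]
  conv_lhs => arg 2; rw [← h1]
  rw [← Finset.sum_add_distrib]
  refine Finset.sum_congr rfl fun x _ => ?_
  have hx : Function.update x j (x j) = x := Function.update_eq_self j x
  cases h : x j
  · rw [h] at hx; rw [hx]; simp
  · rw [h] at hx; rw [hx]; simp [add_comm]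

/-- If under the weights `m` the odds of `x j = true` given the other coordinates are at most `ρ`,
exponential tilting by `∑ c j x j` costs at most the factor `exp (ρ ∑ (exp (c j) - 1))`. -/
lemma sum_mul_exp_le (m : (ι → Bool) → ℝ) (hm : ∀ x, 0 ≤ m x) {ρ : ℝ} (hρ : 0 ≤ ρ)
    (hodds : ∀ x j, m (Function.update x j true) ≤ ρ * m (Function.update x j false))
    (c : ι → ℝ) (hc : ∀ j, 0 ≤ c j) :
    ∑ x, m x * Real.exp (∑ j, c j * bit (x j)) ≤
      Real.exp (ρ * ∑ j, (Real.exp (c j) - 1)) * ∑ x, m x := by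
  have key : ∀ T : Finset ι, ∑ x, m x * Real.exp (∑ j ∈ T, c j * bit (x j)) ≤
      Real.exp (ρ * ∑ j ∈ T, (Real.exp (c j) - 1)) * ∑ x, m x := by
    intro T
    induction T using Finset.induction_on with
    | empty => simp
    | insert a T ha ih =>
      have hstep : ∑ x, m x * Real.exp (∑ j ∈ insert a T, c j * bit (x j)) ≤
          Real.exp (ρ * (Real.exp (c a) - 1)) *
            ∑ x, m x * Real.exp (∑ j ∈ T, c j * bit (x j)) := by
        have h2 := sum_update a (fun x => m x * Real.exp (∑ j ∈ insert a T, c j * bit (x j)))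
        have h3 := sum_update a (fun x => m x * Real.exp (∑ j ∈ T, c j * bit (x j)))
        suffices h : ∑ x, (m (Function.update x a true) *
              Real.exp (∑ j ∈ insert a T, c j * bit (Function.update x a true j)) +
            m (Function.update x a false) *
              Real.exp (∑ j ∈ insert a T, c j * bit (Function.update x a false j))) ≤
            Real.exp (ρ * (Real.exp (c a) - 1)) * ∑ x, (m (Function.update x a true) *
              Real.exp (∑ j ∈ T, c j * bit (Function.update x a true j)) +
            m (Function.update x a false) *
              Real.exp (∑ j ∈ T, c j * bit (Function.update x a false j))) by
          rw [← h2, ← h3] at h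
          linarith
        rw [Finset.mul_sum]
        refine Finset.sum_le_sum fun x _ => ?_
        have hT : ∀ b, ∑ j ∈ T, c j * bit (Function.update x a b j) =
            ∑ j ∈ T, c j * bit (x j) := by
          intro b
          refine Finset.sum_congr rfl fun j hj => ?_
          rw [Function.update_of_ne]
          rintro rfl; exact ha hj
        simp only [Finset.sum_insert ha, hT, Function.update_self, bit_true, bit_false, mul_one,
          mul_zero, zero_add, Real.exp_add]
        set A := m (Function.update x a true)
        set B := m (Function.update x a false)
        set W := Real.exp (∑ j ∈ T, c j * bit (x j))
        have hA : 0 ≤ A := hm _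
        have hAB : A ≤ ρ * B := hodds x a
        have hW : 0 < W := Real.exp_pos _
        have hE : 0 ≤ Real.exp (c a) - 1 := by
          have := Real.add_one_le_exp (c a); have := hc a; linarith
        have hexp := Real.add_one_le_exp (ρ * (Real.exp (c a) - 1))
        have hB : 0 ≤ B := hm _
        -- The excess `A (exp (c a) - 1)` is at most `ρ (exp (c a) - 1) B` by the odds bound.
        have h4 : A * Real.exp (c a) + B ≤ (ρ * (Real.exp (c a) - 1) + 1) * (A + B) := by
          nlinarith [mul_le_mul_of_nonneg_right hAB hE, mul_nonneg (mul_nonneg hρ hE) hA]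
        calc A * (Real.exp (c a) * W) + B * W = (A * Real.exp (c a) + B) * W := by ring
          _ ≤ ((ρ * (Real.exp (c a) - 1) + 1) * (A + B)) * W := by gcongr
          _ ≤ (Real.exp (ρ * (Real.exp (c a) - 1)) * (A + B)) * W := by gcongr
          _ = _ := by ring
      calc _ ≤ _ := hstep
        _ ≤ Real.exp (ρ * (Real.exp (c a) - 1)) *
            (Real.exp (ρ * ∑ j ∈ T, (Real.exp (c j) - 1)) * ∑ x, m x) := by gcongr
        _ = _ := by
          rw [Finset.sum_insert ha, mul_add, Real.exp_add]; ring
  exact key Finset.univ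

end Bernoulli

/-! ### Chernoff information of comparable product Bernoulli laws -/

section Chernoff

variable {V : Type}

/-- Two vectors of Bernoulli parameters of the same order `ps`, bounded away from `1`. -/
structure Comparable (ε ω ps : ℝ) (p q : V → ℝ) : Prop where
  eps_pos : 0 < ε
  one_le : 1 ≤ ω
  ps_pos : 0 < ps
  ps_le : ps ≤ 1 - ε
  p_lower : ∀ j, ps / ω ≤ p j
  p_upper : ∀ j, p j ≤ ps
  q_lower : ∀ j, ps / ω ≤ q j
  q_upper : ∀ j, q j ≤ ps

/-- Log-likelihood ratio of `Bern(b)` to `Bern(a)` at the outcome `t`. -/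
def lr (a b : ℝ) (t : Bool) : ℝ := Real.log (bw b t) - Real.log (bw a t)

/-- Log-likelihood ratio of `⨂ Bern(q j)` to `⨂ Bern(p j)`. -/
def llr [Fintype V] (p q : V → ℝ) (x : V → Bool) : ℝ := ∑ j, lr (p j) (q j) (x j)

/-- Difference of the log-odds of `b` and `a`. -/
def logOdds (a b : ℝ) : ℝ := lr a b true - lr a b false

/-- Chi-square type separation of two parameter vectors. -/
def chiSep [Fintype V] (ps : ℝ) (p q : V → ℝ) : ℝ := ∑ j, (p j - q j) ^ 2 / ps

variable {ε ω ps : ℝ} {p q : V → ℝ}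

lemma Comparable.symm (h : Comparable ε ω ps p q) : Comparable ε ω ps q p :=
  ⟨h.eps_pos, h.one_le, h.ps_pos, h.ps_le, h.q_lower, h.q_upper, h.p_lower, h.p_upper⟩

lemma Comparable.omega_pos (h : Comparable ε ω ps p q) : 0 < ω := by linarith [h.one_le]

lemma Comparable.p_pos (h : Comparable ε ω ps p q) (j : V) : 0 < p j :=
  lt_of_lt_of_le (div_pos h.ps_pos h.omega_pos) (h.p_lower j)

lemma Comparable.p_le (h : Comparable ε ω ps p q) (j : V) : p j ≤ 1 - ε :=
  (h.p_upper j).trans h.ps_le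

lemma Comparable.p_mem (h : Comparable ε ω ps p q) (j : V) : 0 < p j ∧ p j < 1 :=
  ⟨h.p_pos j, by linarith [h.p_le j, h.eps_pos]⟩

lemma Comparable.p_mem' (h : Comparable ε ω ps p q) (j : V) : 0 ≤ p j ∧ p j ≤ 1 :=
  ⟨(h.p_mem j).1.le, (h.p_mem j).2.le⟩

lemma Comparable.bwp_pos (h : Comparable ε ω ps p q) (j : V) (b : Bool) : 0 < bw (p j) b :=
  bw_pos (h.p_mem j).1 (h.p_mem j).2 b

lemma Comparable.bwq_pos (h : Comparable ε ω ps p q) (j : V) (b : Bool) : 0 < bw (q j) b :=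
  h.symm.bwp_pos j b

variable [Fintype V]

lemma mul_exp_lr {a b : ℝ} (t : Bool) (ha : 0 < bw a t) (hb : 0 < bw b t) :
    bw a t * Real.exp (lr a b t) = bw b t := by
  rw [lr, Real.exp_sub, Real.exp_log hb, Real.exp_log ha]
  field_simp

lemma Comparable.bernProd_q (h : Comparable ε ω ps p q) (x : V → Bool) :
    bernProd q x = bernProd p x * Real.exp (llr p q x) := by
  rw [llr, Real.exp_sum, bernProd_eq, bernProd_eq, ← Finset.prod_mul_distrib]
  exact Finset.prod_congr rfl fun j _ => (mul_exp_lr _ (h.bwp_pos j _) (h.bwq_pos j _)).symm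

lemma lr_swap (a b : ℝ) (t : Bool) : lr b a t = -lr a b t := by simp [lr]

lemma llr_swap (p q : V → ℝ) (x : V → Bool) : llr q p x = -llr p q x := by
  simp only [llr, lr_swap (p _) (q _), Finset.sum_neg_distrib]

lemma llr_eq (p q : V → ℝ) (x : V → Bool) :
    llr p q x = ∑ j, lr (p j) (q j) false + ∑ j, logOdds (p j) (q j) * bit (x j) := by
  rw [llr, ← Finset.sum_add_distrib]
  refine Finset.sum_congr rfl fun j _ => ?_
  cases h : x j <;> simp [logOdds]

/-- The Chernoff sum `∑ φ₀^(1-α) φ₁^α`, as an expectation. -/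
def cSum (p q : V → ℝ) (α : ℝ) : ℝ := bE p fun x => Real.exp (α * llr p q x)

lemma Comparable.rpow_mul_rpow (h : Comparable ε ω ps p q) (α : ℝ) (x : V → Bool) :
    bernProd p x ^ (1 - α) * bernProd q x ^ α = bernProd p x * Real.exp (α * llr p q x) := by
  have hp := bernProd_pos h.p_mem x
  rw [h.bernProd_q x, Real.mul_rpow hp.le (Real.exp_pos _).le, ← mul_assoc, ← Real.rpow_add hp,
    ← Real.exp_mul]
  simp [mul_comm]

lemma Comparable.chernoffDiv_eq (h : Comparable ε ω ps p q) (α : ℝ) :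
    chernoffDiv α (bernProd p) (bernProd q) = -Real.log (cSum p q α) := by
  rw [chernoffDiv, cSum, bE]
  simp only [h.rpow_mul_rpow]

lemma cSum_pos (h : Comparable ε ω ps p q) (α : ℝ) : 0 < cSum p q α :=
  Finset.sum_pos (fun x _ => mul_pos (bernProd_pos h.p_mem x) (Real.exp_pos _)) (by simp)

lemma cSum_swap (h : Comparable ε ω ps p q) (α : ℝ) : cSum q p (1 - α) = cSum p q α := by
  rw [cSum, cSum, bE, bE]
  refine Finset.sum_congr rfl fun x _ => ?_
  rw [h.bernProd_q x, mul_assoc, ← Real.exp_add, llr_swap]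
  congr 2; ring

lemma cSum_eq_prod (p q : V → ℝ) (α : ℝ) :
    cSum p q α = ∏ j, (p j * Real.exp (α * lr (p j) (q j) true) +
      (1 - p j) * Real.exp (α * lr (p j) (q j) false)) := by
  rw [cSum, ← bE_prod p (fun j b => Real.exp (α * lr (p j) (q j) b))]
  congr 1; ext x
  rw [llr, Finset.mul_sum, Real.exp_sum]

lemma chiSep_nonneg (h : Comparable ε ω ps p q) : 0 ≤ chiSep ps p q :=
  Finset.sum_nonneg fun _ _ => div_nonneg (sq_nonneg _) h.ps_pos.le

lemma chiSep_swap (ps : ℝ) (p q : V → ℝ) : chiSep ps q p = chiSep ps p q :=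
  Finset.sum_congr rfl fun _ _ => by rw [← neg_sub, neg_sq]

lemma chiSep_le (h : Comparable ε ω ps p q) : chiSep ps p q ≤ Fintype.card V * ps := by
  have : ∀ j ∈ (Finset.univ : Finset V), (p j - q j) ^ 2 / ps ≤ ps := by
    intro j _
    rw [div_le_iff₀ h.ps_pos, ← sq]
    have h1 := h.p_pos j; have h2 := h.symm.p_pos j
    have h3 := h.p_upper j; have h4 := h.q_upper j
    exact sq_le_sq' (by linarith) (by linarith)
  calc _ ≤ ∑ _j : V, ps := Finset.sum_le_sum this
    _ = _ := by simp

/-- The Kullback-Leibler divergence is at most the chi-square divergence: apply `log t ≤ t - 1` at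
each outcome. -/
lemma lr_mean_ge {a b : ℝ} (ha : 0 < a) (ha1 : a < 1) (hb : 0 < b) (hb1 : b < 1) :
    -((a - b) ^ 2 / (b * (1 - b))) ≤ a * lr a b true + (1 - a) * lr a b false := by
  have key : ∀ u v : ℝ, 0 < u → 0 < v → -(u / v - 1) ≤ Real.log v - Real.log u := by
    intro u v hu hv
    have := Real.log_le_sub_one_of_pos (div_pos hu hv)
    rw [Real.log_div hu.ne' hv.ne'] at this
    linarith
  have h1 := mul_le_mul_of_nonneg_left (key a b ha hb) ha.le
  have h2 := mul_le_mul_of_nonneg_left (key (1 - a) (1 - b) (by linarith) (by linarith))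
    (by linarith : 0 ≤ 1 - a)
  simp only [lr, bw_true, bw_false]
  have h3 : -((a - b) ^ 2 / (b * (1 - b))) =
      a * -(a / b - 1) + (1 - a) * -((1 - a) / (1 - b) - 1) := by
    have : 1 - b ≠ 0 := by linarith
    field_simp
    ring
  linarith

lemma exp_mean_le {a : ℝ} (ha : 0 ≤ a) (ha1 : a ≤ 1) (u v : ℝ) :
    Real.exp (a * u + (1 - a) * v) ≤ a * Real.exp u + (1 - a) * Real.exp v := by
  have := convexOn_exp.2 (Set.mem_univ u) (Set.mem_univ v) ha (by linarith : 0 ≤ 1 - a)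
    (by ring)
  simpa using this

/-- Jensen's inequality bounds the sum below by `exp (-α KL)`, and the divergence is at most of
order `chiSep`. The factor `α` in the exponent matters: it will keep the optimal exponent away from
the end points. -/
lemma le_cSum (h : Comparable ε ω ps p q) {α : ℝ} (hα : 0 ≤ α) :
    Real.exp (-(α * (ω / ε * chiSep ps p q))) ≤ cSum p q α := by
  rw [cSum_eq_prod, chiSep, Finset.mul_sum, Finset.mul_sum, ← Finset.sum_neg_distrib,
    Real.exp_sum]
  refine Finset.prod_le_prod (fun j _ => (Real.exp_pos _).le) fun j _ => ?_
  have hp := h.p_mem j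
  have hq := h.symm.p_mem j
  refine le_trans ?_ (exp_mean_le hp.1.le hp.2.le _ _)
  apply Real.exp_le_exp.2
  have h1 := mul_le_mul_of_nonneg_left (lr_mean_ge hp.1 hp.2 hq.1 hq.2) hα
  have h2 : (p j - q j) ^ 2 / (q j * (1 - q j)) ≤ ω / ε * ((p j - q j) ^ 2 / ps) := by
    rw [div_mul_div_comm, mul_comm ω, ← div_div_eq_mul_div]
    refine div_le_div_of_nonneg_left (sq_nonneg _)
      (div_pos (mul_pos h.eps_pos h.ps_pos) h.omega_pos) ?_
    rw [mul_comm ε, mul_div_right_comm]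
    have h3 := h.q_lower j
    have h4 := h.symm.p_le j
    exact mul_le_mul h3 (by linarith) h.eps_pos.le hq.1.le
  have h5 := mul_le_mul_of_nonneg_left h2 hα
  nlinarith

lemma le_cSum' (h : Comparable ε ω ps p q) {α : ℝ} (hα : α ≤ 1) :
    Real.exp (-((1 - α) * (ω / ε * chiSep ps p q))) ≤ cSum p q α := by
  rw [← cSum_swap h, ← chiSep_swap ps p q]
  exact le_cSum h.symm (by linarith)

/-- The second root is at most the arithmetic mean, and the first is `(a + b - (√a - √b)²) / 2`.
Since `(√a + √b)² ≤ 4 ps`, the square `(√a - √b)²` is at least `(a - b)² / (4 ps)`. -/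
lemma bhattacharyya_le {ps a b : ℝ} (hps : 0 < ps) (ha : 0 < a) (ha1 : a < 1) (hb : 0 < b)
    (hb1 : b < 1) (hap : a ≤ ps) (hbp : b ≤ ps) :
    Real.sqrt (a * b) + Real.sqrt ((1 - a) * (1 - b)) ≤ Real.exp (-((a - b) ^ 2 / ps / 8)) := by
  refine le_trans ?_ (Real.add_one_le_exp _)
  have h1 : Real.sqrt ((1 - a) * (1 - b)) ≤ (2 - a - b) / 2 := by
    apply Real.sqrt_le_iff.2
    constructor
    · linarith
    · nlinarith [sq_nonneg (a - b)]
  have h2 : (a - b) ^ 2 / ps ≤ 4 * (Real.sqrt a - Real.sqrt b) ^ 2 := by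
    have hsa := Real.sq_sqrt ha.le
    have hsb := Real.sq_sqrt hb.le
    rw [div_le_iff₀ hps]
    have h3 : (a - b) ^ 2 = (Real.sqrt a - Real.sqrt b) ^ 2 * (Real.sqrt a + Real.sqrt b) ^ 2 := by
      rw [← mul_pow, ← hsa, ← hsb]
      simp only [Real.sqrt_sq (Real.sqrt_nonneg _)]
      ring
    have h4 : (Real.sqrt a + Real.sqrt b) ^ 2 ≤ 4 * ps := by
      nlinarith [sq_nonneg (Real.sqrt a - Real.sqrt b)]
    rw [h3]
    nlinarith [mul_le_mul_of_nonneg_left h4 (sq_nonneg (Real.sqrt a - Real.sqrt b))]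
  have h5 : Real.sqrt (a * b) = (a + b - (Real.sqrt a - Real.sqrt b) ^ 2) / 2 := by
    rw [Real.sqrt_mul ha.le]
    nlinarith [Real.sq_sqrt ha.le, Real.sq_sqrt hb.le]
  rw [h5]
  linarith

lemma bw_mul_exp_half {a b : ℝ} (t : Bool) (ha : 0 < bw a t) (hb : 0 < bw b t) :
    bw a t * Real.exp (1 / 2 * lr a b t) = Real.sqrt (bw a t * bw b t) := by
  symm
  rw [Real.sqrt_eq_iff_mul_self_eq (by positivity) (by positivity)]
  have : Real.exp (1 / 2 * lr a b t) * Real.exp (1 / 2 * lr a b t) = bw b t / bw a t := by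
    rw [← Real.exp_add, ← add_mul, lr]
    norm_num
    rw [Real.exp_sub, Real.exp_log hb, Real.exp_log ha]
  have h2 : bw a t * Real.exp (1 / 2 * lr a b t) * (bw a t * Real.exp (1 / 2 * lr a b t)) =
      bw a t * bw a t * (Real.exp (1 / 2 * lr a b t) * Real.exp (1 / 2 * lr a b t)) := by ring
  rw [h2, this]
  field_simp

lemma cSum_half_le (h : Comparable ε ω ps p q) :
    cSum p q (1 / 2) ≤ Real.exp (-(chiSep ps p q / 8)) := by
  rw [cSum_eq_prod, chiSep, Finset.sum_div, ← Finset.sum_neg_distrib, Real.exp_sum]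
  refine Finset.prod_le_prod (fun j _ => ?_) fun j _ => ?_
  · have := h.p_mem j
    have : 0 ≤ 1 - p j := by linarith
    have := (h.p_pos j).le
    positivity
  · have hp := h.p_mem j
    have hq := h.symm.p_mem j
    have h1 := bw_mul_exp_half true (h.bwp_pos j true) (h.bwq_pos j true)
    have h2 := bw_mul_exp_half false (h.bwp_pos j false) (h.bwq_pos j false)
    simp only [bw_true, bw_false] at h1 h2
    rw [h1, h2]
    exact bhattacharyya_le h.ps_pos hp.1 hp.2 hq.1 hq.2 (h.p_upper j) (h.q_upper j)

lemma Comparable.bddAbove (h : Comparable ε ω ps p q) :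
    BddAbove (Set.range fun α : Set.Ioo (0 : ℝ) 1 =>
      chernoffDiv (α : ℝ) (bernProd p) (bernProd q)) := by
  refine ⟨ω / ε * chiSep ps p q, ?_⟩
  rintro _ ⟨⟨α, hα0, hα1⟩, rfl⟩
  simp only [h.chernoffDiv_eq]
  have h1 := (Real.le_log_iff_exp_le (cSum_pos h α)).2 (le_cSum h hα0.le)
  have h2 : 0 ≤ ω / ε * chiSep ps p q :=
    mul_nonneg (div_nonneg h.omega_pos.le h.eps_pos.le) (chiSep_nonneg h)
  nlinarith

/-- With `le_chernoffInfo`, this makes the Chernoff information equivalent to `chiSep`. The latter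
is a sum over nodes and restricts well to subsets of nodes, unlike a supremum over `α`. -/
lemma chernoffInfo_le (h : Comparable ε ω ps p q) :
    chernoffInfo (bernProd p) (bernProd q) ≤ ω / ε * chiSep ps p q := by
  have : Nonempty (Set.Ioo (0 : ℝ) 1) := ⟨⟨1 / 2, by norm_num, by norm_num⟩⟩
  refine ciSup_le ?_
  rintro ⟨α, hα0, hα1⟩
  simp only [h.chernoffDiv_eq]
  have h1 := (Real.le_log_iff_exp_le (cSum_pos h α)).2 (le_cSum h hα0.le)
  have h2 : 0 ≤ ω / ε * chiSep ps p q :=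
    mul_nonneg (div_nonneg h.omega_pos.le h.eps_pos.le) (chiSep_nonneg h)
  nlinarith

lemma le_chernoffInfo (h : Comparable ε ω ps p q) :
    chiSep ps p q / 8 ≤ chernoffInfo (bernProd p) (bernProd q) := by
  refine le_trans ?_ (le_ciSup h.bddAbove ⟨1 / 2, by norm_num, by norm_num⟩)
  simp only [h.chernoffDiv_eq]
  have := Real.log_le_log (cSum_pos h _) (cSum_half_le h)
  rw [Real.log_exp] at this
  linarith

lemma affinity_eq (h : Comparable ε ω ps p q) :
    affinity (bernProd p) (bernProd q) = bE p fun x => min 1 (Real.exp (llr p q x)) := by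
  refine Finset.sum_congr rfl fun x _ => ?_
  rw [h.bernProd_q x, mul_min_of_nonneg _ _ (bernProd_pos h.p_mem x).le, mul_one]

lemma affinity_pos (h : Comparable ε ω ps p q) : 0 < affinity (bernProd p) (bernProd q) :=
  Finset.sum_pos (fun x _ => lt_min (bernProd_pos h.p_mem x) (bernProd_pos h.symm.p_mem x))
    (by simp)

/-- For `α` inside `(0,1)` this retains a two-sided decay in `t` that the plain bound `exp (α t)`
discards. Anticoncentration acts on this extra factor. -/
lemma min_one_exp_le {α c t : ℝ} (h1 : c ≤ α) (h2 : c ≤ 1 - α) :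
    min 1 (Real.exp t) ≤ Real.exp (α * t) * Real.exp (-(c * |t|)) := by
  rw [← Real.exp_add]
  rcases le_total 0 t with ht | ht
  · refine (min_le_left _ _).trans (Real.one_le_exp ?_)
    rw [abs_of_nonneg ht]; nlinarith
  · refine (min_le_right _ _).trans (Real.exp_le_exp.2 ?_)
    rw [abs_of_nonpos ht]; nlinarith

lemma affinity_le_cSum (h : Comparable ε ω ps p q) {α : ℝ} (h0 : 0 ≤ α) (h1 : α ≤ 1) :
    affinity (bernProd p) (bernProd q) ≤ cSum p q α := by
  rw [affinity_eq h]
  refine bE_mono h.p_mem' fun x => ?_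
  simpa using min_one_exp_le (c := 0) (t := llr p q x) h0 (by linarith)

lemma affinity_le_exp (h : Comparable ε ω ps p q) :
    affinity (bernProd p) (bernProd q) ≤
      Real.exp (-chernoffInfo (bernProd p) (bernProd q)) := by
  have : Nonempty (Set.Ioo (0 : ℝ) 1) := ⟨⟨1 / 2, by norm_num, by norm_num⟩⟩
  rw [← Real.log_le_iff_le_exp (affinity_pos h), le_neg]
  refine ciSup_le ?_
  rintro ⟨α, hα0, hα1⟩
  simp only [h.chernoffDiv_eq, neg_le_neg_iff]
  exact Real.log_le_log (affinity_pos h) (affinity_le_cSum h hα0.le hα1.le)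

/-- The optimal exponent exists, is bounded away from `0` and `1`, and the log-likelihood ratio is
centered under the corresponding tilted law. -/
lemma exists_optimal (h : Comparable ε ω ps p q) (hχ : 0 < chiSep ps p q) :
    ∃ α : ℝ, ε / (8 * ω) ≤ α ∧ ε / (8 * ω) ≤ 1 - α ∧
      cSum p q α = Real.exp (-chernoffInfo (bernProd p) (bernProd q)) ∧
      bE p (fun x => Real.exp (α * llr p q x) * llr p q x) = 0 := by
  have hderiv : ∀ α, HasDerivAt (cSum p q)
      (bE p (fun x => Real.exp (α * llr p q x) * llr p q x)) α := by
    intro α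
    unfold cSum bE
    apply HasDerivAt.fun_sum
    intro x _
    apply HasDerivAt.const_mul
    have := ((hasDerivAt_id α).mul_const (llr p q x)).exp
    simpa using this
  have hcont : Continuous (cSum p q) :=
    continuous_iff_continuousAt.2 fun α => (hderiv α).continuousAt
  obtain ⟨α, ⟨hα0, hα1⟩, hmin⟩ := (isCompact_Icc (a := (0 : ℝ)) (b := 1)).exists_isMinOn
    ⟨0, by simp⟩ hcont.continuousOn
  have hω := h.omega_pos
  have hε := h.eps_pos
  have hhalf : cSum p q α ≤ Real.exp (-(chiSep ps p q / 8)) :=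
    (hmin (show (1 / 2 : ℝ) ∈ Set.Icc 0 1 by norm_num)).trans (cSum_half_le h)
  -- Close to an end point the Jensen bound would exceed the value of the sum at `1 / 2`, which
  -- contradicts minimality.
  have hlow : ∀ t : ℝ, Real.exp (-(t * (ω / ε * chiSep ps p q))) ≤ cSum p q α →
      ε / (8 * ω) ≤ t := by
    intro t ht
    have h1 := Real.exp_le_exp.1 (ht.trans hhalf)
    have h2 : chiSep ps p q * (1 / 8) ≤ chiSep ps p q * (t * (ω / ε)) := by nlinarith
    have h3 := le_of_mul_le_mul_left h2 hχ
    rw [div_le_iff₀ (by positivity)]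
    have h4 := mul_le_mul_of_nonneg_right h3 hε.le
    have h5 : t * (ω / ε) * ε = t * ω := by field_simp
    rw [h5] at h4
    linarith
  have hl := hlow α (le_cSum h hα0)
  have hr := hlow (1 - α) (le_cSum' h hα1)
  have hc0 : 0 < ε / (8 * ω) := by positivity
  have hI : α ∈ Set.Ioo (0 : ℝ) 1 := ⟨by linarith, by linarith⟩
  refine ⟨α, hl, hr, ?_, ?_⟩
  · have hsup : chernoffInfo (bernProd p) (bernProd q) = -Real.log (cSum p q α) := by
      have : Nonempty (Set.Ioo (0 : ℝ) 1) := ⟨⟨α, hI⟩⟩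
      apply le_antisymm
      · refine ciSup_le ?_
        rintro ⟨a, ha0, ha1⟩
        simp only [h.chernoffDiv_eq, neg_le_neg_iff]
        exact Real.log_le_log (cSum_pos h _) (hmin ⟨ha0.le, ha1.le⟩)
      · rw [← h.chernoffDiv_eq]
        exact le_ciSup h.bddAbove ⟨α, hI⟩
    rw [hsup, neg_neg, Real.exp_log (cSum_pos h α)]
  · have hloc : IsLocalMin (cSum p q) α :=
      hmin.isLocalMin (Icc_mem_nhds hI.1 hI.2)
    exact hloc.hasDerivAt_eq_zero (hderiv α)

/-- Parameters of the tilted law. -/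
def tilt (p q : V → ℝ) (α : ℝ) (j : V) : ℝ :=
  p j * Real.exp (α * lr (p j) (q j) true) /
    (p j * Real.exp (α * lr (p j) (q j) true) + (1 - p j) * Real.exp (α * lr (p j) (q j) false))

/-- Tilting by the log-likelihood ratio, a sum over coordinates, preserves the product form. -/
lemma bE_exp_mul (h : Comparable ε ω ps p q) (α : ℝ) (f : (V → Bool) → ℝ) :
    bE p (fun x => Real.exp (α * llr p q x) * f x) = cSum p q α * bE (tilt p q α) f := by
  rw [bE, bE, Finset.mul_sum]
  refine Finset.sum_congr rfl fun x _ => ?_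
  rw [← mul_assoc, ← mul_assoc]
  congr 1
  rw [cSum_eq_prod, bernProd_eq, bernProd_eq, llr, Finset.mul_sum, Real.exp_sum,
    ← Finset.prod_mul_distrib, ← Finset.prod_mul_distrib]
  refine Finset.prod_congr rfl fun j _ => ?_
  have hp := h.p_mem j
  have h1 : 0 < p j * Real.exp (α * lr (p j) (q j) true) := mul_pos hp.1 (Real.exp_pos _)
  have h0 : 0 < (1 - p j) * Real.exp (α * lr (p j) (q j) false) :=
    mul_pos (by linarith) (Real.exp_pos _)
  have hne := (add_pos h1 h0).ne'
  cases x j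
  · simp only [bw_false, tilt]
    field_simp
    ring
  · simp only [bw_true, tilt]
    field_simp

lemma exp_mul_lr_bounds {a b m M α : ℝ} (t : Bool) (h0 : 0 ≤ α) (h1 : α ≤ 1) (hm : 0 < m)
    (ha : m ≤ bw a t) (hb : m ≤ bw b t) (ha' : bw a t ≤ M) (hb' : bw b t ≤ M) :
    m ≤ bw a t * Real.exp (α * lr a b t) ∧ bw a t * Real.exp (α * lr a b t) ≤ M := by
  have hapos : 0 < bw a t := hm.trans_le ha
  have hbpos : 0 < bw b t := hm.trans_le hb
  have hM : 0 < M := hapos.trans_le ha'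
  have heq : bw a t * Real.exp (α * lr a b t) =
      Real.exp ((1 - α) * Real.log (bw a t) + α * Real.log (bw b t)) := by
    rw [lr]
    nth_rewrite 1 [← Real.exp_log hapos]
    rw [← Real.exp_add]
    congr 1; ring
  rw [heq, ← Real.log_le_iff_le_exp hm, ← Real.le_log_iff_exp_le hM]
  have l1 := Real.log_le_log hm ha
  have l2 := Real.log_le_log hm hb
  have l3 := Real.log_le_log hapos ha'
  have l4 := Real.log_le_log hbpos hb'
  constructor <;> nlinarith

/-- Before normalization the tilted weights are geometric means of those of `p` and `q`. The
normalizer is at most `1` by the weighted arithmetic-geometric mean inequality and at least `ε`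
because of the outcome `false`. -/
lemma tilt_bounds (h : Comparable ε ω ps p q) {α : ℝ} (h0 : 0 ≤ α) (h1 : α ≤ 1) (j : V) :
    ps / ω ≤ tilt p q α j ∧ tilt p q α j ≤ ps / ε ∧ ε ≤ 1 - tilt p q α j := by
  have hp := h.p_mem j
  have hq := h.symm.p_mem j
  have hω := h.omega_pos
  have hε := h.eps_pos
  have hps := h.ps_pos
  have hT := exp_mul_lr_bounds (a := p j) (b := q j) (m := ps / ω) (M := ps) true h0 h1
    (by positivity) (by simpa using h.p_lower j) (by simpa using h.q_lower j)
    (by simpa using h.p_upper j) (by simpa using h.q_upper j)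
  have hF := exp_mul_lr_bounds (a := p j) (b := q j) (m := ε) (M := 1) false h0 h1 hε
    (by simp; linarith [h.p_le j]) (by simp; linarith [h.symm.p_le j])
    (by simp; linarith) (by simp; linarith)
  have hle1 : p j * Real.exp (α * lr (p j) (q j) true) +
      (1 - p j) * Real.exp (α * lr (p j) (q j) false) ≤ 1 := by
    have e1 := exp_mean_le (by linarith : 0 ≤ 1 - α) (by linarith : 1 - α ≤ 1)
      (Real.log (p j)) (Real.log (q j))
    have e0 := exp_mean_le (by linarith : 0 ≤ 1 - α) (by linarith : 1 - α ≤ 1)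
      (Real.log (1 - p j)) (Real.log (1 - q j))
    rw [Real.exp_log hp.1, Real.exp_log hq.1] at e1
    rw [Real.exp_log (by linarith), Real.exp_log (by linarith)] at e0
    have f1 : p j * Real.exp (α * lr (p j) (q j) true) =
        Real.exp ((1 - α) * Real.log (p j) + (1 - (1 - α)) * Real.log (q j)) := by
      simp only [lr, bw_true]
      nth_rewrite 1 [← Real.exp_log hp.1]
      rw [← Real.exp_add]
      congr 1; ring
    have f0 : (1 - p j) * Real.exp (α * lr (p j) (q j) false) =
        Real.exp ((1 - α) * Real.log (1 - p j) + (1 - (1 - α)) * Real.log (1 - q j)) := by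
      simp only [lr, bw_false]
      nth_rewrite 1 [← Real.exp_log (by linarith : 0 < 1 - p j)]
      rw [← Real.exp_add]
      congr 1; ring
    rw [f1, f0]
    linarith
  simp only [bw_true, bw_false] at hT hF
  rw [tilt]
  set a := p j * Real.exp (α * lr (p j) (q j) true)
  set b := (1 - p j) * Real.exp (α * lr (p j) (q j) false)
  have ha : 0 < a := lt_of_lt_of_le (by positivity) hT.1
  have hab : 0 < a + b := by linarith
  refine ⟨?_, ?_, ?_⟩
  · rw [le_div_iff₀ hab]
    have : 0 < ps / ω := by positivity
    nlinarith
  · rw [div_le_div_iff₀ hab hε]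
    nlinarith
  · have : 1 - a / (a + b) = b / (a + b) := by field_simp; ring
    rw [this, le_div_iff₀ hab]
    nlinarith

end Chernoff

section Affinity

variable {V : Type} [Fintype V] {ε ω ps : ℝ} {p q : V → ℝ}

/-! ### Anticoncentration and the affinity -/

/-- The right side is the derivative of `arctan` at a point near `u`. Exponential decay beats it,
and the shift `m` only affects the constant. -/
lemma exp_neg_le_inv_one_add_sq {c m u ξ : ℝ} (hc : 0 < c) (hξ : |ξ| ≤ |u| + m) :
    Real.exp (-(c * |u|)) ≤ (1 + 2 * m ^ 2 + 4 / c ^ 2) * (1 / (1 + ξ ^ 2)) := by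
  have h1 : 0 < 1 + ξ ^ 2 := by positivity
  rw [mul_one_div, le_div_iff₀ h1, Real.exp_neg, inv_mul_le_iff₀ (Real.exp_pos _)]
  have hu := abs_nonneg u
  have h2 : ξ ^ 2 ≤ (|u| + m) ^ 2 := by
    rw [← sq_abs ξ]; exact pow_le_pow_left₀ (abs_nonneg _) hξ 2
  have h3 := Real.quadratic_le_exp_of_nonneg (mul_nonneg hc.le hu)
  have h4 : 1 ≤ Real.exp (c * |u|) := Real.one_le_exp (by positivity)
  have h5 : |u| ^ 2 ≤ 2 / c ^ 2 * Real.exp (c * |u|) := by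
    have : (c * |u|) ^ 2 / 2 ≤ Real.exp (c * |u|) := by nlinarith [mul_nonneg hc.le hu]
    rw [div_mul_eq_mul_div, le_div_iff₀ (by positivity)]
    nlinarith
  have h6 : 0 ≤ m ^ 2 := sq_nonneg _
  calc 1 + ξ ^ 2 ≤ 1 + 2 * m ^ 2 + 2 * |u| ^ 2 := by nlinarith [sq_nonneg (|u| - m)]
    _ ≤ (1 + 2 * m ^ 2) * Real.exp (c * |u|) + 2 * (2 / c ^ 2 * Real.exp (c * |u|)) := by
        nlinarith
    _ = _ := by ring

/-- By the mean value theorem, the jump of `arctan` across a step of size `L` dominates `|L|` times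
the exponential kernel. Thus the kernel is controlled by increments of a bounded function; the sign
makes them nonnegative. -/
lemma arctan_diff_ge {c m u t L : ℝ} (hc : 0 < c) (hL : |L| ≤ m) (hu : u = t ∨ u = t + L) :
    |L| * Real.exp (-(c * |u|)) ≤
      (1 + 2 * m ^ 2 + 4 / c ^ 2) * (SignType.sign L * (Real.arctan (t + L) - Real.arctan t)) := by
  have hm : 0 ≤ m := (abs_nonneg L).trans hL
  have key : ∀ a b : ℝ, a < b → (u = a ∨ u = b) → b - a ≤ m →
      (b - a) * Real.exp (-(c * |u|)) ≤
        (1 + 2 * m ^ 2 + 4 / c ^ 2) * (Real.arctan b - Real.arctan a) := by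
    intro a b hab hu hba
    obtain ⟨ξ, hξ, hd⟩ := exists_hasDerivAt_eq_slope Real.arctan (fun x => 1 / (1 + x ^ 2)) hab
      Real.continuous_arctan.continuousOn (fun x _ => Real.hasDerivAt_arctan x)
    have hpos : 0 < b - a := by linarith
    have h1 : Real.arctan b - Real.arctan a = (b - a) * (1 / (1 + ξ ^ 2)) := by
      rw [hd]; field_simp
    have hξ' : |ξ| ≤ |u| + m := by
      have : |ξ - u| ≤ m := by
        rw [abs_le]; rcases hu with rfl | rfl <;> constructor <;> linarith [hξ.1, hξ.2]
      calc |ξ| = |u + (ξ - u)| := by ring_nf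
        _ ≤ |u| + |ξ - u| := abs_add_le _ _
        _ ≤ _ := by linarith
    rw [h1]
    have := mul_le_mul_of_nonneg_left (exp_neg_le_inv_one_add_sq hc hξ') hpos.le
    linarith
  rcases lt_trichotomy L 0 with h | h | h
  · have := key (t + L) t (by linarith) hu.symm (by rw [abs_of_neg h] at hL; linarith)
    rw [sign_neg h, abs_of_neg h]
    simp only [SignType.coe_neg, SignType.coe_one]
    have e1 : t - (t + L) = -L := by ring
    rw [e1] at this
    linarith
  · subst h; simp
  · have := key t (t + L) (by linarith) hu (by rw [abs_of_pos h] at hL; linarith)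
    rw [sign_pos h, abs_of_pos h]
    simp only [SignType.coe_one]
    have e1 : t + L - t = L := by ring
    rw [e1] at this
    linarith

/-- A sum of independent Bernoulli variables, of which those in `S` have the same weight `L`, does
not concentrate at a scale finer than its standard deviation. -/
lemma bE_exp_neg_abs_le {a : V → ℝ} (ha : ∀ j, 0 ≤ a j ∧ a j ≤ 1) (s : ℝ) (w : V → ℝ)
    (S : Finset V) {L c m v : ℝ} (hw : ∀ j ∈ S, w j = L) (hL : L ≠ 0) (hLm : |L| ≤ m) (hc : 0 < c)
    (hv : 0 < v) (hvar : v ≤ ∑ j ∈ S, a j * (1 - a j)) :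
    bE a (fun x => Real.exp (-(c * |s + ∑ j, w j * bit (x j)|))) ≤
      2 * (1 + 2 * m ^ 2 + 4 / c ^ 2) / (|L| * Real.sqrt v) := by
  set F := fun x : V → Bool => s + ∑ j, w j * bit (x j) with hF
  set A := 1 + 2 * m ^ 2 + 4 / c ^ 2 with hA
  have hApos : 0 < A := by positivity
  set σ : ℝ := ((SignType.sign L : SignType) : ℝ) with hσ
  have hσ1 : |σ| ≤ 1 := by
    rcases lt_trichotomy L 0 with h | h | h
    · simp [hσ, sign_neg h]
    · exact absurd h hL
    · simp [hσ, sign_pos h]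
  have hLpos : 0 < |L| := abs_pos.2 hL
  set B := bE a (fun x => Real.exp (-(c * |F x|))) with hB
  set v' := ∑ j ∈ S, a j * (1 - a j) with hv'
  have hv'pos : 0 < v' := hv.trans_le hvar
  have hupd : ∀ x : V → Bool, ∀ j ∈ S,
      F (Function.update x j true) = F (Function.update x j false) + L := by
    intro x j hj
    simp only [hF]
    have : ∑ i, w i * bit (Function.update x j true i) -
        ∑ i, w i * bit (Function.update x j false i) = L := by
      rw [← Finset.sum_sub_distrib, Finset.sum_eq_single j]
      · simp [hw j hj]
      · intro i _ hi; simp [hi]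
      · simp
    linarith
  have hx : ∀ x : V → Bool, ∀ j, x = Function.update x j false ∨ x = Function.update x j true := by
    intro x j
    cases h : x j
    · left; rw [← h, Function.update_eq_self]
    · right; rw [← h, Function.update_eq_self]
  have hlow : ∀ j ∈ S, |L| * B ≤ A * bE a (fun x =>
      σ * Real.arctan (F (Function.update x j true)) -
        σ * Real.arctan (F (Function.update x j false))) := by
    intro j hj
    rw [hB, ← bE_const_mul, ← bE_const_mul]
    refine bE_mono ha fun x => ?_
    rw [hupd x j hj, ← mul_sub]
    refine arctan_diff_ge hc hLm ?_
    rcases hx x j with h | h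
    · left; rw [← h]
    · right; rw [← hupd x j hj, ← h]
  -- Integration by parts against the bounded function `σ arctan F`: the centred sum over `S`
  -- correlates with it by at least a multiple of `|L| B v'`. Boundedness and the variance limit the
  -- correlation to `2 √v'`, which bounds `B`.
  have hstein : |L| * B * v' ≤ A * bE a (fun x =>
      (∑ j, (if j ∈ S then 1 else 0) * (bit (x j) - a j)) * (σ * Real.arctan (F x))) := by
    have e1 : ∀ x : V → Bool,
        (∑ j, (if j ∈ S then (1 : ℝ) else 0) * (bit (x j) - a j)) * (σ * Real.arctan (F x)) =
        ∑ j ∈ S, (bit (x j) - a j) * (σ * Real.arctan (F x)) := by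
      intro x
      rw [Finset.sum_mul]
      simp only [ite_mul, one_mul, zero_mul, Finset.sum_ite_mem, Finset.univ_inter]
    simp only [e1, bE_sum]
    rw [hv', Finset.mul_sum, Finset.mul_sum]
    refine Finset.sum_le_sum fun j hj => ?_
    rw [bE_centered_mul a j (fun x => σ * Real.arctan (F x))]
    have h1 : 0 ≤ a j * (1 - a j) := mul_nonneg (ha j).1 (by linarith [(ha j).2])
    have := mul_le_mul_of_nonneg_right (hlow j hj) h1
    linarith
  have hup : bE a (fun x => (∑ j, (if j ∈ S then 1 else 0) * (bit (x j) - a j)) *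
      (σ * Real.arctan (F x))) ≤ 2 * Real.sqrt v' := by
    have h1 : bE a (fun x => (∑ j, (if j ∈ S then 1 else 0) * (bit (x j) - a j)) *
        (σ * Real.arctan (F x))) ≤
        bE a (fun x => 2 * |∑ j, (if j ∈ S then 1 else 0) * (bit (x j) - a j)|) := by
      refine bE_mono ha fun x => ?_
      have h2 : |σ * Real.arctan (F x)| ≤ 2 := by
        rw [abs_mul]
        have h3 : |Real.arctan (F x)| ≤ 2 := by
          rw [abs_le]
          have := Real.arctan_lt_pi_div_two (F x)
          have := Real.neg_pi_div_two_lt_arctan (F x)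
          have := Real.pi_lt_four
          constructor <;> linarith
        nlinarith [abs_nonneg σ, abs_nonneg (Real.arctan (F x))]
      calc _ ≤ |(∑ j, (if j ∈ S then 1 else 0) * (bit (x j) - a j)) *
          (σ * Real.arctan (F x))| := le_abs_self _
        _ = |∑ j, (if j ∈ S then 1 else 0) * (bit (x j) - a j)| * |σ * Real.arctan (F x)| :=
          abs_mul _ _
        _ ≤ |∑ j, (if j ∈ S then 1 else 0) * (bit (x j) - a j)| * 2 :=
          mul_le_mul_of_nonneg_left h2 (abs_nonneg _)
        _ = _ := mul_comm _ _
    refine h1.trans ?_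
    rw [bE_const_mul]
    have h2 := bE_abs_le ha (fun x => ∑ j, (if j ∈ S then 1 else 0) * (bit (x j) - a j))
    rw [bE_variance] at h2
    have h3 : ∑ j, (if j ∈ S then (1 : ℝ) else 0) ^ 2 * (a j * (1 - a j)) = v' := by
      simp [hv', Finset.sum_ite_mem]
    rw [h3] at h2
    linarith
  have hfin : |L| * B * v' ≤ A * (2 * Real.sqrt v') :=
    hstein.trans (mul_le_mul_of_nonneg_left hup hApos.le)
  have hsq : Real.sqrt v' * Real.sqrt v' = v' := Real.mul_self_sqrt hv'pos.le
  have hs : 0 < Real.sqrt v' := Real.sqrt_pos.2 hv'pos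
  have h1 : |L| * B * Real.sqrt v' ≤ 2 * A := by
    have : (|L| * B * Real.sqrt v') * Real.sqrt v' ≤ (2 * A) * Real.sqrt v' := by
      calc _ = |L| * B * v' := by rw [mul_assoc, hsq]
        _ ≤ _ := by linarith
    exact le_of_mul_le_mul_right this hs
  have hB0 : 0 ≤ B := bE_nonneg ha fun x => (Real.exp_pos _).le
  rw [le_div_iff₀ (mul_pos hLpos (Real.sqrt_pos.2 hv))]
  have h2 : Real.sqrt v ≤ Real.sqrt v' := Real.sqrt_le_sqrt hvar
  calc B * (|L| * Real.sqrt v) = |L| * B * Real.sqrt v := by ring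
    _ ≤ |L| * B * Real.sqrt v' := by gcongr
    _ ≤ _ := h1

lemma logOdds_eq {a b : ℝ} (ha : 0 < a) (ha1 : a < 1) (hb : 0 < b) (hb1 : b < 1) :
    logOdds a b = Real.log (b * (1 - a) / (a * (1 - b))) := by
  have h1 : (1 - a) ≠ 0 := by linarith
  have h2 : (1 - b) ≠ 0 := by linarith
  rw [Real.log_div (by positivity) (by positivity), Real.log_mul hb.ne' h1, Real.log_mul ha.ne' h2]
  simp only [logOdds, lr, bw_true, bw_false]
  ring

lemma abs_log_sub_le {m u v : ℝ} (hm : 0 < m) (hu : m ≤ u) (hv : m ≤ v) :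
    |Real.log u - Real.log v| ≤ |u - v| / m := by
  have key : ∀ u v : ℝ, m ≤ u → m ≤ v → Real.log u - Real.log v ≤ |u - v| / m := by
    intro u v hu hv
    have hu0 : 0 < u := hm.trans_le hu
    have hv0 : 0 < v := hm.trans_le hv
    have := Real.log_le_sub_one_of_pos (div_pos hu0 hv0)
    rw [Real.log_div hu0.ne' hv0.ne'] at this
    have h2 : u / v - 1 = (u - v) / v := by field_simp
    rw [h2] at this
    refine this.trans ?_
    calc (u - v) / v ≤ |u - v| / v := by gcongr; exact le_abs_self _
      _ ≤ _ := by gcongr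
  rw [abs_le]
  constructor
  · have := key v u hv hu
    rw [abs_sub_comm] at this
    linarith
  · exact key u v hu hv

lemma abs_logOdds_le (h : Comparable ε ω ps p q) (j : V) :
    |logOdds (p j) (q j)| ≤ (ω / ps + 1 / ε) * |p j - q j| := by
  have hω := h.omega_pos
  have hps := h.ps_pos
  have h1 := abs_log_sub_le (div_pos hps hω) (h.q_lower j) (h.p_lower j)
  have h0 := abs_log_sub_le h.eps_pos (u := 1 - q j) (v := 1 - p j)
    (by linarith [h.symm.p_le j]) (by linarith [h.p_le j])
  have e1 : |q j - p j| / (ps / ω) = ω / ps * |p j - q j| := by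
    rw [abs_sub_comm]; field_simp
  have e0 : |1 - q j - (1 - p j)| / ε = 1 / ε * |p j - q j| := by
    have : 1 - q j - (1 - p j) = p j - q j := by ring
    rw [this]; field_simp
  rw [e1] at h1
  rw [e0] at h0
  simp only [logOdds, lr, bw_true, bw_false]
  calc _ ≤ |Real.log (q j) - Real.log (p j)| + |Real.log (1 - q j) - Real.log (1 - p j)| :=
        abs_sub _ _
    _ ≤ _ := by rw [add_mul]; linarith

lemma abs_logOdds_le_const (h : Comparable ε ω ps p q) (j : V) :
    |logOdds (p j) (q j)| ≤ ω + 1 / ε := by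
  refine (abs_logOdds_le h j).trans ?_
  have hω := h.omega_pos
  have hps := h.ps_pos
  have hε := h.eps_pos
  have h1 : |p j - q j| ≤ ps := by
    rw [abs_le]
    have := h.p_pos j; have := h.symm.p_pos j
    have := h.p_upper j; have := h.q_upper j
    constructor <;> linarith
  have hps1 : ps ≤ 1 := by linarith [h.ps_le]
  calc _ ≤ (ω / ps + 1 / ε) * ps := by gcongr
    _ = ω + 1 / ε * ps := by field_simp
    _ ≤ _ := by
      have : 1 / ε * ps ≤ 1 / ε * 1 := by gcongr
      linarith

lemma affinity_eq_tilt (h : Comparable ε ω ps p q) (α : ℝ) :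
    affinity (bernProd p) (bernProd q) = cSum p q α *
      bE (tilt p q α) (fun x => min 1 (Real.exp (llr p q x)) * Real.exp (-(α * llr p q x))) := by
  rw [affinity_eq h, ← bE_exp_mul h]
  congr 1; ext x
  rw [mul_left_comm, ← Real.exp_add]
  simp

lemma tilt_mem (h : Comparable ε ω ps p q) {α : ℝ} (h0 : 0 ≤ α) (h1 : α ≤ 1) (j : V) :
    0 ≤ tilt p q α j ∧ tilt p q α j ≤ 1 := by
  have hb := tilt_bounds h h0 h1 j
  have := h.eps_pos
  have : 0 < ps / ω := div_pos h.ps_pos h.omega_pos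
  constructor <;> linarith

/-- Upper bound on the affinity with the correct polynomial factor. -/
lemma affinity_le (h : Comparable ε ω ps p q) (hχ : 0 < chiSep ps p q) (S : Finset V) {L N : ℝ}
    (hS : ∀ j ∈ S, logOdds (p j) (q j) = L) (hL : L ≠ 0) (hN : 0 < N) (hNS : N ≤ S.card)
    (hne : S.Nonempty) :
    affinity (bernProd p) (bernProd q) ≤
      2 * (1 + 2 * (ω + 1 / ε) ^ 2 + 4 / (ε / (8 * ω)) ^ 2) /
        (|L| * Real.sqrt (N * (ps / ω * ε))) *
          Real.exp (-chernoffInfo (bernProd p) (bernProd q)) := by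
  obtain ⟨α, hα0, hα1, hsum, -⟩ := exists_optimal h hχ
  have hω := h.omega_pos
  have hps := h.ps_pos
  have hε := h.eps_pos
  have hc : 0 < ε / (8 * ω) := by positivity
  have h0 : 0 ≤ α := by linarith
  have h1 : α ≤ 1 := by linarith
  rw [affinity_eq_tilt h α, hsum, mul_comm]
  refine mul_le_mul_of_nonneg_right ?_ (Real.exp_pos _).le
  obtain ⟨j₀, hj₀⟩ := hne
  have hLm : |L| ≤ ω + 1 / ε := by rw [← hS j₀ hj₀]; exact abs_logOdds_le_const h j₀
  have hvar : N * (ps / ω * ε) ≤ ∑ j ∈ S, tilt p q α j * (1 - tilt p q α j) := by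
    calc N * (ps / ω * ε) ≤ S.card * (ps / ω * ε) := by gcongr
      _ = ∑ _j ∈ S, (ps / ω * ε) := by simp
      _ ≤ _ := Finset.sum_le_sum fun j _ => by
        have hb := tilt_bounds h h0 h1 j
        have : 0 < ps / ω := by positivity
        exact mul_le_mul hb.1 hb.2.2 hε.le (by linarith)
  refine le_trans ?_ (bE_exp_neg_abs_le (tilt_mem h h0 h1) (∑ j, lr (p j) (q j) false)
    (fun j => logOdds (p j) (q j)) S hS hL hLm hc (by positivity) hvar)
  refine bE_mono (tilt_mem h h0 h1) fun x => ?_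
  rw [← llr_eq]
  have := mul_le_mul_of_nonneg_right (min_one_exp_le (t := llr p q x) hα0 hα1)
    (Real.exp_pos (-(α * llr p q x))).le
  refine this.trans (le_of_eq ?_)
  rw [mul_right_comm, ← Real.exp_add]
  simp

/-- Lower bound on the affinity. -/
lemma le_affinity (h : Comparable ε ω ps p q) (hχ : 0 < chiSep ps p q) :
    Real.exp (-chernoffInfo (bernProd p) (bernProd q) -
      (ω + 1 / ε) * Real.sqrt (8 / ε * chernoffInfo (bernProd p) (bernProd q))) ≤
    affinity (bernProd p) (bernProd q) := by
  obtain ⟨α, hα0, hα1, hsum, hcen⟩ := exists_optimal h hχ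
  have hω := h.omega_pos
  have hps := h.ps_pos
  have hε := h.eps_pos
  have hc : 0 < ε / (8 * ω) := by positivity
  have h0 : 0 ≤ α := by linarith
  have h1 : α ≤ 1 := by linarith
  set t := tilt p q α with ht
  have htm := tilt_mem h h0 h1
  rw [affinity_eq_tilt h α, hsum, sub_eq_add_neg, Real.exp_add]
  refine mul_le_mul_of_nonneg_left ?_ (Real.exp_pos _).le
  -- Optimality of `α` means that the log-likelihood ratio is centred under the tilted law. Its mean
  -- absolute value is then at most its standard deviation, of order the square root of the
  -- information, and Jensen's inequality concludes.
  have hcen' : bE t (llr p q) = 0 := by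
    have := bE_exp_mul h α (llr p q)
    rw [hcen] at this
    rcases mul_eq_zero.1 this.symm with h2 | h2
    · exact absurd h2 (cSum_pos h α).ne'
    · exact h2
  have hcentered : ∀ x, llr p q x = ∑ j, logOdds (p j) (q j) * (bit (x j) - t j) := by
    have hmean : bE t (llr p q) = ∑ j, lr (p j) (q j) false + ∑ j, logOdds (p j) (q j) * t j := by
      have e : llr p q = fun x => ∑ j, lr (p j) (q j) false +
          ∑ j, logOdds (p j) (q j) * bit (x j) := by ext x; exact llr_eq p q x
      rw [e, bE_add, bE_const, bE_sum]
      congr 1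
      refine Finset.sum_congr rfl fun j _ => ?_
      rw [bE_const_mul, bE_coord t j bit]
      simp
    intro x
    rw [llr_eq]
    simp only [mul_sub, Finset.sum_sub_distrib]
    linarith
  have hvar : bE t (fun x => llr p q x ^ 2) ≤
      (ω + 1 / ε) ^ 2 * (8 / ε * chernoffInfo (bernProd p) (bernProd q)) := by
    simp only [hcentered]
    rw [bE_variance]
    have hterm : ∀ j ∈ (Finset.univ : Finset V), logOdds (p j) (q j) ^ 2 * (t j * (1 - t j)) ≤
        (ω + 1 / ε) ^ 2 / ε * ((p j - q j) ^ 2 / ps) := by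
      intro j _
      have hb := tilt_bounds h h0 h1 j
      have hL : logOdds (p j) (q j) ^ 2 ≤ ((ω / ps + 1 / ε) * |p j - q j|) ^ 2 := by
        rw [← sq_abs (logOdds _ _)]
        exact pow_le_pow_left₀ (abs_nonneg _) (abs_logOdds_le h j) 2
      have hps1 : ps ≤ 1 := by linarith [h.ps_le]
      have hA : ω / ps + 1 / ε ≤ (ω + 1 / ε) / ps := by
        rw [add_div]
        have : 1 / ε ≤ 1 / ε / ps := by
          rw [le_div_iff₀ hps]
          have : 0 < 1 / ε := by positivity
          nlinarith
        linarith
      have hL2 : logOdds (p j) (q j) ^ 2 ≤ ((ω + 1 / ε) / ps * |p j - q j|) ^ 2 := by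
        refine hL.trans ?_
        gcongr
      have ht' : t j * (1 - t j) ≤ ps / ε := by
        have := (htm j).1
        have := (htm j).2
        have e1 : t j ≤ ps / ε := hb.2.1
        have : t j * (1 - t j) ≤ t j := by change 0 ≤ t j at *; nlinarith
        linarith
      have ht0 : 0 ≤ t j * (1 - t j) := mul_nonneg (htm j).1 (by linarith [(htm j).2])
      calc _ ≤ ((ω + 1 / ε) / ps * |p j - q j|) ^ 2 * (ps / ε) :=
            mul_le_mul hL2 ht' ht0 (sq_nonneg _)
        _ = _ := by
          rw [mul_pow, sq_abs]; field_simp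
    calc _ ≤ ∑ j, (ω + 1 / ε) ^ 2 / ε * ((p j - q j) ^ 2 / ps) := Finset.sum_le_sum hterm
      _ = (ω + 1 / ε) ^ 2 / ε * chiSep ps p q := by rw [← Finset.mul_sum]; rfl
      _ ≤ (ω + 1 / ε) ^ 2 / ε * (8 * chernoffInfo (bernProd p) (bernProd q)) := by
        have := le_chernoffInfo h
        gcongr; linarith
      _ = _ := by ring
  have habs : bE t (fun x => |llr p q x|) ≤
      (ω + 1 / ε) * Real.sqrt (8 / ε * chernoffInfo (bernProd p) (bernProd q)) := by
    refine (bE_abs_le htm (llr p q)).trans ((Real.sqrt_le_sqrt hvar).trans (le_of_eq ?_))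
    rw [Real.sqrt_mul (sq_nonneg _), Real.sqrt_sq (by positivity)]
  calc _ ≤ Real.exp (bE t (fun x => -|llr p q x|)) := by
        apply Real.exp_le_exp.2
        have : bE t (fun x => -|llr p q x|) = -bE t (fun x => |llr p q x|) := by
          simpa using bE_const_mul t (-1) (fun x => |llr p q x|)
        linarith
    _ ≤ bE t (fun x => Real.exp (-|llr p q x|)) := exp_bE_le htm _
    _ ≤ _ := by
      refine bE_mono htm fun x => ?_
      rcases le_total 0 (llr p q x) with hl | hl
      · rw [abs_of_nonneg hl, min_eq_left (Real.one_le_exp hl), one_mul]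
        apply Real.exp_le_exp.2; nlinarith
      · rw [abs_of_nonpos hl, min_eq_right (Real.exp_le_one_iff.2 hl), ← Real.exp_add]
        apply Real.exp_le_exp.2; nlinarith

/-- Exponential tilts of the affinity. -/
lemma sum_min_mul_exp_le (h : Comparable ε ω ps p q) (c : V → ℝ) (hc : ∀ j, 0 ≤ c j) :
    ∑ x, min (bernProd p x) (bernProd q x) * Real.exp (∑ j, c j * bit (x j)) ≤
      Real.exp (ps / ε * ∑ j, (Real.exp (c j) - 1)) * affinity (bernProd p) (bernProd q) := by
  have hps := h.ps_pos
  have hε := h.eps_pos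
  refine sum_mul_exp_le (fun x => min (bernProd p x) (bernProd q x))
    (fun x => le_min (bernProd_pos h.p_mem x).le (bernProd_pos h.symm.p_mem x).le)
    (by positivity) (fun x j => ?_) c hc
  -- Turning one bit on multiplies a product mass by at most `ps / ε`. The same odds bound passes to
  -- the minimum of two masses.
  have key : ∀ r : V → ℝ, (∀ i, 0 < r i ∧ r i < 1) → r j ≤ ps →
      bernProd r (Function.update x j true) ≤ ps / ε * bernProd r (Function.update x j false) := by
    intro r hr hrj
    have e : ∀ b, bernProd r (Function.update x j b) =
        bw (r j) b * ∏ i ∈ Finset.univ.erase j, bw (r i) (x i) := by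
      intro b
      rw [bernProd_eq, ← Finset.mul_prod_erase _ _ (Finset.mem_univ j)]
      congr 1
      · simp
      · refine Finset.prod_congr rfl fun i hi => ?_
        rw [Function.update_of_ne (Finset.ne_of_mem_erase hi)]
    rw [e, e, ← mul_assoc]
    refine mul_le_mul_of_nonneg_right ?_
      (Finset.prod_nonneg fun i _ => (bw_pos (hr i).1 (hr i).2 _).le)
    simp only [bw_true, bw_false]
    have : ε ≤ 1 - r j := by linarith [h.ps_le]
    calc r j ≤ ps := hrj
      _ = ps / ε * ε := by field_simp
      _ ≤ _ := by gcongr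
  rw [mul_min_of_nonneg _ _ (by positivity)]
  exact min_le_min (key p h.p_mem (h.p_upper j)) (key q h.symm.p_mem (h.q_upper j))

end Affinity

/-! ### The block model as a product law on pairs of nodes -/

section Graph

variable {V : Type} [LinearOrder V] {K : ℕ}

/-- The coordinate that carries the edge between `i` and `j`. -/
def edge (i j : V) : V × V := if j ≤ i then (i, j) else (j, i)

lemma edge_comm (i j : V) : edge i j = edge j i := by
  rcases lt_trichotomy i j with h | h | h
  · simp [edge, h.le, not_le.2 h]
  · subst h; rfl
  · simp [edge, h.le, not_le.2 h]

lemma edge_of_lt {i j : V} (h : j < i) : edge i j = (i, j) := by simp [edge, h.le]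

lemma edge_eq_iff {i j k l : V} : edge i j = edge k l ↔ (i = k ∧ j = l) ∨ (i = l ∧ j = k) := by
  constructor
  · intro h
    unfold edge at h
    split_ifs at h <;> simp only [Prod.mk.injEq] at h <;> tauto
  · rintro (⟨rfl, rfl⟩ | ⟨rfl, rfl⟩)
    · rfl
    · exact edge_comm _ _

lemma edge_injective (i : V) : Function.Injective (edge i) := by
  intro a b h
  rcases edge_eq_iff.1 h with h | h
  · exact h.2
  · exact h.2.trans h.1

/-- The graph coded by the coordinates `x (i, j)`, `j < i`. -/
def graphOf (x : V × V → Bool) : SimpleGraph V where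
  Adj i j := i ≠ j ∧ x (edge i j) = true
  symm := ⟨fun i j h => ⟨h.1.symm, by rw [edge_comm]; exact h.2⟩⟩
  loopless := ⟨fun i h => h.1 rfl⟩

lemma graphOf_adj {x : V × V → Bool} {i j : V} :
    (graphOf x).Adj i j ↔ i ≠ j ∧ x (edge i j) = true := Iff.rfl

/-- The coordinates of the edges at `i`. -/
def row (i : V) (x : V × V → Bool) : V → Bool := fun a => x (edge i a)

/-- The parameters of the product law on pairs of nodes. -/
def edgeP (z : V → Fin K) (P : Matrix (Fin K) (Fin K) ℝ) : V × V → ℝ :=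
  fun ij => P (z ij.1) (z ij.2)

lemma edgeP_edge (z : V → Fin K) {P : Matrix (Fin K) (Fin K) ℝ} (hP : P.IsSymm) (i j : V) :
    edgeP z P (edge i j) = P (z i) (z j) := by
  unfold edge edgeP
  split_ifs
  · rfl
  · exact hP.apply _ _

lemma edgeP_mem {z : V → Fin K} {P : Matrix (Fin K) (Fin K) ℝ} (h : ∀ k l, 0 < P k l ∧ P k l < 1)
    (ij : V × V) : 0 ≤ edgeP z P ij ∧ edgeP z P ij ≤ 1 :=
  ⟨(h _ _).1.le, (h _ _).2.le⟩

lemma subGraph_graphOf (x : V × V → Bool) (S : Finset V) :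
    subGraph (graphOf x) S =
      graphOf (fun e : {v // v ∈ S} × {v // v ∈ S} => x ((e.1 : V), (e.2 : V))) := by
  ext i j
  simp only [subGraph, SimpleGraph.comap_adj, graphOf_adj, ne_eq, Subtype.ext_iff]
  have : edge (i : V) (j : V) = (((edge i j).1 : V), ((edge i j).2 : V)) := by
    unfold edge
    split_ifs <;> simp_all
  rw [this]

variable [Fintype V]

/-- Only coordinates `(i, j)` with `j < i` code edges; the others are idle and integrate to one. -/
lemma bE_graphOf_eq (z : V → Fin K) (P : Matrix (Fin K) (Fin K) ℝ) (G : SimpleGraph V) :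
    bE (edgeP z P) (fun x => if graphOf x = G then 1 else 0) = graphProb z P G := by
  have h1 : ∀ x : V × V → Bool, (if graphOf x = G then (1 : ℝ) else 0) =
      ∏ ij : V × V, (fun (ij : V × V) (b : Bool) => if ij.2 < ij.1 then
        (if (b = true ↔ G.Adj ij.1 ij.2) then (1 : ℝ) else 0) else 1) ij (x ij) := by
    intro x
    split_ifs with h
    · subst h
      symm
      apply Finset.prod_eq_one
      rintro ⟨i, j⟩ -
      dsimp only
      split_ifs with h1 h2
      · rfl
      · exact absurd (by rw [graphOf_adj, edge_of_lt h1]; simp [h1.ne']) h2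
      · rfl
    · symm
      have : ∃ i j : V, j < i ∧ ¬ (x (i, j) = true ↔ G.Adj i j) := by
        by_contra hcon
        push Not at hcon
        apply h
        ext i j
        rw [graphOf_adj]
        rcases lt_trichotomy i j with hij | hij | hij
        · rw [edge_comm, edge_of_lt hij, hcon j i hij, G.adj_comm]
          simp [hij.ne]
        · subst hij; simp
        · rw [edge_of_lt hij, hcon i j hij]
          simp [hij.ne']
      obtain ⟨i, j, hij, hne⟩ := this
      apply Finset.prod_eq_zero (Finset.mem_univ (i, j))
      simp [hij, hne]
  simp only [h1]
  rw [bE_prod (edgeP z P) (fun (ij : V × V) (b : Bool) => if ij.2 < ij.1 then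
        (if (b = true ↔ G.Adj ij.1 ij.2) then (1 : ℝ) else 0) else 1), graphProb,
        Finset.prod_filter]
  refine Finset.prod_congr rfl fun ij _ => ?_
  by_cases h2 : ij.2 < ij.1 <;> by_cases h3 : G.Adj ij.1 ij.2 <;> simp [edgeP, h2, h3]

/-- Expectations in the block model are expectations under the product law. -/
lemma sum_graphProb_mul (z : V → Fin K) (P : Matrix (Fin K) (Fin K) ℝ) (f : SimpleGraph V → ℝ) :
    ∑ G, graphProb z P G * f G = bE (edgeP z P) fun x => f (graphOf x) := by
  have : ∀ x : V × V → Bool, f (graphOf x) = ∑ G, f G * if graphOf x = G then (1 : ℝ) else 0 := by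
    intro x; simp
  simp only [this]
  rw [bE_sum]
  simp only [bE_const_mul, bE_graphOf_eq]
  exact Finset.sum_congr rfl fun G _ => mul_comm _ _

lemma sbmProb_eq (z : V → Fin K) (P : Matrix (Fin K) (Fin K) ℝ) (A : SimpleGraph V → Prop) :
    sbmProb z P A = bP (edgeP z P) fun x => A (graphOf x) := by
  rw [bP, ← sum_graphProb_mul z P (fun G => if A G then 1 else 0), sbmProb]
  refine Finset.sum_congr rfl fun G _ => ?_
  split_ifs <;> simp

/-- The subgraph of a block model is a block model. -/
lemma sbmProb_subGraph (z : V → Fin K) (P : Matrix (Fin K) (Fin K) ℝ) (S : Finset V)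
    (A : SimpleGraph {v // v ∈ S} → Prop) :
    bP (edgeP z P) (fun x => A (subGraph (graphOf x) S)) =
      sbmProb (fun v : {v // v ∈ S} => z v) P A := by
  simp only [subGraph_graphOf]
  rw [sbmProb_eq]
  exact bP_comp (edgeP z P) (e := fun e : {v // v ∈ S} × {v // v ∈ S} => ((e.1 : V), (e.2 : V)))
    (fun a b h => by
      simp only [Prod.mk.injEq] at h
      exact Prod.ext (Subtype.ext h.1) (Subtype.ext h.2)) (fun y => A (graphOf y))

lemma bE_row (z : V → Fin K) {P : Matrix (Fin K) (Fin K) ℝ} (hP : P.IsSymm) (i : V)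
    (f : (V → Bool) → ℝ) :
    bE (edgeP z P) (fun x => f (row i x)) = bE (pRow z P (z i)) f := by
  have := bE_comp (edgeP z P) (edge_injective i) f
  simp only [edgeP_edge z hP] at this
  exact this

lemma bP_row (z : V → Fin K) {P : Matrix (Fin K) (Fin K) ℝ} (hP : P.IsSymm) (i : V)
    (A : (V → Bool) → Prop) :
    bP (edgeP z P) (fun x => A (row i x)) = bP (pRow z P (z i)) A :=
  bE_row z hP i fun ξ => if A ξ then 1 else 0

end Graph

/-! ### Linear statistics of the edges -/

section Linear

variable {ι : Type} [Fintype ι]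

/-- Linear statistic with weights `a`. -/
def lin (a : ι → ℝ) (x : ι → Bool) : ℝ := ∑ e, a e * bit (x e)

lemma bE_exp_lin (p a : ι → ℝ) :
    bE p (fun x => Real.exp (lin a x)) = ∏ e, (1 + p e * (Real.exp (a e) - 1)) := by
  have h := bE_prod p (fun e b => Real.exp (a e * bit b))
  simp only [← Real.exp_sum] at h
  simp only [lin, h]
  refine Finset.prod_congr rfl fun e _ => ?_
  simp; ring

lemma bE_exp_lin_le {p : ι → ℝ} (hp : ∀ i, 0 ≤ p i ∧ p i ≤ 1) (a : ι → ℝ) :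
    bE p (fun x => Real.exp (lin a x)) ≤ Real.exp (∑ e, p e * (Real.exp (a e) - 1)) := by
  rw [bE_exp_lin, Real.exp_sum]
  refine Finset.prod_le_prod (fun e _ => ?_) fun e _ => ?_
  · have := Real.exp_pos (a e)
    have := hp e
    nlinarith
  · linarith [Real.add_one_le_exp (p e * (Real.exp (a e) - 1))]

lemma bP_le_lin {p : ι → ℝ} (hp : ∀ i, 0 ≤ p i ∧ p i ≤ 1) (a : ι → ℝ) (t : ℝ) :
    bP p (fun x => t ≤ lin a x) ≤ Real.exp (∑ e, p e * (Real.exp (a e) - 1) - t) := by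
  have h1 : bP p (fun x => t ≤ lin a x) ≤ bE p (fun x => Real.exp (-t) * Real.exp (lin a x)) := by
    refine bP_le_bE hp (fun x => by positivity) fun x hx => ?_
    rw [← Real.exp_add]
    exact Real.one_le_exp (by linarith)
  refine h1.trans ?_
  rw [bE_const_mul, sub_eq_neg_add, Real.exp_add]
  exact mul_le_mul_of_nonneg_left (bE_exp_lin_le hp a) (Real.exp_pos _).le

/-- Chernoff's bound for both signs with `exp u ≤ 1 + u + u²` for `|u| ≤ 1`. Weights up to `2`
account for the restriction `s ≤ 1 / 2`. -/
lemma bP_lin_dev_le {p : ι → ℝ} (hp : ∀ i, 0 ≤ p i ∧ p i ≤ 1) (a : ι → ℝ)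
    (ha : ∀ e, 0 ≤ a e ∧ a e ≤ 2) {t s v : ℝ} (hs : 0 ≤ s) (hs1 : s ≤ 1 / 2)
    (hv : ∑ e, p e * a e ^ 2 ≤ v) :
    bP p (fun x => t ≤ |lin a x - ∑ e, a e * p e|) ≤ 2 * Real.exp (s ^ 2 * v - s * t) := by
  have key : ∀ u : ℝ, |u| ≤ 1 / 2 → u ^ 2 = s ^ 2 →
      bP p (fun x => s * t ≤ u * (lin a x - ∑ e, a e * p e)) ≤ Real.exp (s ^ 2 * v - s * t) := by
    intro u hu hus
    have h1 : ∀ x, lin (fun e => u * a e) x = u * lin a x := by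
      intro x; simp only [lin, Finset.mul_sum, mul_assoc]
    have h2 := bP_le_lin hp (fun e => u * a e) (s * t + u * ∑ e, a e * p e)
    simp only [h1] at h2
    refine le_trans (bP_mono hp fun x hx => ?_) (h2.trans (Real.exp_le_exp.2 ?_))
    · linarith
    · have h3 : ∑ e, p e * (Real.exp (u * a e) - 1) ≤
          ∑ e, (p e * (s ^ 2 * a e ^ 2) + u * (a e * p e)) := by
        refine Finset.sum_le_sum fun e _ => ?_
        have h4 : |u * a e| ≤ 1 := by
          rw [abs_mul, abs_of_nonneg (ha e).1]
          nlinarith [abs_nonneg u, (ha e).1, (ha e).2]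
        have h5 := (abs_le.1 (Real.abs_exp_sub_one_sub_id_le h4)).2
        rw [mul_pow, hus] at h5
        nlinarith [(hp e).1]
      have h6 : ∑ e, p e * (s ^ 2 * a e ^ 2) = s ^ 2 * ∑ e, p e * a e ^ 2 := by
        rw [Finset.mul_sum]; exact Finset.sum_congr rfl fun e _ => by ring
      rw [Finset.sum_add_distrib, ← Finset.mul_sum, h6] at h3
      nlinarith [mul_le_mul_of_nonneg_left hv (sq_nonneg s)]
  have hpos := key s (by rw [abs_of_nonneg hs]; exact hs1) rfl
  have hneg := key (-s) (by rw [abs_neg, abs_of_nonneg hs]; exact hs1) (by ring)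
  refine le_trans (bP_mono hp (B := fun x => s * t ≤ s * (lin a x - ∑ e, a e * p e) ∨
    s * t ≤ -s * (lin a x - ∑ e, a e * p e)) fun x hx => ?_) ((bP_or_le hp _ _).trans ?_)
  · rcases le_total 0 (lin a x - ∑ e, a e * p e) with h | h
    · left; rw [abs_of_nonneg h] at hx; exact mul_le_mul_of_nonneg_left hx hs
    · right; rw [abs_of_nonpos h] at hx; nlinarith
  · linarith

end Linear

/-! ### Concentration of edge counts and accuracy of the connectivity estimate -/

section BlockEstimate

variable {V : Type} [Fintype V] [LinearOrder V] {K : ℕ}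

lemma sum_pairs_eq (F : V × V → ℝ) (hF : ∀ i, F (i, i) = 0) :
    ∑ ij, F ij = ∑ ij : V × V, if ij.2 < ij.1 then F ij + F (ij.2, ij.1) else 0 := by
  have h1 : ∀ ij : V × V, F ij = (if ij.2 < ij.1 then F ij else 0) +
      (if ij.1 < ij.2 then F ij else 0) := by
    rintro ⟨i, j⟩
    rcases lt_trichotomy i j with h | h | h
    · simp [h, h.not_gt]
    · subst h; simp [hF]
    · simp [h, h.not_gt]
  have h2 : ∑ ij : V × V, (if ij.1 < ij.2 then F ij else 0) =
      ∑ ij : V × V, (if ij.2 < ij.1 then F (ij.2, ij.1) else 0) :=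
    (Equiv.sum_comp (Equiv.prodComm V V) (fun ij => if ij.1 < ij.2 then F ij else 0)).symm
  calc ∑ ij, F ij = ∑ ij : V × V, ((if ij.2 < ij.1 then F ij else 0) +
        (if ij.1 < ij.2 then F ij else 0)) := Finset.sum_congr rfl fun ij _ => h1 ij
    _ = _ := by
      rw [Finset.sum_add_distrib, h2, ← Finset.sum_add_distrib]
      refine Finset.sum_congr rfl fun ij _ => ?_
      split_ifs <;> simp

/-- Multiplicity of the unordered pair `ij` among the ordered pairs with labels `k`, `l`. -/
def blockW (y : V → Fin K) (k l : Fin K) (ij : V × V) : ℝ :=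
  if ij.2 < ij.1 then (if y ij.1 = k ∧ y ij.2 = l then 1 else 0) +
    (if y ij.2 = k ∧ y ij.1 = l then 1 else 0) else 0

/-- Number of endpoints of the unordered pair `ij` in `M`. -/
def hitW (M : Finset V) (ij : V × V) : ℝ :=
  if ij.2 < ij.1 then (if ij.1 ∈ M then 1 else 0) + (if ij.2 ∈ M then 1 else 0) else 0

lemma pairCount_eq (y : V → Fin K) (k l : Fin K) :
    (pairCount y k l : ℝ) = ∑ ij, blockW y k l ij := by
  rw [pairCount, Finset.card_filter]
  push_cast
  rw [sum_pairs_eq _ (by simp)]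
  refine Finset.sum_congr rfl fun ij _ => ?_
  unfold blockW
  by_cases h : ij.2 < ij.1
  · simp [h, h.ne, h.ne']
  · simp [h]

lemma edgeCount_eq (x : V × V → Bool) (y : V → Fin K) (k l : Fin K) :
    (edgeCount (graphOf x) y k l : ℝ) = lin (blockW y k l) x := by
  rw [edgeCount, Finset.card_filter, lin]
  push_cast
  rw [sum_pairs_eq _ (by simp)]
  refine Finset.sum_congr rfl fun ij _ => ?_
  obtain ⟨i, j⟩ := ij
  unfold blockW
  dsimp only
  by_cases h : j < i
  · rw [if_pos h, if_pos h, graphOf_adj, graphOf_adj, edge_comm j i, edge_of_lt h]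
    cases hx : x (i, j) <;> simp [h.ne, h.ne']
  · simp [h]

lemma blockW_mem (y : V → Fin K) (k l : Fin K) (ij : V × V) :
    0 ≤ blockW y k l ij ∧ blockW y k l ij ≤ 2 := by
  unfold blockW
  split_ifs <;> norm_num

lemma hitW_mem (M : Finset V) (ij : V × V) :
    hitW M ij = 0 ∨ hitW M ij = 1 ∨ hitW M ij = 2 := by
  unfold hitW
  split_ifs <;> norm_num

lemma abs_blockW_sub_le (y z : V → Fin K) (k l : Fin K) (ij : V × V) :
    |blockW y k l ij - blockW z k l ij| ≤
      2 * hitW (Finset.univ.filter fun i => y i ≠ z i) ij := by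
  obtain ⟨i, j⟩ := ij
  have hy := blockW_mem y k l (i, j)
  have hz := blockW_mem z k l (i, j)
  have h2 : |blockW y k l (i, j) - blockW z k l (i, j)| ≤ 2 := by
    rw [abs_le]; constructor <;> linarith
  by_cases h : j < i
  · by_cases hi : y i = z i
    · by_cases hj : y j = z j
      · simp [blockW, hitW, h, hi, hj]
      · simp only [hitW, h, if_true, Finset.mem_filter, Finset.mem_univ, true_and, hi, hj, ne_eq,
          not_true, not_false_iff, if_false]
        linarith
    · simp only [hitW, h, if_true, Finset.mem_filter, Finset.mem_univ, true_and, hi, ne_eq,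
        not_false_iff]
      split_ifs <;> linarith
  · simp [blockW, hitW, h]

lemma sum_hitW_le (M : Finset V) : ∑ ij, hitW M ij ≤ M.card * Fintype.card V := by
  have h := sum_pairs_eq (fun ij : V × V => if ij.1 ≠ ij.2 ∧ ij.1 ∈ M then (1 : ℝ) else 0) (by simp)
  have h1 : ∑ ij, hitW M ij = ∑ ij : V × V, if ij.1 ≠ ij.2 ∧ ij.1 ∈ M then (1 : ℝ) else 0 := by
    rw [h]
    refine Finset.sum_congr rfl fun ij _ => ?_
    unfold hitW
    by_cases hl : ij.2 < ij.1
    · simp [hl, hl.ne, hl.ne']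
    · simp [hl]
  rw [h1, Fintype.sum_prod_type]
  calc _ ≤ ∑ i : V, ∑ _j : V, (if i ∈ M then (1 : ℝ) else 0) := by
        refine Finset.sum_le_sum fun i _ => Finset.sum_le_sum fun j _ => ?_
        dsimp only
        split_ifs <;> simp_all
    _ = _ := by
        simp

lemma sum_edgeP_blockW (z : V → Fin K) {P : Matrix (Fin K) (Fin K) ℝ} (hP : P.IsSymm)
    (k l : Fin K) :
    ∑ ij, blockW z k l ij * edgeP z P ij = P k l * pairCount z k l := by
  rw [pairCount_eq, Finset.mul_sum]
  refine Finset.sum_congr rfl fun ij _ => ?_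
  have hs : P l k = P k l := hP.apply k l
  unfold blockW edgeP
  by_cases h1 : z ij.1 = k ∧ z ij.2 = l
  · rw [h1.1, h1.2, mul_comm]
  · by_cases h2 : z ij.2 = k ∧ z ij.1 = l
    · rw [h2.1, h2.2, hs, mul_comm]
    · simp [h1, h2]

lemma pairCount_le (y : V → Fin K) (k l : Fin K) :
    (pairCount y k l : ℝ) ≤ (Fintype.card V : ℝ) ^ 2 := by
  have : pairCount y k l ≤ Fintype.card (V × V) := Finset.card_le_univ _
  rw [Fintype.card_prod] at this
  rw [sq]; exact_mod_cast this

/-- The edge counts are close to their means on the true classes, and small sets of nodes meet few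
edges. -/
def Regular (z : V → Fin K) (P : Matrix (Fin K) (Fin K) ℝ) (ps τ : ℝ) (x : V × V → Bool) : Prop :=
  (∀ k l, |lin (blockW z k l) x - P k l * pairCount z k l| ≤ τ * Fintype.card V) ∧
    ∀ M : Finset V, (M.card : ℝ) ≤ 3 * τ / ps → lin (hitW M) x ≤ 24 * τ * Fintype.card V

/-- The misclassified set depends on the graph, so control is needed uniformly over `M`. The union
over at most `2 ^ n` sets is affordable: the count for a fixed `M` has mean at most `3 τ n`, and it
reaches `24 τ n` with probability at most `exp (-3n)`. -/
lemma bP_not_regular_le (z : V → Fin K) {P : Matrix (Fin K) (Fin K) ℝ} (hP : P.IsSymm)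
    (hP01 : ∀ k l, 0 < P k l ∧ P k l < 1) {ps τ : ℝ} (hps : 0 < ps) (hPs : ∀ k l, P k l ≤ ps)
    (hτ : 1 ≤ τ) (hτn : τ ≤ 2 * (Fintype.card V * ps)) :
    bP (edgeP z P) (fun x => ¬ Regular z P ps τ x) ≤
      K ^ 2 * (2 * Real.exp (-(τ ^ 2 / ps / 8))) + Real.exp (-(Fintype.card V : ℝ)) := by
  have hp := edgeP_mem (z := z) hP01
  set n : ℝ := (Fintype.card V : ℝ) with hn
  have hnps : 0 < n * ps := by linarith
  have hn0 : 0 < n := pos_of_mul_pos_left hnps hps.le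
  have h1 : ∀ kl : Fin K × Fin K, bP (edgeP z P)
      (fun x => τ * n ≤ |lin (blockW z kl.1 kl.2) x - P kl.1 kl.2 * pairCount z kl.1 kl.2|) ≤
      2 * Real.exp (-(τ ^ 2 / ps / 8)) := by
    rintro ⟨k, l⟩
    have hv : ∑ e, edgeP z P e * blockW z k l e ^ 2 ≤ 2 * n ^ 2 * ps := by
      calc _ ≤ ∑ e, 2 * ps * blockW z k l e := by
            refine Finset.sum_le_sum fun e _ => ?_
            have hb := blockW_mem z k l e
            have : edgeP z P e ≤ ps := hPs _ _
            have h3 : blockW z k l e ^ 2 ≤ 2 * blockW z k l e := by nlinarith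
            calc _ ≤ ps * (2 * blockW z k l e) :=
                  mul_le_mul this h3 (sq_nonneg _) hps.le
              _ = _ := by ring
        _ = 2 * ps * pairCount z k l := by rw [← Finset.mul_sum, pairCount_eq]
        _ ≤ 2 * ps * n ^ 2 := by have := pairCount_le z k l; gcongr
        _ = _ := by ring
    -- This `s` minimizes `s² · 2 n² ps - s τ n`, with value `-τ² / (8 ps)`.
    have hs1 : τ / (4 * (n * ps)) ≤ 1 / 2 := by
      rw [div_le_iff₀ (by positivity)]; linarith
    have h2 := bP_lin_dev_le hp (blockW z k l) (blockW_mem z k l) (t := τ * n)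
      (s := τ / (4 * (n * ps))) (by positivity) hs1 hv
    rw [sum_edgeP_blockW z hP] at h2
    refine h2.trans (le_of_eq ?_)
    congr 2
    field_simp
    ring
  have h2 : ∀ M ∈ Finset.univ.filter (fun M : Finset V => (M.card : ℝ) ≤ 3 * τ / ps),
      bP (edgeP z P) (fun x => 24 * τ * n ≤ lin (hitW M) x) ≤ Real.exp (-(2 * n)) * Real.exp (-n) := by
    intro M hM
    have hM' := (Finset.mem_filter.1 hM).2
    refine (bP_le_lin hp (hitW M) _).trans ?_
    rw [← Real.exp_add]
    apply Real.exp_le_exp.2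
    have h3 : ∑ e, edgeP z P e * (Real.exp (hitW M e) - 1) ≤ ∑ e, ps * 7 * hitW M e := by
      refine Finset.sum_le_sum fun e _ => ?_
      have h4 : Real.exp (hitW M e) - 1 ≤ 7 * hitW M e := by
        have he := Real.exp_one_lt_d9
        have he0 := Real.exp_pos 1
        rcases hitW_mem M e with h | h | h <;> rw [h]
        · simp
        · linarith
        · have : Real.exp 2 = Real.exp 1 * Real.exp 1 := by rw [← Real.exp_add]; norm_num
          rw [this]; nlinarith
      have h5 : 0 ≤ hitW M e := by rcases hitW_mem M e with h | h | h <;> rw [h] <;> norm_num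
      have h6 : edgeP z P e ≤ ps := hPs _ _
      have h7 := (hp e).1
      nlinarith [mul_nonneg h7 (sub_nonneg.2 h4), mul_nonneg h5 (sub_nonneg.2 h6)]
    rw [← Finset.mul_sum] at h3
    have h4 := sum_hitW_le M
    have h5 : (M.card : ℝ) * ps ≤ 3 * τ := by rwa [le_div_iff₀ hps] at hM'
    have h6 : ps * 7 * ∑ e, hitW M e ≤ 21 * τ * n := by
      calc _ ≤ ps * 7 * (M.card * n) := by gcongr
        _ = 7 * n * (M.card * ps) := by ring
        _ ≤ 7 * n * (3 * τ) := by gcongr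
        _ = _ := by ring
    nlinarith
  have hor : bP (edgeP z P) (fun x => ¬ Regular z P ps τ x) ≤
      bP (edgeP z P) (fun x => (∃ kl ∈ (Finset.univ : Finset (Fin K × Fin K)),
        τ * n ≤ |lin (blockW z kl.1 kl.2) x - P kl.1 kl.2 * pairCount z kl.1 kl.2|) ∨
        ∃ M ∈ Finset.univ.filter (fun M : Finset V => (M.card : ℝ) ≤ 3 * τ / ps),
          24 * τ * n ≤ lin (hitW M) x) := by
    refine bP_mono hp fun x hx => ?_
    unfold Regular at hx
    rw [not_and_or] at hx
    rcases hx with hx | hx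
    · push Not at hx
      obtain ⟨k, l, h⟩ := hx
      exact Or.inl ⟨(k, l), Finset.mem_univ _, h.le⟩
    · push Not at hx
      obtain ⟨M, hM, h⟩ := hx
      exact Or.inr ⟨M, by simp [hM], h.le⟩
  refine hor.trans ((bP_or_le hp _ _).trans (add_le_add ?_ ?_))
  · refine (bP_exists_le hp _ _).trans ((Finset.sum_le_sum fun kl _ => h1 kl).trans (le_of_eq ?_))
    simp [sq]
  · refine (bP_exists_le hp _ _).trans ((Finset.sum_le_sum h2).trans ?_)
    rw [Finset.sum_const, nsmul_eq_mul, ← mul_assoc]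
    have hcard : ((Finset.univ.filter
        (fun M : Finset V => (M.card : ℝ) ≤ 3 * τ / ps)).card : ℝ) ≤ Real.exp (2 * n) := by
      have h3 : (Finset.univ.filter (fun M : Finset V => (M.card : ℝ) ≤ 3 * τ / ps)).card ≤
          2 ^ Fintype.card V := by
        refine (Finset.card_le_univ _).trans (le_of_eq ?_)
        simp
      have h4 : (2 : ℝ) ^ Fintype.card V ≤ Real.exp (2 * n) := by
        have : (2 : ℝ) ≤ Real.exp 2 := by linarith [Real.add_one_le_exp (2 : ℝ)]
        calc (2 : ℝ) ^ Fintype.card V ≤ (Real.exp 2) ^ Fintype.card V := by gcongr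
          _ = _ := by rw [← Real.exp_nat_mul, mul_comm]
      exact le_trans (by exact_mod_cast h3) h4
    calc _ ≤ Real.exp (2 * n) * Real.exp (-(2 * n)) * Real.exp (-n) := by gcongr
      _ = _ := by rw [← Real.exp_add]; simp

lemma lin_sub_le (a b c : V × V → ℝ) (h : ∀ e, |a e - b e| ≤ c e) (x : V × V → Bool) :
    |lin a x - lin b x| ≤ lin c x := by
  rw [lin, lin, lin, ← Finset.sum_sub_distrib]
  refine (Finset.abs_sum_le_sum_abs _ _).trans (Finset.sum_le_sum fun e _ => ?_)
  rw [← sub_mul, abs_mul, abs_of_nonneg (bit_nonneg _)]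
  exact mul_le_mul_of_nonneg_right (h e) (bit_nonneg _)

lemma le_pairCount (y : V → Fin K) (k l : Fin K) :
    (commSize y k : ℝ) * ((commSize y l : ℝ) - 1) ≤ pairCount y k l := by
  have h1 : (pairCount y k l : ℝ) = ∑ i ∈ Finset.univ.filter (fun i => y i = k),
      (((Finset.univ.filter fun j => y j = l).erase i).card : ℝ) := by
    rw [pairCount, Finset.card_filter, Fintype.sum_prod_type, Finset.sum_filter]
    push_cast
    refine Finset.sum_congr rfl fun i _ => ?_
    split_ifs with h
    · have : (Finset.univ.filter fun j => y j = l).erase i =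
          Finset.univ.filter (fun j => i ≠ j ∧ y j = l) := by
        ext j; simp [eq_comm]
      rw [this, Finset.card_filter]
      push_cast
      refine Finset.sum_congr rfl fun j _ => ?_
      simp [h]
    · simp [h]
  rw [h1]
  calc _ = ∑ i ∈ Finset.univ.filter (fun i => y i = k), ((commSize y l : ℝ) - 1) := by
        rw [Finset.sum_const, nsmul_eq_mul, commSize]
    _ ≤ _ := by
      refine Finset.sum_le_sum fun i _ => ?_
      have := Finset.pred_card_le_card_erase (s := Finset.univ.filter fun j => y j = l) (a := i)
      have h2 : (commSize y l : ℝ) ≤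
          (((Finset.univ.filter fun j => y j = l).erase i).card : ℝ) + 1 := by
        rw [commSize]
        have h3 : (Finset.univ.filter fun j => y j = l).card ≤
          ((Finset.univ.filter fun j => y j = l).erase i).card + 1 := by omega
        exact_mod_cast h3
      linarith

lemma commSize_le_add (y z : V → Fin K) (k : Fin K) :
    commSize z k ≤ commSize y k + (Finset.univ.filter fun i => y i ≠ z i).card := by
  unfold commSize
  refine le_trans (Finset.card_le_card ?_) (Finset.card_union_le _ _)
  intro i hi
  simp only [Finset.mem_filter, Finset.mem_univ, true_and, Finset.mem_union] at hi ⊢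
  by_cases h : y i = z i
  · left; rw [h, hi]
  · right; exact h

/-- On regular graphs, labels close to the truth give a good estimate of the connectivities. -/
lemma Regular.blockEstimate {z : V → Fin K} {P : Matrix (Fin K) (Fin K) ℝ} {ps τ b : ℝ}
    {x : V × V → Bool} (hx : Regular z P ps τ x) (hps : 0 < ps)
    (hPs : ∀ k l, 0 < P k l ∧ P k l ≤ ps) (hτ : 0 < τ) (hb : 0 < b)
    (hsize : ∀ k, (Fintype.card V : ℝ) / b ≤ commSize z k) (hn : 4 * b ≤ Fintype.card V)
    (hτb : 3 * τ / ps ≤ Fintype.card V / (2 * b)) {y : V → Fin K}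
    (hy : ((Finset.univ.filter fun i => y i ≠ z i).card : ℝ) ≤ 3 * τ / ps) (k l : Fin K) :
    |blockEstimate (graphOf x) y k l - P k l| ≤ 440 * b ^ 2 * τ / Fintype.card V := by
  set n : ℝ := (Fintype.card V : ℝ) with hn'
  set M := Finset.univ.filter fun i => y i ≠ z i with hM
  have hn0 : 0 < n := by linarith
  have hN : ∀ k, n / (2 * b) ≤ commSize y k := by
    intro k
    have h1 : (commSize z k : ℝ) ≤ commSize y k + M.card := by exact_mod_cast commSize_le_add y z k
    have h2 := hsize k
    have h3 : n / b = n / (2 * b) + n / (2 * b) := by field_simp; norm_num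
    linarith
  have hpc : n ^ 2 / (8 * b ^ 2) ≤ pairCount y k l := by
    refine le_trans ?_ (le_pairCount y k l)
    have h1 : 2 ≤ n / (2 * b) := by rw [le_div_iff₀ (by positivity)]; linarith
    have h2 := hN k
    have h3 := hN l
    have h4 : n / (2 * b) / 2 ≤ (commSize y l : ℝ) - 1 := by linarith
    calc n ^ 2 / (8 * b ^ 2) = n / (2 * b) * (n / (2 * b) / 2) := by field_simp; norm_num
      _ ≤ _ := mul_le_mul h2 h4 (by positivity) (by linarith)
  have hpc0 : (0 : ℝ) < pairCount y k l := lt_of_lt_of_le (by positivity) hpc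
  have hhit := hx.2 M hy
  have e2 : ∀ x, lin (fun e => 2 * hitW M e) x = 2 * lin (hitW M) x := by
    intro x; simp only [lin, Finset.mul_sum, mul_assoc]
  have h1 : |lin (blockW y k l) x - lin (blockW z k l) x| ≤ 48 * τ * n := by
    have := lin_sub_le _ _ _ (abs_blockW_sub_le y z k l) x
    rw [e2] at this
    linarith
  have h2 := hx.1 k l
  have h3 : |P k l * pairCount z k l - P k l * pairCount y k l| ≤ 6 * τ * n := by
    rw [← mul_sub, abs_mul, abs_of_pos (hPs k l).1, abs_sub_comm, pairCount_eq, pairCount_eq,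
      ← Finset.sum_sub_distrib]
    have h4 : |∑ e, (blockW y k l e - blockW z k l e)| ≤ 2 * (M.card * n) := by
      refine (Finset.abs_sum_le_sum_abs _ _).trans
        ((Finset.sum_le_sum fun e _ => abs_blockW_sub_le y z k l e).trans ?_)
      rw [← Finset.mul_sum]
      have := sum_hitW_le M
      linarith
    have h5 : (M.card : ℝ) * ps ≤ 3 * τ := by rwa [le_div_iff₀ hps] at hy
    calc _ ≤ ps * (2 * (M.card * n)) :=
          mul_le_mul (hPs k l).2 h4 (abs_nonneg _) hps.le
      _ = 2 * n * (M.card * ps) := by ring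
      _ ≤ 2 * n * (3 * τ) := by gcongr
      _ = _ := by ring
  -- The three errors are relabelled edges (48), fluctuation of the true counts (1) and relabelled
  -- pairs in the mean (6). Division by a pair count of at least `n² / (8 b²)` turns 55 into 440.
  have h4 : |lin (blockW y k l) x - P k l * pairCount y k l| ≤ 55 * τ * n := by
    have := abs_add_three (lin (blockW y k l) x - lin (blockW z k l) x)
      (lin (blockW z k l) x - P k l * pairCount z k l)
      (P k l * pairCount z k l - P k l * pairCount y k l)
    have e : lin (blockW y k l) x - lin (blockW z k l) x +
      (lin (blockW z k l) x - P k l * pairCount z k l) +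
      (P k l * pairCount z k l - P k l * pairCount y k l) =
      lin (blockW y k l) x - P k l * pairCount y k l := by ring
    rw [e] at this
    linarith
  rw [SBM.blockEstimate, edgeCount_eq]
  have e : lin (blockW y k l) x / (pairCount y k l : ℝ) - P k l =
      (lin (blockW y k l) x - P k l * pairCount y k l) / pairCount y k l := by
    field_simp
  rw [e, abs_div, abs_of_pos hpc0, div_le_iff₀ hpc0]
  refine h4.trans ?_
  calc 55 * τ * n = 440 * b ^ 2 * τ / n * (n ^ 2 / (8 * b ^ 2)) := by field_simp; norm_num
    _ ≤ _ := by gcongr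

end BlockEstimate

/-! ### Perturbed likelihood ratios -/

/-- Connectivity matrices with entries of the order `ps`, bounded away from `1`. -/
structure BlockBounds {K : ℕ} (ε ω ps : ℝ) (P : Matrix (Fin K) (Fin K) ℝ) : Prop where
  symm : P.IsSymm
  eps_pos : 0 < ε
  one_le : 1 ≤ ω
  ps_pos : 0 < ps
  ps_le : ps ≤ 1 - ε
  lower : ∀ k l, ps / ω ≤ P k l
  upper : ∀ k l, P k l ≤ ps

section Perturbation

variable {K : ℕ} {ε ω ps d : ℝ} {P Q : Matrix (Fin K) (Fin K) ℝ}

lemma BlockBounds.comparable (h : BlockBounds ε ω ps P) {V : Type} (z : V → Fin K) (k l : Fin K) :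
    Comparable ε ω ps (pRow z P k) (pRow z P l) :=
  ⟨h.eps_pos, h.one_le, h.ps_pos, h.ps_le, fun _ => h.lower _ _, fun _ => h.upper _ _,
    fun _ => h.lower _ _, fun _ => h.upper _ _⟩

lemma BlockBounds.omega_pos (h : BlockBounds ε ω ps P) : 0 < ω := by linarith [h.one_le]

lemma BlockBounds.pos (h : BlockBounds ε ω ps P) (k l : Fin K) : 0 < P k l :=
  lt_of_lt_of_le (div_pos h.ps_pos h.omega_pos) (h.lower k l)

lemma BlockBounds.mem (h : BlockBounds ε ω ps P) (k l : Fin K) : 0 < P k l ∧ P k l < 1 :=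
  ⟨h.pos k l, by linarith [h.upper k l, h.ps_le, h.eps_pos]⟩

lemma BlockBounds.bw_pos (h : BlockBounds ε ω ps P) (k l : Fin K) (b : Bool) : 0 < bw (P k l) b :=
  SBM.bw_pos (h.mem k l).1 (h.mem k l).2 b

lemma le_mul_exp_of_sub_le {u v m t : ℝ} (hm : 0 < m) (hv : m ≤ v) (ht : 0 ≤ t) (h : u ≤ v + t) :
    u ≤ v * Real.exp (t / m) := by
  have hv0 : 0 < v := hm.trans_le hv
  calc u ≤ v + t := h
    _ ≤ v * (t / m + 1) := by
        have : t ≤ v * (t / m) := by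
          rw [mul_div_assoc', le_div_iff₀ hm]; nlinarith
        linarith
    _ ≤ _ := by have := Real.add_one_le_exp (t / m); gcongr

/-- An additive error `d` costs an exponent of order `d / ps` at an edge but only of order `d` at a
non-edge. A row has about `n ps` edges and `n` non-edges, so for `d` of order `τ / n` both totals
are of order `τ`. -/
lemma BlockBounds.bw_est_le (h : BlockBounds ε ω ps P) (hd : 0 ≤ d) (hQ : ∀ k l, |Q k l - P k l| ≤ d)
    (k l : Fin K) (b : Bool) :
    bw (Q k l) b ≤ bw (P k l) b * Real.exp (d * ω / ps * bit b + d / ε) := by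
  have hq := abs_le.1 (hQ k l)
  have hω := h.omega_pos
  have hps := h.ps_pos
  have hε := h.eps_pos
  have hpos := h.bw_pos k l b
  cases b
  · simp only [bw_false, bit_false, mul_zero, zero_add]
    exact le_mul_exp_of_sub_le hε (by linarith [h.upper k l, h.ps_le]) hd (by linarith)
  · simp only [bw_true, bit_true, mul_one] at hpos ⊢
    have h1 := le_mul_exp_of_sub_le (div_pos hps hω) (h.lower k l) hd
      (by linarith : Q k l ≤ P k l + d)
    have e : d / (ps / ω) = d * ω / ps := by field_simp
    rw [e] at h1
    refine h1.trans ?_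
    have : 0 ≤ d / ε := by positivity
    gcongr
    linarith

lemma BlockBounds.bw_le_est (h : BlockBounds ε ω ps P) (hd : 0 ≤ d) (hd1 : d ≤ ps / (2 * ω))
    (hd2 : d ≤ ε / 2) (hQ : ∀ k l, |Q k l - P k l| ≤ d) (k l : Fin K) (b : Bool) :
    0 < bw (Q k l) b ∧
    bw (P k l) b ≤ bw (Q k l) b * Real.exp (2 * (d * ω / ps) * bit b + 2 * (d / ε)) := by
  have hq := abs_le.1 (hQ k l)
  have hω := h.omega_pos
  have hps := h.ps_pos
  have hε := h.eps_pos
  have hl := h.lower k l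
  have e1 : ps / ω = ps / (2 * ω) + ps / (2 * ω) := by field_simp; norm_num
  have hQpos : ps / (2 * ω) ≤ Q k l := by linarith
  have h0 : 0 < ps / (2 * ω) := by positivity
  cases b
  · simp only [bw_false, bit_false, mul_zero, zero_add]
    have h2 : ε / 2 ≤ 1 - Q k l := by linarith [h.upper k l, h.ps_le]
    refine ⟨by linarith, ?_⟩
    have h1 := le_mul_exp_of_sub_le (half_pos hε) h2 hd (by linarith : 1 - P k l ≤ 1 - Q k l + d)
    have e : d / (ε / 2) = 2 * (d / ε) := by field_simp
    rwa [e] at h1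
  · simp only [bw_true, bit_true, mul_one]
    refine ⟨by linarith, ?_⟩
    have h1 := le_mul_exp_of_sub_le h0 hQpos hd (by linarith : P k l ≤ Q k l + d)
    have e : d / (ps / (2 * ω)) = 2 * (d * ω / ps) := by field_simp
    rw [e] at h1
    refine h1.trans ?_
    have : 0 ≤ d / ε := by positivity
    have : 0 < Q k l := by linarith
    gcongr
    linarith

/-- The price of one mislabelled neighbour: a bounded exponent at an edge, and one of order `ps` at
a non-edge. -/
lemma BlockBounds.bw_le_bw (h : BlockBounds ε ω ps P) (k l k' l' : Fin K) (b : Bool) :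
    bw (P k l) b ≤ bw (P k' l') b * Real.exp (Real.log ω * bit b + ps / ε) := by
  have hω := h.omega_pos
  have hps := h.ps_pos
  have hε := h.eps_pos
  cases b
  · simp only [bw_false, bit_false, mul_zero, zero_add]
    exact le_mul_exp_of_sub_le hε (by linarith [h.upper k' l', h.ps_le]) hps.le
      (by linarith [h.pos k l, h.upper k' l'])
  · simp only [bw_true, bit_true, mul_one]
    have h1 : 1 ≤ Real.exp (ps / ε) := Real.one_le_exp (by positivity)
    rw [Real.exp_add, Real.exp_log hω]
    have h2 : P k l ≤ P k' l' * ω := by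
      have h3 := h.lower k' l'
      rw [div_le_iff₀ hω] at h3
      exact (h.upper k l).trans h3
    have h3 : 0 < P k' l' * ω := mul_pos (h.pos _ _) hω
    nlinarith

/-- Exponent by which the likelihood ratio at a neighbour may change. -/
def pertC (ω ps d : ℝ) (bad : Prop) : ℝ :=
  3 * (d * ω / ps) + if bad then 2 * Real.log ω else 0

/-- Exponent by which the likelihood ratio at a non-neighbour may change. -/
def pertG (ε ps d : ℝ) (bad : Prop) : ℝ := 3 * (d / ε) + if bad then 2 * (ps / ε) else 0

lemma BlockBounds.pertC_nonneg (h : BlockBounds ε ω ps P) (hd : 0 ≤ d) (bad : Prop) :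
    0 ≤ pertC ω ps d bad := by
  have hω := h.omega_pos
  have hps := h.ps_pos
  have := Real.log_nonneg h.one_le
  unfold pertC
  split_ifs <;> positivity

lemma BlockBounds.pertG_nonneg (h : BlockBounds ε ω ps P) (hd : 0 ≤ d) (bad : Prop) :
    0 ≤ pertG ε ps d bad := by
  have hε := h.eps_pos
  have hps := h.ps_pos
  unfold pertG
  split_ifs <;> positivity

variable {V : Type} {z : V → Fin K}

/-- Some label other than the true one maximizes the likelihood for node `i`, for some
connectivities `Q` within `d` of `P`. -/
def RowErr (z : V → Fin K) (P : Matrix (Fin K) (Fin K) ℝ) (d : ℝ) (S : Finset V) (u : V → Fin K)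
    (i : V) (ξ : V → Bool) : Prop :=
  ∃ Q : Matrix (Fin K) (Fin K) ℝ, (∀ k l, |Q k l - P k l| ≤ d) ∧ ∃ k, k ≠ z i ∧
    ∏ a ∈ S.filter (fun a => a ≠ i), bw (Q (z i) (u a)) (ξ a) ≤
      ∏ a ∈ S.filter (fun a => a ≠ i), bw (Q k (u a)) (ξ a)

/-- Total variation affinity of the laws with parameter vectors `p_{k*}` and `p_{l*}`. -/
def pairAff [Fintype V] (z : V → Fin K) (P : Matrix (Fin K) (Fin K) ℝ) (k l : Fin K) : ℝ :=
  affinity (bernProd (pRow z P k)) (bernProd (pRow z P l))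

/-- The classifier for node `i` errs for some connectivities within `d` of `P` and some labels
that are correct outside `M`. -/
def FinalErr [Fintype V] (z : V → Fin K) (P : Matrix (Fin K) (Fin K) ℝ) (d : ℝ) (M : Finset V)
    (i : V) (ξ : V → Bool) : Prop :=
  ∃ u : V → Fin K, (∀ a, a ∉ M → u a = z a ∧ a ≠ i) ∧ RowErr z P d Finset.univ u i ξ

/-- Changing `Q` and `u` into `P` and `z` has a price that depends only on `M` and the bits of the
row. All choices of `Q` and `u` are thereby treated at once, and no union bound over them is needed.
-/
lemma RowErr.exists_le (h : BlockBounds ε ω ps P) (hd : 0 ≤ d) (hd1 : d ≤ ps / (2 * ω))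
    (hd2 : d ≤ ε / 2) {S M : Finset V} {u : V → Fin K} {i : V} {ξ : V → Bool}
    (hM : ∀ a ∈ S, a ∉ M → u a = z a ∧ a ≠ i) (herr : RowErr z P d S u i ξ) :
    ∃ k, k ≠ z i ∧ ∏ a ∈ S, bw (P (z i) (z a)) (ξ a) ≤
      ∏ a ∈ S, (bw (P k (z a)) (ξ a) *
        Real.exp (pertC ω ps d (a ∈ M) * bit (ξ a) + pertG ε ps d (a ∈ M))) := by
  obtain ⟨Q, hQ, k, hk, hle⟩ := herr
  refine ⟨k, hk, ?_⟩
  have hlog := Real.log_nonneg h.one_le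
  have hω := h.omega_pos
  have hps := h.ps_pos
  have hε := h.eps_pos
  set X := d * ω / ps with hX
  set Y := d / ε with hY
  set Z := ps / ε with hZ
  have hX0 : 0 ≤ X := by positivity
  have hY0 : 0 ≤ Y := by positivity
  have hZ0 : 0 ≤ Z := by positivity
  let c1 : V → ℝ := fun a => (if a ∈ M then Real.log ω else 0)
  let g1 : V → ℝ := fun a => (if a ∈ M then Z else 0)
  have hlab : ∀ k' : Fin K, ∀ a ∈ S, a ∈ M ∨ u a = z a := fun k' a ha => by
    by_cases hm : a ∈ M
    · exact Or.inl hm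
    · exact Or.inr (hM a ha hm).1
  have hA : ∀ k', ∀ a ∈ S, bw (P k' (z a)) (ξ a) ≤
      bw (P k' (u a)) (ξ a) * Real.exp (c1 a * bit (ξ a) + g1 a) := by
    intro k' a ha
    by_cases hm : a ∈ M
    · simp only [c1, g1, hm, if_true]; exact h.bw_le_bw _ _ _ _ _
    · simp [c1, g1, hm, (hM a ha hm).1]
  have hB : ∀ k', ∀ a ∈ S, bw (P k' (u a)) (ξ a) ≤
      bw (P k' (z a)) (ξ a) * Real.exp (c1 a * bit (ξ a) + g1 a) := by
    intro k' a ha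
    by_cases hm : a ∈ M
    · simp only [c1, g1, hm, if_true]; exact h.bw_le_bw _ _ _ _ _
    · simp [c1, g1, hm, (hM a ha hm).1]
  set T := S.filter (fun a => a ≠ i) with hT
  have hTS : ∀ a ∈ T, a ∈ S := fun a ha => (Finset.mem_filter.1 ha).1
  have h1 : ∏ a ∈ T, bw (P (z i) (z a)) (ξ a) ≤ ∏ a ∈ T, (bw (Q (z i) (u a)) (ξ a) *
      Real.exp ((c1 a + 2 * X) * bit (ξ a) + (g1 a + 2 * Y))) := by
    refine Finset.prod_le_prod (fun a _ => (h.bw_pos _ _ _).le) fun a ha => ?_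
    have e1 := hA (z i) a (hTS a ha)
    have e2 := (h.bw_le_est hd hd1 hd2 hQ (z i) (u a) (ξ a)).2
    calc _ ≤ _ := e1
      _ ≤ (bw (Q (z i) (u a)) (ξ a) * Real.exp (2 * X * bit (ξ a) + 2 * Y)) *
          Real.exp (c1 a * bit (ξ a) + g1 a) := by gcongr
      _ = _ := by rw [mul_assoc, ← Real.exp_add]; congr 2; ring
  have h2 : ∏ a ∈ T, bw (Q k (u a)) (ξ a) ≤ ∏ a ∈ T, (bw (P k (z a)) (ξ a) *
      Real.exp ((c1 a + X) * bit (ξ a) + (g1 a + Y))) := by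
    refine Finset.prod_le_prod (fun a _ => (h.bw_le_est hd hd1 hd2 hQ _ _ _).1.le) fun a ha => ?_
    have e1 := hB k a (hTS a ha)
    have e2 := h.bw_est_le hd hQ k (u a) (ξ a)
    calc _ ≤ _ := e2
      _ ≤ (bw (P k (z a)) (ξ a) * Real.exp (c1 a * bit (ξ a) + g1 a)) *
          Real.exp (X * bit (ξ a) + Y) := by gcongr
      _ = _ := by rw [mul_assoc, ← Real.exp_add]; congr 2; ring
  have h3 : ∏ a ∈ T, bw (P (z i) (z a)) (ξ a) ≤ ∏ a ∈ T, (bw (P k (z a)) (ξ a) *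
        Real.exp (pertC ω ps d (a ∈ M) * bit (ξ a) + pertG ε ps d (a ∈ M))) := by
    rw [Finset.prod_mul_distrib] at h1 h2 ⊢
    set E1 := ∏ a ∈ T, Real.exp ((c1 a + 2 * X) * bit (ξ a) + (g1 a + 2 * Y))
    set E2 := ∏ a ∈ T, Real.exp ((c1 a + X) * bit (ξ a) + (g1 a + Y))
    have hE1 : 0 < E1 := Finset.prod_pos fun _ _ => Real.exp_pos _
    -- The estimate costs `2 X` for the true label and `X` for the competitor, and the labels cost
    -- `c1` and `g1` on each side. Hence the factors 3 and 2 in `pertC` and `pertG`.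
    have hE : E2 * E1 = ∏ a ∈ T,
        Real.exp (pertC ω ps d (a ∈ M) * bit (ξ a) + pertG ε ps d (a ∈ M)) := by
      rw [← Finset.prod_mul_distrib]
      refine Finset.prod_congr rfl fun a _ => ?_
      rw [← Real.exp_add]
      congr 1
      by_cases hm : a ∈ M <;> simp only [c1, g1, pertC, pertG, hm, if_true, if_false] <;> ring
    rw [← hE, ← mul_assoc]
    refine h1.trans (mul_le_mul_of_nonneg_right (hle.trans h2) hE1.le)
  -- The classifier omits node `i`, whereas the full product contains it. By hypothesis `i` then
  -- lies in `M`, and the allowance for a mislabelled node covers the missing factor.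
  by_cases hi : i ∈ S
  · have hTe : T = S.erase i := by ext a; simp [hT, and_comm]
    rw [hTe] at h3
    rw [← Finset.mul_prod_erase S _ hi, ← Finset.mul_prod_erase S _ hi]
    refine mul_le_mul ?_ h3 (Finset.prod_nonneg fun a _ => (h.bw_pos _ _ _).le)
      (mul_pos (h.bw_pos _ _ _) (Real.exp_pos _)).le
    have hiM : i ∈ M := by
      by_contra hm
      exact (hM i hi hm).2 rfl
    refine (h.bw_le_bw (z i) (z i) k (z i) (ξ i)).trans ?_
    have hb := bit_nonneg (ξ i)
    have hp := (h.bw_pos k (z i) (ξ i)).le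
    gcongr
    · simp only [pertC, hiM, if_true]; linarith
    · simp only [pertG, hiM, if_true]; linarith
  · have hTe : T = S := by
      rw [hT]; apply Finset.filter_true_of_mem
      rintro a ha rfl; exact hi ha
    rwa [hTe] at h3

/-- The total effect of perturbations of the likelihood ratios at scale `τ`. -/
lemma BlockBounds.sum_pert_le (h : BlockBounds ε ω ps P) [Fintype V] {B τ : ℝ} (hB : 0 ≤ B)
    (hτ : 0 < τ) (hV : 0 < Fintype.card V) (hd : d = B * τ / Fintype.card V)
    (hd1 : d ≤ ps / (2 * ω)) {M : Finset V} (hM : (M.card : ℝ) ≤ 3 * τ / ps) :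
    ∑ a, (pertG ε ps d (a ∈ M) + ps / ε * (Real.exp (pertC ω ps d (a ∈ M)) - 1)) ≤
      (3 * B + 6 + 15 * B * ω + 15 * ω ^ 2) / ε * τ := by
  have hω := h.omega_pos
  have hps := h.ps_pos
  have hε := h.eps_pos
  set n : ℝ := (Fintype.card V : ℝ) with hn
  have hn0 : 0 < n := by rw [hn]; exact_mod_cast hV
  have hd0 : 0 ≤ d := by rw [hd]; positivity
  set X := 3 * (d * ω / ps) with hX
  have hX0 : 0 ≤ X := by positivity
  have hX1 : X ≤ 3 / 2 := by
    rw [le_div_iff₀ (by positivity)] at hd1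
    rw [hX, mul_div_assoc', div_le_iff₀ hps]
    linarith
  have hexp : Real.exp X ≤ 5 := by
    have h1 : Real.exp X ≤ Real.exp (3 / 2) := Real.exp_le_exp.2 hX1
    have h2 : Real.exp (3 / 2) ^ 2 = Real.exp 1 ^ 3 := by
      rw [← Real.exp_nat_mul, ← Real.exp_nat_mul]; norm_num
    have h3 := Real.exp_one_lt_d9
    have h4 : Real.exp 1 ^ 3 ≤ 2.7182818286 ^ 3 :=
      pow_le_pow_left₀ (Real.exp_pos _).le h3.le 3
    have h5 : Real.exp (3 / 2) ≤ 5 := by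
      by_contra hcon
      push Not at hcon
      have : (5 : ℝ) ^ 2 < Real.exp (3 / 2) ^ 2 := by gcongr
      rw [h2] at this
      norm_num at h4 this
      linarith
    linarith
  have hexp1 : Real.exp X - 1 ≤ 5 * X := by
    have h1 := Real.add_one_le_exp (-X)
    have h2 : Real.exp X * Real.exp (-X) = 1 := by rw [← Real.exp_add]; simp
    nlinarith [Real.exp_pos X]
  -- Every node pays an amount of order `d`, and nodes in `M` pay in addition an amount of order
  -- `ps`. Both sums are of order `τ`, as `n d = B τ` and `|M| ps ≤ 3 τ`.
  have hterm : ∀ a : V, pertG ε ps d (a ∈ M) + ps / ε * (Real.exp (pertC ω ps d (a ∈ M)) - 1) ≤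
      (3 * (d / ε) + ps / ε * (5 * X)) +
        (if a ∈ M then 2 * (ps / ε) + ps / ε * (5 * ω ^ 2) else 0) := by
    intro a
    have hpe : 0 < ps / ε := by positivity
    by_cases hm : a ∈ M
    · simp only [pertG, pertC, hm, if_true]
      have : Real.exp (X + 2 * Real.log ω) ≤ 5 * ω ^ 2 := by
        rw [Real.exp_add, two_mul, Real.exp_add, Real.exp_log hω, ← sq]
        gcongr
      have h1 : ps / ε * (Real.exp (X + 2 * Real.log ω) - 1) ≤ ps / ε * (5 * ω ^ 2) := by
        gcongr; linarith
      have h2 : 0 ≤ ps / ε * (5 * X) := by positivity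
      linarith
    · simp only [pertG, pertC, hm, if_false, add_zero]
      gcongr
  refine (Finset.sum_le_sum fun a _ => hterm a).trans ?_
  rw [Finset.sum_add_distrib, Finset.sum_const, Finset.card_univ, nsmul_eq_mul,
    Finset.sum_ite_mem, Finset.univ_inter, Finset.sum_const, nsmul_eq_mul, ← hn]
  have hMps : (M.card : ℝ) * ps ≤ 3 * τ := by rwa [le_div_iff₀ hps] at hM
  have e1 : n * (3 * (d / ε) + ps / ε * (5 * X)) = (3 * B + 15 * B * ω) / ε * τ := by
    rw [hX, hd]; field_simp; ring
  have e2 : (M.card : ℝ) * (2 * (ps / ε) + ps / ε * (5 * ω ^ 2)) =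
      (2 + 5 * ω ^ 2) / ε * (M.card * ps) := by field_simp
  rw [e1, e2]
  have h3 : (2 + 5 * ω ^ 2) / ε * (M.card * ps) ≤ (2 + 5 * ω ^ 2) / ε * (3 * τ) := by gcongr
  have e3 : (3 * B + 6 + 15 * B * ω + 15 * ω ^ 2) / ε * τ =
      (3 * B + 15 * B * ω) / ε * τ + (2 + 5 * ω ^ 2) / ε * (3 * τ) := by ring
  linarith

lemma RowErr.congr [Fintype V] {S : Finset V} {u : V → Fin K} {i : V} {ξ ξ' : V → Bool}
    (h : ∀ a ∈ S, ξ a = ξ' a) : RowErr z P d S u i ξ ↔ RowErr z P d S u i ξ' := by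
  unfold RowErr
  have e : ∀ (Q : Matrix (Fin K) (Fin K) ℝ) (k : Fin K),
      ∏ a ∈ S.filter (fun a => a ≠ i), bw (Q k (u a)) (ξ a) =
      ∏ a ∈ S.filter (fun a => a ≠ i), bw (Q k (u a)) (ξ' a) := fun Q k =>
    Finset.prod_congr rfl fun a ha => by rw [h a (Finset.mem_filter.1 ha).1]
  simp only [e]

lemma RowErr.congr_labels [Fintype V] {S : Finset V} {u u' : V → Fin K} {i : V} {ξ : V → Bool}
    (h : ∀ a ∈ S, u a = u' a) : RowErr z P d S u i ξ ↔ RowErr z P d S u' i ξ := by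
  unfold RowErr
  have e : ∀ (Q : Matrix (Fin K) (Fin K) ℝ) (k : Fin K),
      ∏ a ∈ S.filter (fun a => a ≠ i), bw (Q k (u a)) (ξ a) =
      ∏ a ∈ S.filter (fun a => a ≠ i), bw (Q k (u' a)) (ξ a) := fun Q k =>
    Finset.prod_congr rfl fun a ha => by rw [h a (Finset.mem_filter.1 ha).1]
  simp only [e]

/-- Error probability for a node classified by its edges to `S`, through the Hellinger affinity. -/
lemma BlockBounds.bP_rowErr_le (h : BlockBounds ε ω ps P) [Fintype V] (hd : 0 ≤ d)
    (hd1 : d ≤ ps / (2 * ω)) (hd2 : d ≤ ε / 2) {S M : Finset V} {u : V → Fin K} {i : V}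
    (hM : ∀ a ∈ S, a ∉ M → u a = z a ∧ a ≠ i) {X R : ℝ}
    (hX : ∀ k, k ≠ z i → X ≤ ∑ a ∈ S, (P (z i) (z a) - P k (z a)) ^ 2 / ps)
    (hR : ∑ a, (pertG ε ps d (a ∈ M) + ps / ε * (Real.exp (pertC ω ps d (a ∈ M)) - 1)) ≤ R) :
    bP (pRow z P (z i)) (RowErr z P d S u i) ≤ K * Real.exp (R - X / 8) := by
  have hω := h.omega_pos
  have hps := h.ps_pos
  have hε := h.eps_pos
  have hp : ∀ a, 0 ≤ pRow z P (z i) a ∧ pRow z P (z i) a ≤ 1 := (h.comparable z (z i) (z i)).p_mem'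
  -- Markov's inequality for the square root of the perturbed likelihood ratio, whose mean
  -- factorizes into perturbed Bhattacharyya coefficients. The constant lost in the exponent is
  -- harmless in the first step.
  let G : Fin K → V → Bool → ℝ := fun k a b => if a ∈ S then
    Real.exp (1 / 2 * (lr (P (z i) (z a)) (P k (z a)) b +
      (pertC ω ps d (a ∈ M) * bit b + pertG ε ps d (a ∈ M)))) else 1
  have hG0 : ∀ k a b, 0 < G k a b := by
    intro k a b; simp only [G]; split_ifs
    · exact Real.exp_pos _
    · norm_num
  have h1 : bP (pRow z P (z i)) (RowErr z P d S u i) ≤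
      bE (pRow z P (z i)) (fun ξ => ∑ k ∈ Finset.univ.erase (z i), ∏ a, G k a (ξ a)) := by
    refine bP_le_bE hp (fun ξ => Finset.sum_nonneg fun k _ =>
      Finset.prod_nonneg fun a _ => (hG0 _ _ _).le) fun ξ hξ => ?_
    obtain ⟨k, hk, hle⟩ := hξ.exists_le h hd hd1 hd2 hM
    refine le_trans ?_ (Finset.single_le_sum (f := fun k => ∏ a, G k a (ξ a))
      (fun k _ => Finset.prod_nonneg fun a _ => (hG0 _ _ _).le)
      (Finset.mem_erase.2 ⟨hk, Finset.mem_univ k⟩))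
    have e1 : ∏ a, G k a (ξ a) = ∏ a ∈ S, Real.exp (1 / 2 * (lr (P (z i) (z a)) (P k (z a)) (ξ a) +
      (pertC ω ps d (a ∈ M) * bit (ξ a) + pertG ε ps d (a ∈ M)))) := by
      simp only [G, Finset.prod_ite_mem, Finset.univ_inter]
    rw [e1, ← Real.exp_sum, ← Finset.mul_sum]
    apply Real.one_le_exp
    have hpos : 0 < ∏ a ∈ S, bw (P (z i) (z a)) (ξ a) := Finset.prod_pos fun a _ => h.bw_pos _ _ _
    have h2 := Real.log_le_log hpos hle
    rw [Real.log_prod (fun a _ => (h.bw_pos _ _ _).ne'),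
      Real.log_prod (fun a _ => (mul_pos (h.bw_pos _ _ _) (Real.exp_pos _)).ne')] at h2
    have e2 : ∀ a ∈ S, Real.log (bw (P k (z a)) (ξ a) *
        Real.exp (pertC ω ps d (a ∈ M) * bit (ξ a) + pertG ε ps d (a ∈ M))) =
        Real.log (bw (P k (z a)) (ξ a)) +
          (pertC ω ps d (a ∈ M) * bit (ξ a) + pertG ε ps d (a ∈ M)) := fun a _ => by
      rw [Real.log_mul (h.bw_pos _ _ _).ne' (Real.exp_pos _).ne', Real.log_exp]
    rw [Finset.sum_congr rfl e2] at h2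
    have h3 : 0 ≤ ∑ a ∈ S, (lr (P (z i) (z a)) (P k (z a)) (ξ a) +
        (pertC ω ps d (a ∈ M) * bit (ξ a) + pertG ε ps d (a ∈ M))) := by
      simp only [lr, Finset.sum_add_distrib, Finset.sum_sub_distrib] at h2 ⊢
      linarith
    linarith
  refine h1.trans ?_
  rw [bE_sum]
  have h2 : ∀ k ∈ Finset.univ.erase (z i), bE (pRow z P (z i)) (fun ξ => ∏ a, G k a (ξ a)) ≤
      Real.exp (R - X / 8) := by
    intro k hk
    have hk' := Finset.ne_of_mem_erase hk
    rw [bE_prod]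
    have hfac : ∀ a, pRow z P (z i) a * G k a true + (1 - pRow z P (z i) a) * G k a false ≤
        Real.exp ((pertG ε ps d (a ∈ M) + ps / ε * (Real.exp (pertC ω ps d (a ∈ M)) - 1)) -
          (if a ∈ S then (P (z i) (z a) - P k (z a)) ^ 2 / ps / 8 else 0)) := by
      intro a
      have hg := h.pertG_nonneg hd (a ∈ M)
      have hc := h.pertC_nonneg hd (a ∈ M)
      set g := pertG ε ps d (a ∈ M)
      set c := pertC ω ps d (a ∈ M)
      have hec : 1 ≤ Real.exp c := Real.one_le_exp hc
      by_cases ha : a ∈ S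
      · simp only [G, ha, if_true, bit_true, bit_false, mul_one, mul_zero, zero_add, pRow]
        set p := P (z i) (z a)
        set q := P k (z a)
        have hpm : 0 < p ∧ p < 1 := h.mem _ _
        have hqm : 0 < q ∧ q < 1 := h.mem _ _
        have s1 := bw_mul_exp_half (a := p) (b := q) true (h.bw_pos _ _ _) (h.bw_pos _ _ _)
        have s0 := bw_mul_exp_half (a := p) (b := q) false (h.bw_pos _ _ _) (h.bw_pos _ _ _)
        simp only [bw_true, bw_false] at s1 s0
        have f1 : p * Real.exp (1 / 2 * (lr p q true + (c + g))) =
            Real.sqrt (p * q) * Real.exp (c / 2) * Real.exp (g / 2) := by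
          rw [← s1, mul_assoc, mul_assoc, ← Real.exp_add, ← Real.exp_add]
          congr 2; ring
        have f0 : (1 - p) * Real.exp (1 / 2 * (lr p q false + g)) =
            Real.sqrt ((1 - p) * (1 - q)) * Real.exp (g / 2) := by
          rw [← s0, mul_assoc, ← Real.exp_add]
          congr 2; ring
        rw [f1, f0]
        -- The same odds bound as for the minimum, now for the geometric mean: it limits the cost of
        -- the tilt at an edge.
        have hsq : Real.sqrt (p * q) ≤ ps / ε * Real.sqrt ((1 - p) * (1 - q)) := by
          have e : ps / ε * Real.sqrt ((1 - p) * (1 - q)) =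
              Real.sqrt ((ps / ε) ^ 2 * ((1 - p) * (1 - q))) := by
            rw [Real.sqrt_mul (sq_nonneg _), Real.sqrt_sq (by positivity)]
          rw [e]
          apply Real.sqrt_le_sqrt
          have t : ∀ v, v ≤ ps → v ≤ ps / ε * (1 - v) := by
            intro v hv
            have : ε ≤ 1 - v := by linarith [h.ps_le]
            calc v ≤ ps := hv
              _ = ps / ε * ε := by field_simp
              _ ≤ _ := by gcongr
          calc p * q ≤ (ps / ε * (1 - p)) * (ps / ε * (1 - q)) :=
                mul_le_mul (t p (h.upper _ _)) (t q (h.upper _ _)) hqm.1.le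
                  (by have : 0 < 1 - p := by linarith
                      positivity)
            _ = _ := by ring
        have hbc := bhattacharyya_le hps hpm.1 hpm.2 hqm.1 hqm.2 (h.upper _ _) (h.upper _ _)
        set A := Real.sqrt (p * q)
        set B := Real.sqrt ((1 - p) * (1 - q))
        have hA0 : 0 ≤ A := Real.sqrt_nonneg _
        have hB0 : 0 ≤ B := Real.sqrt_nonneg _
        have hec2 : Real.exp (c / 2) ≤ Real.exp c := Real.exp_le_exp.2 (by linarith)
        have heg2 : Real.exp (g / 2) ≤ Real.exp g := Real.exp_le_exp.2 (by linarith)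
        have hmain : A * Real.exp (c / 2) + B ≤ (A + B) * (1 + ps / ε * (Real.exp c - 1)) := by
          have t1 : A * (Real.exp c - 1) ≤ ps / ε * B * (Real.exp c - 1) := by
            gcongr
          have t2 : 0 ≤ A * (ps / ε * (Real.exp c - 1)) := by
            have : 0 ≤ Real.exp c - 1 := by linarith
            positivity
          nlinarith [mul_le_mul_of_nonneg_left hec2 hA0]
        have hone := Real.add_one_le_exp (ps / ε * (Real.exp c - 1))
        have hfacnn : 0 ≤ 1 + ps / ε * (Real.exp c - 1) := by
          have : 0 ≤ Real.exp c - 1 := by linarith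
          positivity
        calc A * Real.exp (c / 2) * Real.exp (g / 2) + B * Real.exp (g / 2)
            = (A * Real.exp (c / 2) + B) * Real.exp (g / 2) := by ring
          _ ≤ ((A + B) * (1 + ps / ε * (Real.exp c - 1))) * Real.exp g := by gcongr
          _ ≤ (Real.exp (-((p - q) ^ 2 / ps / 8)) * Real.exp (ps / ε * (Real.exp c - 1))) *
              Real.exp g := by
            gcongr
            linarith
          _ = _ := by rw [← Real.exp_add, ← Real.exp_add]; congr 1; ring
      · simp only [G, ha, if_false, mul_one, add_sub_cancel, sub_zero]
        apply Real.one_le_exp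
        have : 0 ≤ Real.exp c - 1 := by linarith
        positivity
    refine (Finset.prod_le_prod (fun a _ => ?_) fun a _ => hfac a).trans ?_
    · have := hp a
      have := hG0 k a true
      have := hG0 k a false
      have : 0 ≤ 1 - pRow z P (z i) a := by linarith
      have : 0 ≤ pRow z P (z i) a := by linarith
      positivity
    · rw [← Real.exp_sum]
      apply Real.exp_le_exp.2
      rw [Finset.sum_sub_distrib, Finset.sum_ite_mem, Finset.univ_inter, ← Finset.sum_div]
      have := hX k hk'
      linarith
  refine (Finset.sum_le_sum h2).trans ?_
  rw [Finset.sum_const, nsmul_eq_mul]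
  gcongr
  calc (Finset.univ.erase (z i)).card ≤ (Finset.univ : Finset (Fin K)).card :=
        Finset.card_le_card (Finset.erase_subset _ _)
    _ = K := by simp

/-- Error probability for a node classified by all its edges, through the total variation
affinity. -/
lemma BlockBounds.bP_rowErr_le_affinity (h : BlockBounds ε ω ps P) [Fintype V] (hd : 0 ≤ d)
    (hd1 : d ≤ ps / (2 * ω)) (hd2 : d ≤ ε / 2) {M : Finset V} {i : V} {R η : ℝ}
    (hη : ∀ k, k ≠ z i → pairAff z P (z i) k ≤ η)
    (hη0 : 0 ≤ η)
    (hR : ∑ a, (pertG ε ps d (a ∈ M) + ps / ε * (Real.exp (pertC ω ps d (a ∈ M)) - 1)) ≤ R) :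
    bP (pRow z P (z i)) (FinalErr z P d M i) ≤ K * (Real.exp R * η) := by
  have hps := h.ps_pos
  have hε := h.eps_pos
  set g := ∑ a, pertG ε ps d (a ∈ M) with hg
  have hg0 : 0 ≤ g := Finset.sum_nonneg fun a _ => h.pertG_nonneg hd _
  -- On the error event the true mass is bounded by the perturbed mass of some `k`, and trivially by
  -- its own perturbed mass, hence by the perturbed minimum. This preserves the affinity and not
  -- merely its exponential rate.
  have h1 : bP (pRow z P (z i)) (FinalErr z P d M i) ≤
      ∑ ξ, ∑ k ∈ Finset.univ.erase (z i), Real.exp g *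
        (min (bernProd (pRow z P (z i)) ξ) (bernProd (pRow z P k) ξ) *
          Real.exp (∑ a, pertC ω ps d (a ∈ M) * bit (ξ a))) := by
    rw [bP, bE]
    refine Finset.sum_le_sum fun ξ _ => ?_
    have hpos : ∀ k, 0 < bernProd (pRow z P k) ξ := fun k =>
      bernProd_pos (h.comparable z k k).p_mem ξ
    have hnn : ∀ k ∈ Finset.univ.erase (z i), 0 ≤ Real.exp g *
        (min (bernProd (pRow z P (z i)) ξ) (bernProd (pRow z P k) ξ) *
          Real.exp (∑ a, pertC ω ps d (a ∈ M) * bit (ξ a))) := by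
      intro k _
      have := le_min (hpos (z i)).le (hpos k).le
      positivity
    split_ifs with hξ
    · obtain ⟨u, hM, hξ⟩ := hξ
      obtain ⟨k, hk, hle⟩ := hξ.exists_le h hd hd1 hd2 (fun a _ ha => hM a ha)
      rw [mul_one]
      refine le_trans ?_ (Finset.single_le_sum hnn (Finset.mem_erase.2 ⟨hk, Finset.mem_univ k⟩))
      rw [Finset.prod_mul_distrib, ← Real.exp_sum, Finset.sum_add_distrib, ← hg] at hle
      set s := ∑ a, pertC ω ps d (a ∈ M) * bit (ξ a) with hs
      have hs0 : 0 ≤ s := Finset.sum_nonneg fun a _ =>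
        mul_nonneg (h.pertC_nonneg hd _) (bit_nonneg _)
      change bernProd (pRow z P (z i)) ξ ≤ bernProd (pRow z P k) ξ * Real.exp (s + g) at hle
      have h2 : bernProd (pRow z P (z i)) ξ ≤ bernProd (pRow z P (z i)) ξ * Real.exp (s + g) :=
        le_mul_of_one_le_right (hpos _).le (Real.one_le_exp (by linarith))
      calc _ ≤ min (bernProd (pRow z P (z i)) ξ) (bernProd (pRow z P k) ξ) * Real.exp (s + g) := by
            rw [min_mul_of_nonneg _ _ (Real.exp_pos _).le]
            exact le_min h2 hle
        _ = _ := by rw [Real.exp_add]; ring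
    · rw [mul_zero]
      exact Finset.sum_nonneg hnn
  refine h1.trans ?_
  rw [Finset.sum_comm]
  have h2 : ∀ k ∈ Finset.univ.erase (z i), ∑ ξ, Real.exp g *
        (min (bernProd (pRow z P (z i)) ξ) (bernProd (pRow z P k) ξ) *
          Real.exp (∑ a, pertC ω ps d (a ∈ M) * bit (ξ a))) ≤ Real.exp R * η := by
    intro k hk
    rw [← Finset.mul_sum]
    have h3 := sum_min_mul_exp_le (h.comparable z (z i) k) (fun a => pertC ω ps d (a ∈ M))
      (fun a => h.pertC_nonneg hd _)
    calc _ ≤ Real.exp g * (Real.exp (ps / ε * ∑ a, (Real.exp (pertC ω ps d (a ∈ M)) - 1)) *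
          affinity (bernProd (pRow z P (z i))) (bernProd (pRow z P k))) := by gcongr
      _ = Real.exp (g + ps / ε * ∑ a, (Real.exp (pertC ω ps d (a ∈ M)) - 1)) *
          affinity (bernProd (pRow z P (z i))) (bernProd (pRow z P k)) := by
          rw [Real.exp_add, mul_assoc]
      _ ≤ Real.exp R * η := by
          refine mul_le_mul (Real.exp_le_exp.2 ?_) (hη k (Finset.ne_of_mem_erase hk))
            (affinity_pos (h.comparable z (z i) k)).le (Real.exp_pos _).le
          rw [Finset.sum_add_distrib, ← Finset.mul_sum] at hR
          exact hR
  refine (Finset.sum_le_sum h2).trans ?_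
  rw [Finset.sum_const, nsmul_eq_mul]
  gcongr
  calc (Finset.univ.erase (z i)).card ≤ (Finset.univ : Finset (Fin K)).card :=
        Finset.card_le_card (Finset.erase_subset _ _)
    _ = K := by simp

end Perturbation

/-! ### The two likelihood-ratio steps -/

section Relabel

variable {V : Type} [Fintype V] {K : ℕ}

/-- The estimate is equivariant under permutations of the labels. The unknown alignment can
therefore be moved through each likelihood-ratio step. -/
lemma blockEstimate_comp (G : SimpleGraph V) (π : Equiv.Perm (Fin K)) (y : V → Fin K)
    (k l : Fin K) : blockEstimate G (fun v => π (y v)) (π k) (π l) = blockEstimate G y k l := by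
  unfold blockEstimate edgeCount pairCount
  simp only [EmbeddingLike.apply_eq_iff_eq]

lemma IsLRLabel.comp {G : SimpleGraph V} {y₀ y : V → Fin K} {S : Finset V} {i : V} {k : Fin K}
    (h : IsLRLabel G (blockEstimate G y₀) S y i k) (π : Equiv.Perm (Fin K)) :
    IsLRLabel G (blockEstimate G fun v => π (y₀ v)) S (fun v => π (y v)) i (π k) := by
  have e : ∀ l, likelihood G (blockEstimate G fun v => π (y₀ v)) S (fun v => π (y v)) i (π l) =
      likelihood G (blockEstimate G y₀) S y i l := by
    intro l
    unfold likelihood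
    refine Finset.prod_congr rfl fun a _ => ?_
    rw [blockEstimate_comp]
  intro l
  have := h (π.symm l)
  rw [← e, ← e, Equiv.apply_symm_apply] at this
  exact this

end Relabel

section Steps

variable {V : Type} [Fintype V] [LinearOrder V] {K : ℕ} {ε ω ps d : ℝ}
  {P : Matrix (Fin K) (Fin K) ℝ} {z : V → Fin K}

/-- Number of errors among the nodes of `A`, classified by their edges to `B` with fixed labels. -/
lemma BlockBounds.bP_count_le (h : BlockBounds ε ω ps P) {A B : Finset V} (hAB : Disjoint A B)
    (u : V → Fin K) {q s m : ℝ} (hs : 0 ≤ s)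
    (hq : ∀ i ∈ A, bP (pRow z P (z i)) (RowErr z P d B u i) ≤ q) :
    bP (edgeP z P) (fun y => m ≤ ((A.filter fun i => RowErr z P d B u i (row i y)).card : ℝ)) ≤
      Real.exp (A.card * (Real.exp s * q) - s * m) := by
  have hp := edgeP_mem (z := z) h.mem
  let F : V → (V × V → Bool) → ℝ := fun i y =>
    Real.exp (s * if RowErr z P d B u i (row i y) then 1 else 0)
  have h1 : bP (edgeP z P)
      (fun y => m ≤ ((A.filter fun i => RowErr z P d B u i (row i y)).card : ℝ)) ≤
      bE (edgeP z P) (fun y => Real.exp (-(s * m)) * ∏ i ∈ A, F i y) := by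
    refine bP_le_bE hp (fun y => by positivity) fun y hy => ?_
    simp only [F]
    rw [← Real.exp_sum, ← Real.exp_add, ← Finset.mul_sum, Finset.sum_boole]
    apply Real.one_le_exp
    have := mul_le_mul_of_nonneg_left hy hs
    linarith
  refine h1.trans ?_
  -- Since `A` and `B` are disjoint, different nodes of `A` use disjoint sets of edges to `B`, and
  -- their errors are independent.
  rw [bE_const_mul, bE_prod_of_dependsOn (edgeP z P) A
    (s := fun i => {e | ∃ a ∈ B, e = edge i a})]
  · rw [sub_eq_neg_add, Real.exp_add]
    refine mul_le_mul_of_nonneg_left ?_ (Real.exp_pos _).le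
    rw [Real.exp_nat_mul, ← Finset.prod_const]
    refine Finset.prod_le_prod (fun i _ => bE_nonneg hp fun y => (Real.exp_pos _).le)
      fun i hi => ?_
    have e1 : ∀ y, F i y = 1 + (Real.exp s - 1) *
        if RowErr z P d B u i (row i y) then 1 else 0 := by
      intro y; simp only [F]; split_ifs <;> simp
    rw [show F i = _ from funext e1, bE_add, bE_const, bE_const_mul]
    have h2 := hq i hi
    rw [← bP_row z h.symm] at h2
    have h3 := bP_nonneg hp (fun y => RowErr z P d B u i (row i y))
    rw [bP] at h2 h3
    have h4 : 1 ≤ Real.exp s := Real.one_le_exp hs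
    have h5 := Real.add_one_le_exp (Real.exp s * q)
    nlinarith
  · intro i _ x y hxy
    have : ∀ a ∈ B, row i x a = row i y a := fun a ha => hxy _ ⟨a, ha, rfl⟩
    simp only [F, RowErr.congr this]
  · intro i hi i' hi' hne
    rw [Set.disjoint_left]
    rintro e ⟨a, ha, rfl⟩ ⟨a', ha', h'⟩
    rcases edge_eq_iff.1 h' with h2 | h2
    · exact hne h2.1
    · exact Finset.disjoint_left.1 hAB hi (h2.1 ▸ ha')

/-- The same, for labels on `B` that are computed from the edges within `B`. -/
lemma BlockBounds.bP_count_le_of_labels (h : BlockBounds ε ω ps P) {A B : Finset V}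
    (hAB : Disjoint A B) (U : (V × V → Bool) → V → Fin K)
    (hU : ∀ x x' : V × V → Bool, (∀ a ∈ B, ∀ b ∈ B, x (edge a b) = x' (edge a b)) → U x = U x')
    (Good : (V → Fin K) → Prop) {q s m : ℝ} (hs : 0 ≤ s)
    (hq : ∀ u, Good u → ∀ i ∈ A, bP (pRow z P (z i)) (RowErr z P d B u i) ≤ q) :
    bP (edgeP z P) (fun x => Good (U x) ∧
      m ≤ ((A.filter fun i => RowErr z P d B (U x) i (row i x)).card : ℝ)) ≤
      Real.exp (A.card * (Real.exp s * q) - s * m) := by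
  have hp := edgeP_mem (z := z) h.mem
  -- Resampling the edges between `A` and `B` leaves the labels on `B` unchanged, so they are
  -- deterministic in the inner probability.
  set S : Set (V × V) := {e | ∃ i ∈ A, ∃ a ∈ B, e = edge i a} with hS
  rw [bP_resample _ S]
  rw [← bE_const (edgeP z P) (Real.exp (A.card * (Real.exp s * q) - s * m))]
  refine bE_mono hp fun x => ?_
  have hUx : ∀ y, U (mix S x y) = U x := by
    intro y
    refine hU _ _ fun a ha b hb => mix_of_notMem x y ?_
    rintro ⟨i, hi, c, hc, he⟩
    rcases edge_eq_iff.1 he with h2 | h2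
    · exact Finset.disjoint_left.1 hAB hi (h2.1 ▸ ha)
    · exact Finset.disjoint_left.1 hAB hi (h2.2 ▸ hb)
  have hrow : ∀ y, ∀ i ∈ A, (RowErr z P d B (U x) i (row i (mix S x y)) ↔
      RowErr z P d B (U x) i (row i y)) := by
    intro y i hi
    exact RowErr.congr fun a ha => mix_of_mem x y ⟨i, hi, a, ha, rfl⟩
  have hfil : ∀ y, (A.filter fun i => RowErr z P d B (U x) i (row i (mix S x y))) =
      A.filter fun i => RowErr z P d B (U x) i (row i y) := fun y =>
    Finset.filter_congr fun i hi => hrow y i hi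
  simp only [hUx, hfil]
  by_cases hg : Good (U x)
  · simp only [hg, true_and]
    exact h.bP_count_le hAB (U x) hs (hq _ hg)
  · simp only [hg, false_and, bP, if_false, bE_const]
    positivity

/-- Error at node `j`, given that the other labels are wrong only on a small set which does not
depend on the edges at `j`. -/
lemma BlockBounds.bP_final_le (h : BlockBounds ε ω ps P) (hd : 0 ≤ d)
    (hd1 : d ≤ ps / (2 * ω)) (hd2 : d ≤ ε / 2) (j : V) (M : (V × V → Bool) → Finset V)
    (hMdep : ∀ x x' : V × V → Bool, (∀ a b, a ≠ j → b ≠ j → x (edge a b) = x' (edge a b)) →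
      M x = M x')
    {m R η : ℝ}
    (hη : ∀ k, k ≠ z j → pairAff z P (z j) k ≤ η)
    (hη0 : 0 ≤ η)
    (hR : ∀ M' : Finset V, (M'.card : ℝ) ≤ m → ∑ a, (pertG ε ps d (a ∈ M') +
      ps / ε * (Real.exp (pertC ω ps d (a ∈ M')) - 1)) ≤ R) :
    bP (edgeP z P) (fun x => ((M x).card : ℝ) ≤ m ∧ FinalErr z P d (M x) j (row j x)) ≤
      K * (Real.exp R * η) := by
  have hp := edgeP_mem (z := z) h.mem
  set S : Set (V × V) := {e | ∃ a, e = edge j a} with hS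
  rw [bP_resample _ S]
  rw [← bE_const (edgeP z P) (K * (Real.exp R * η))]
  refine bE_mono hp fun x => ?_
  have hMx : ∀ y, M (mix S x y) = M x := by
    intro y
    refine hMdep _ _ fun a b ha hb => mix_of_notMem x y ?_
    rintro ⟨c, he⟩
    rcases edge_eq_iff.1 he with h2 | h2
    · exact ha h2.1
    · exact hb h2.2
  have hrow : ∀ y, row j (mix S x y) = row j y := by
    intro y; ext a
    exact mix_of_mem x y ⟨a, rfl⟩
  simp only [hMx, hrow]
  by_cases hm : ((M x).card : ℝ) ≤ m
  · simp only [hm, true_and]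
    rw [bP_row z h.symm j (FinalErr z P d (M x) j)]
    exact h.bP_rowErr_le_affinity hd hd1 hd2 hη hη0 (hR _ hm)
  · simp only [hm, false_and, bP, if_false, bE_const]
    positivity

/-- The labels of `SC` on the nodes of `B`, relabelled by `σ`, and the true labels elsewhere. -/
def subLab (z : V → Fin K) (SC : Clustering K) (B : Finset V) (σ : Equiv.Perm (Fin K))
    (x : V × V → Bool) (v : V) : Fin K :=
  if h : v ∈ B then σ (SC _ (subGraph (graphOf x) B) ⟨v, h⟩) else z v

lemma subLab_congr (z : V → Fin K) (SC : Clustering K) (B : Finset V) (σ : Equiv.Perm (Fin K))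
    (x x' : V × V → Bool) (h : ∀ a ∈ B, ∀ b ∈ B, x (edge a b) = x' (edge a b)) :
    subLab z SC B σ x = subLab z SC B σ x' := by
  have : subGraph (graphOf x) B = subGraph (graphOf x') B := by
    ext a b
    simp only [subGraph, SimpleGraph.comap_adj, graphOf_adj, h a a.2 b b.2]
  unfold subLab
  rw [this]

/-- A set that contains all the nodes that may be mislabelled before the final step. -/
def missSet (z : V → Fin K) (P : Matrix (Fin K) (Fin K) ℝ) (d : ℝ) (SC : Clustering K)
    (A B : Finset V) (σA σB : Equiv.Perm (Fin K)) (j : V) (x : V × V → Bool) : Finset V :=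
  insert j ((A.filter fun i => RowErr z P d B (subLab z SC B σB x) i (row i x)) ∪
    (B.filter fun i => RowErr z P d A (subLab z SC A σA x) i (row i x)))

/-- This is the purpose of deleting `j` in iteration `j`. The initial labels, which do see the edges
at `j`, have been replaced by a fixed relabelling and by errors over all `Q` near `P`. -/
lemma missSet_congr (SC : Clustering K) {A B : Finset V} (σA σB : Equiv.Perm (Fin K)) {j : V}
    (hA : j ∉ A) (hB : j ∉ B) (x x' : V × V → Bool)
    (h : ∀ a b, a ≠ j → b ≠ j → x (edge a b) = x' (edge a b)) :
    missSet z P d SC A B σA σB j x = missSet z P d SC A B σA σB j x' := by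
  have nA : ∀ a ∈ A, a ≠ j := fun a ha h => hA (h ▸ ha)
  have nB : ∀ a ∈ B, a ≠ j := fun a ha h => hB (h ▸ ha)
  have eA := subLab_congr z SC A σA x x' fun a ha b hb => h a b (nA a ha) (nA b hb)
  have eB := subLab_congr z SC B σB x x' fun a ha b hb => h a b (nB a ha) (nB b hb)
  unfold missSet
  rw [eA, eB]
  congr 2
  · exact Finset.filter_congr fun i hi => RowErr.congr fun a ha => h _ _ (nA i hi) (nB a ha)
  · exact Finset.filter_congr fun i hi => RowErr.congr fun a ha => h _ _ (nB i hi) (nA a ha)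

lemma likelihood_graphOf (x : V × V → Bool) (Q : Matrix (Fin K) (Fin K) ℝ) (S : Finset V)
    (y : V → Fin K) (i : V) (k : Fin K) :
    likelihood (graphOf x) Q S y i k =
      ∏ a ∈ S.filter (fun a => a ≠ i), bw (Q k (y a)) (row i x a) := by
  unfold likelihood
  refine Finset.prod_congr (by congr) fun a ha => ?_
  have ha' : a ≠ i := (Finset.mem_filter.1 ha).2
  unfold bw row
  simp only [graphOf_adj, ne_eq, ha'.symm, not_false_iff, true_and]

lemma rowErr_of_isLRLabel {x : V × V → Bool} {y₀ y : V → Fin K} {S : Finset V} {i : V} {k : Fin K}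
    (h : IsLRLabel (graphOf x) (blockEstimate (graphOf x) y₀) S y i k)
    (hQ : ∀ k l, |blockEstimate (graphOf x) y₀ k l - P k l| ≤ d) (hk : k ≠ z i) :
    RowErr z P d S y i (row i x) := by
  refine ⟨_, hQ, k, hk, ?_⟩
  have := h (z i)
  rw [likelihood_graphOf, likelihood_graphOf] at this
  convert this

/-- If the spectral labels are good and the graph is regular, node `j` gets the right label, up to
the permutation `π`, unless the final step errs. -/
lemma iteration_correct_or (h : BlockBounds ε ω ps P) {b τ₀ τ d₀ : ℝ} {x : V × V → Bool}
    (hx₀ : Regular z P ps τ₀ x) (hx : Regular z P ps τ x) (hτ₀ : 0 < τ₀) (hτ : 1 ≤ τ)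
    (hb : 0 < b) (hsize : ∀ k, (Fintype.card V : ℝ) / b ≤ commSize z k)
    (hn : 4 * b ≤ Fintype.card V) (hτ₀b : 3 * τ₀ / ps ≤ Fintype.card V / (2 * b))
    (hτb : 3 * τ / ps ≤ Fintype.card V / (2 * b))
    (hd₀ : d₀ = 440 * b ^ 2 * τ₀ / Fintype.card V) (hd : d = 440 * b ^ 2 * τ / Fintype.card V)
    {zt y w : V → Fin K} {k : Fin K} {π : Equiv.Perm (Fin K)} {j : V} {A B : Finset V}
    (SC : Clustering K) {σA σB : Equiv.Perm (Fin K)}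
    (hcover : ∀ a, a = j ∨ a ∈ A ∨ a ∈ B)
    (hzt : ((Finset.univ.filter fun i => π (zt i) ≠ z i).card : ℝ) ≤ 3 * τ₀ / ps)
    (hyA : ∀ i ∈ A, π (y i) = subLab z SC A σA x i) (hyB : ∀ i ∈ B, π (y i) = subLab z SC B σB x i)
    (hcA : ((A.filter fun i => RowErr z P d₀ B (subLab z SC B σB x) i (row i x)).card : ℝ) ≤ τ / ps)
    (hcB : ((B.filter fun i => RowErr z P d₀ A (subLab z SC A σA x) i (row i x)).card : ℝ) ≤ τ / ps)
    (hwA : ∀ i ∈ A, IsLRLabel (graphOf x) (blockEstimate (graphOf x) zt) B y i (w i))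
    (hwB : ∀ i ∈ B, IsLRLabel (graphOf x) (blockEstimate (graphOf x) zt) A y i (w i))
    (hk : IsLRLabel (graphOf x) (blockEstimate (graphOf x) w) Finset.univ w j k) :
    π k = z j ∨ (((missSet z P d₀ SC A B σA σB j x).card : ℝ) ≤ 3 * τ / ps ∧
      FinalErr z P d (missSet z P d₀ SC A B σA σB j x) j (row j x)) := by
  have hPs : ∀ k l, 0 < P k l ∧ P k l ≤ ps := fun k l => ⟨h.pos k l, h.upper k l⟩
  by_cases hkj : π k = z j
  · exact Or.inl hkj
  right
  have hQ₀ : ∀ k l, |blockEstimate (graphOf x) (fun v => π (zt v)) k l - P k l| ≤ d₀ := by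
    intro k l
    rw [hd₀]
    exact hx₀.blockEstimate h.ps_pos hPs hτ₀ hb hsize hn hτ₀b hzt k l
  set M := missSet z P d₀ SC A B σA σB j x with hM
  have hmem : ∀ a, a ∉ M → π (w a) = z a ∧ a ≠ j := by
    intro a ha
    simp only [hM, missSet, Finset.mem_insert, Finset.mem_union, Finset.mem_filter, not_or,
      not_and] at ha
    refine ⟨?_, ha.1⟩
    by_contra hne
    rcases hcover a with hj | hA | hB
    · exact ha.1 hj
    · exact ha.2.1 hA ((RowErr.congr_labels hyB).1
        (rowErr_of_isLRLabel ((hwA a hA).comp π) hQ₀ hne))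
    · exact ha.2.2 hB ((RowErr.congr_labels hyA).1
        (rowErr_of_isLRLabel ((hwB a hB).comp π) hQ₀ hne))
  have hps := h.ps_pos
  have hcard : (M.card : ℝ) ≤ 3 * τ / ps := by
    have h1 : M.card ≤ (A.filter fun i => RowErr z P d₀ B (subLab z SC B σB x) i (row i x)).card +
        (B.filter fun i => RowErr z P d₀ A (subLab z SC A σA x) i (row i x)).card + 1 :=
      (Finset.card_insert_le _ _).trans (Nat.add_le_add_right (Finset.card_union_le _ _) 1)
    have h2 : (M.card : ℝ) ≤
        ((A.filter fun i => RowErr z P d₀ B (subLab z SC B σB x) i (row i x)).card : ℝ) +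
        ((B.filter fun i => RowErr z P d₀ A (subLab z SC A σA x) i (row i x)).card : ℝ) + 1 := by
      exact_mod_cast h1
    -- The third unit of `τ / ps` pays for `j` itself.
    have h3 : 1 ≤ τ / ps := by
      rw [le_div_iff₀ hps]
      linarith [h.ps_le, h.eps_pos]
    have h4 : 3 * τ / ps = τ / ps + τ / ps + τ / ps := by ring
    linarith
  refine ⟨hcard, fun v => π (w v), hmem, ?_⟩
  have hwz : ((Finset.univ.filter fun i => π (w i) ≠ z i).card : ℝ) ≤ 3 * τ / ps := by
    refine le_trans ?_ hcard
    have : (Finset.univ.filter fun i => π (w i) ≠ z i) ⊆ M := by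
      intro a ha
      by_contra hne
      exact (Finset.mem_filter.1 ha).2 (hmem a hne).1
    exact_mod_cast Finset.card_le_card this
  have hQ : ∀ k l, |blockEstimate (graphOf x) (fun v => π (w v)) k l - P k l| ≤ d := by
    intro k l
    rw [hd]
    exact hx.blockEstimate h.ps_pos hPs (by linarith) hb hsize hn hτb hwz k l
  exact rowErr_of_isLRLabel (hk.comp π) hQ hkj

/-- Labels on `S` matched with labels that are close to the truth after the permutation `π` are
close to the truth after the same permutation. -/
lemma IsMatched.exists_subLab {SC : Clustering K} {S : Finset V} {zt y : V → Fin K}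
    {x : V × V → Bool} (h : IsMatched S zt (SC _ (subGraph (graphOf x) S)) y)
    {π πS : Equiv.Perm (Fin K)} {e₀ e₁ : ℝ}
    (hπ : ((Finset.univ.filter fun i => π (zt i) ≠ z i).card : ℝ) ≤ e₀)
    (hπS : ((Finset.univ.filter fun i : {v // v ∈ S} =>
      πS (SC _ (subGraph (graphOf x) S) i) ≠ z i).card : ℝ) ≤ e₁) :
    ∃ σ, (∀ i ∈ S, π (y i) = subLab z SC S σ x i) ∧
      ((Finset.univ.filter fun i => subLab z SC S σ x i ≠ z i).card : ℝ) ≤ 2 * e₀ + e₁ := by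
  obtain ⟨σ', hy, hmin⟩ := h
  set raw := SC _ (subGraph (graphOf x) S) with hraw
  have hlab : ∀ i : {v // v ∈ S}, subLab z SC S (σ'.trans π) x i = π (σ' (raw i)) := by
    rintro ⟨i, hi⟩
    simp only [subLab, hi, dif_pos, Equiv.trans_apply]
    rfl
  refine ⟨σ'.trans π, fun i hi => ?_, ?_⟩
  · rw [hlab ⟨i, hi⟩, ← hy ⟨i, hi⟩]
  · have hE0 : (Finset.univ.filter fun i : {v // v ∈ S} => π (zt i) ≠ z i).card ≤
        (Finset.univ.filter fun i => π (zt i) ≠ z i).card := by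
      refine Finset.card_le_card_of_injOn (fun i => (i : V)) (fun i hi => ?_)
        (fun a _ b _ hab => Subtype.ext hab)
      simpa using hi
    -- The optimal matching is compared with the one that maps the raw labels to the truth by `πS`
    -- and then back to the reference labels.
    have h1 := hmin (πS.trans π.symm)
    have h2 : (Finset.univ.filter fun i : {v // v ∈ S} =>
        zt i ≠ (πS.trans π.symm) (raw i)).card ≤
        (Finset.univ.filter fun i : {v // v ∈ S} => π (zt i) ≠ z i).card +
        (Finset.univ.filter fun i : {v // v ∈ S} => πS (raw i) ≠ z i).card := by
      refine le_trans (Finset.card_le_card ?_) (Finset.card_union_le _ _)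
      intro i hi
      have hi' := (Finset.mem_filter.1 hi).2
      simp only [Finset.mem_filter, Finset.mem_univ, true_and, Finset.mem_union]
      by_contra hcon
      push Not at hcon
      exact hi' (by rw [Equiv.trans_apply]; rw [hcon.2, ← hcon.1, Equiv.symm_apply_apply])
    have h3 : (Finset.univ.filter fun i => subLab z SC S (σ'.trans π) x i ≠ z i).card ≤
        (Finset.univ.filter fun i : {v // v ∈ S} => π (σ' (raw i)) ≠ z i).card := by
      refine Finset.card_le_card_of_surjOn (fun i => (i : V)) ?_
      intro i hi
      simp only [Finset.coe_filter, Finset.mem_univ, true_and, Set.mem_ofPred_eq] at hi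
      have hiS : i ∈ S := by
        by_contra hn
        exact hi (by simp [subLab, hn])
      refine ⟨⟨i, hiS⟩, ?_, rfl⟩
      simp only [Finset.coe_filter, Finset.mem_univ, true_and, Set.mem_ofPred_eq]
      rw [← hlab ⟨i, hiS⟩]; exact hi
    have h4 : (Finset.univ.filter fun i : {v // v ∈ S} => π (σ' (raw i)) ≠ z i).card ≤
        (Finset.univ.filter fun i : {v // v ∈ S} => zt i ≠ σ' (raw i)).card +
        (Finset.univ.filter fun i : {v // v ∈ S} => π (zt i) ≠ z i).card := by
      refine le_trans (Finset.card_le_card ?_) (Finset.card_union_le _ _)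
      intro i hi
      simp only [Finset.mem_filter, Finset.mem_univ, true_and, Finset.mem_union] at hi ⊢
      by_contra hcon
      push Not at hcon
      exact hi (by rw [← hcon.1, hcon.2])
    have h5 : (Finset.univ.filter fun i => subLab z SC S (σ'.trans π) x i ≠ z i).card ≤
        2 * (Finset.univ.filter fun i => π (zt i) ≠ z i).card +
        (Finset.univ.filter fun i : {v // v ∈ S} => πS (raw i) ≠ z i).card := by omega
    have h6 : ((Finset.univ.filter fun i => subLab z SC S (σ'.trans π) x i ≠ z i).card : ℝ) ≤
        2 * ((Finset.univ.filter fun i => π (zt i) ≠ z i).card : ℝ) +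
        ((Finset.univ.filter fun i : {v // v ∈ S} => πS (raw i) ≠ z i).card : ℝ) := by
      exact_mod_cast h5
    linarith

end Steps

section Model

variable {V : Type} [Fintype V] {K : ℕ} {β ε ω : ℝ} {z : V → Fin K}
  {P : Matrix (Fin K) (Fin K) ℝ}

/-! ### Parameters of the model -/

lemma le_pStar (P : Matrix (Fin K) (Fin K) ℝ) (k l : Fin K) : P k l ≤ pStar P :=
  le_ciSup (f := fun kl : Fin K × Fin K => P kl.1 kl.2) (Set.finite_range _).bddAbove (k, l)

lemma Admissible.blockBounds (h : Admissible β ε ω z P) (hε : 0 < ε) (hω : 1 < ω) (hK : 2 ≤ K) :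
    BlockBounds ε ω (pStar P) P := by
  have : Nonempty (Fin K) := ⟨⟨0, by omega⟩⟩
  obtain ⟨⟨k₀, l₀⟩, h0⟩ := exists_eq_ciSup_of_finite (f := fun kl : Fin K × Fin K => P kl.1 kl.2)
  have h0' : P k₀ l₀ = pStar P := h0
  refine ⟨h.symm, hε, hω.le, h0' ▸ h.pos _ _, h.sparse, fun k l => ?_, fun k l => le_pStar P k l⟩
  have h1 := h.ratio k₀ l₀ k l
  rw [h0', div_le_iff₀ (h.pos k l)] at h1
  rw [div_le_iff₀ (by linarith)]
  linarith

lemma pairs_nonempty (hK : 2 ≤ K) : Nonempty (Pairs K) :=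
  ⟨⟨(⟨0, by omega⟩, ⟨1, by omega⟩), by simp⟩⟩

lemma dStar_le (z : V → Fin K) (P : Matrix (Fin K) (Fin K) ℝ) {k l : Fin K} (hkl : k ≠ l) :
    dStar z P ≤ pairInfo z P k l :=
  ciInf_le (f := fun kl : Pairs K => pairInfo z P kl.1.1 kl.1.2) (Set.finite_range _).bddBelow
    ⟨(k, l), hkl⟩

lemma pairAff_le_etaStar (z : V → Fin K) (P : Matrix (Fin K) (Fin K) ℝ) {k l : Fin K}
    (hkl : k ≠ l) : pairAff z P k l ≤ etaStar z P :=
  le_ciSup (f := fun kl : Pairs K => pairAff z P kl.1.1 kl.1.2) (Set.finite_range _).bddAbove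
    ⟨(k, l), hkl⟩

variable {ps : ℝ}

lemma BlockBounds.etaStar_pos (h : BlockBounds ε ω ps P) (hK : 2 ≤ K) : 0 < etaStar z P := by
  obtain ⟨kl⟩ := pairs_nonempty hK
  exact (affinity_pos (h.comparable z kl.1.1 kl.1.2)).trans_le (pairAff_le_etaStar z P kl.2)

lemma BlockBounds.etaStar_le (h : BlockBounds ε ω ps P) (hK : 2 ≤ K) :
    etaStar z P ≤ Real.exp (-dStar z P) := by
  have := pairs_nonempty hK
  refine ciSup_le fun kl => (affinity_le_exp (h.comparable z kl.1.1 kl.1.2)).trans ?_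
  exact Real.exp_le_exp.2 (neg_le_neg (dStar_le z P kl.2))

/-- Separation of two communities. -/
def pairSep (z : V → Fin K) (P : Matrix (Fin K) (Fin K) ℝ) (ps : ℝ) (k l : Fin K) : ℝ :=
  chiSep ps (pRow z P k) (pRow z P l)

lemma BlockBounds.dStar_le_sep (h : BlockBounds ε ω ps P) {k l : Fin K} (hkl : k ≠ l) :
    dStar z P ≤ ω / ε * pairSep z P ps k l :=
  (dStar_le z P hkl).trans (chernoffInfo_le (h.comparable z k l))

lemma BlockBounds.dStar_le_card (h : BlockBounds ε ω ps P) (hK : 2 ≤ K) :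
    dStar z P ≤ ω / ε * (Fintype.card V * ps) := by
  obtain ⟨kl⟩ := pairs_nonempty hK
  refine (h.dStar_le_sep kl.2).trans ?_
  have := chiSep_le (h.comparable z kl.1.1 kl.1.2)
  have h1 := h.omega_pos
  have h2 := h.eps_pos
  unfold pairSep
  gcongr

lemma mul_sum_le_sum_of_commSize {θ : ℝ} {S : Finset V}
    (hS : ∀ m, θ * commSize z m ≤ ((S.filter fun a => z a = m).card : ℝ)) {f : Fin K → ℝ}
    (hf : ∀ m, 0 ≤ f m) : θ * ∑ a, f (z a) ≤ ∑ a ∈ S, f (z a) := by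
  have key : ∀ T : Finset V, ∑ a ∈ T, f (z a) =
      ∑ m, ((T.filter fun a => z a = m).card : ℝ) * f m := by
    intro T
    rw [← Finset.sum_fiberwise T z]
    refine Finset.sum_congr rfl fun m _ => ?_
    rw [Finset.sum_congr rfl (fun a ha => by rw [(Finset.mem_filter.1 ha).2] :
      ∀ a ∈ T.filter (fun a => z a = m), f (z a) = f m), Finset.sum_const, nsmul_eq_mul]
  rw [key, key, Finset.mul_sum]
  refine Finset.sum_le_sum fun m _ => ?_
  rw [← mul_assoc]
  exact mul_le_mul_of_nonneg_right (hS m) (hf m)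

lemma BlockBounds.sep_le_sum (h : BlockBounds ε ω ps P) {θ : ℝ} {S : Finset V}
    (hS : ∀ m, θ * commSize z m ≤ ((S.filter fun a => z a = m).card : ℝ)) (k l : Fin K) :
    θ * pairSep z P ps k l ≤ ∑ a ∈ S, (P k (z a) - P l (z a)) ^ 2 / ps :=
  mul_sum_le_sum_of_commSize hS (f := fun m => (P k m - P l m) ^ 2 / ps)
    fun _ => div_nonneg (sq_nonneg _) h.ps_pos.le

/-- The separation `chiSep` is additive over nodes, so `S` retains a fraction `θ` of it. The factor
`ε / (8 ω)` is lost in passing from information to separation and back. -/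
lemma BlockBounds.dStar_sub_ge (h : BlockBounds ε ω ps P) (hK : 2 ≤ K) {θ : ℝ} (hθ : 0 ≤ θ)
    {S : Finset V} (hS : ∀ m, θ * commSize z m ≤ ((S.filter fun a => z a = m).card : ℝ)) :
    θ * (ε / (8 * ω)) * dStar z P ≤ dStar (fun v : {v // v ∈ S} => z v) P := by
  have := pairs_nonempty hK
  have h1 := h.omega_pos
  have h2 := h.eps_pos
  refine le_ciInf fun kl => ?_
  refine le_trans ?_ (le_chernoffInfo (h.comparable (fun v : {v // v ∈ S} => z v) kl.1.1 kl.1.2))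
  have h3 : chiSep ps (pRow (fun v : {v // v ∈ S} => z v) P kl.1.1)
      (pRow (fun v : {v // v ∈ S} => z v) P kl.1.2) =
      ∑ a ∈ S, (P kl.1.1 (z a) - P kl.1.2 (z a)) ^ 2 / ps :=
    Finset.sum_coe_sort S (fun a => (P kl.1.1 (z a) - P kl.1.2 (z a)) ^ 2 / ps)
  have h4 := h.sep_le_sum hS kl.1.1 kl.1.2
  have h5 := h.dStar_le_sep (z := z) kl.2
  rw [h3]
  calc θ * (ε / (8 * ω)) * dStar z P ≤
        θ * (ε / (8 * ω)) * (ω / ε * pairSep z P ps kl.1.1 kl.1.2) := by gcongr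
    _ = θ * pairSep z P ps kl.1.1 kl.1.2 / 8 := by field_simp
    _ ≤ _ := by gcongr

lemma card_ge_of_commSize {S : Finset V}
    (hS : ∀ m, 1 / 8 * (commSize z m : ℝ) ≤ ((S.filter fun a => z a = m).card : ℝ)) :
    (Fintype.card V : ℝ) / 8 ≤ S.card := by
  have h1 := mul_sum_le_sum_of_commSize hS (f := fun _ => (1 : ℝ)) (fun _ => zero_le_one)
  simp only [Finset.sum_const, nsmul_eq_mul, mul_one, Finset.card_univ] at h1
  linarith

lemma commSize_sub (z : V → Fin K) (S : Finset V) (m : Fin K) :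
    commSize (fun v : {v // v ∈ S} => z v) m = (S.filter fun a => z a = m).card := by
  unfold commSize
  refine Finset.card_bij (fun v _ => (v : V)) ?_ ?_ ?_
  · rintro ⟨v, hv⟩ h
    simpa [hv] using h
  · rintro a _ b _ hab
    exact Subtype.ext hab
  · intro v hv
    rw [Finset.mem_filter] at hv
    exact ⟨⟨v, hv.1⟩, by simp [hv.2], rfl⟩

/-- At least an eighth of each community, and hence of all nodes, remains; the balance constant
deteriorates by at most a factor 8. -/
lemma Admissible.sub (h : Admissible β ε ω z P) (hβ : 1 < β) {S : Finset V}
    (hS : ∀ m, 1 / 8 * (commSize z m : ℝ) ≤ ((S.filter fun a => z a = m).card : ℝ)) :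
    Admissible (8 * β) ε ω (fun v : {v // v ∈ S} => z v) P := by
  have hcard := card_ge_of_commSize hS
  have hle : (S.card : ℝ) ≤ Fintype.card V := by exact_mod_cast Finset.card_le_univ S
  refine ⟨h.symm, h.pos, fun k => ?_, fun k => ?_, h.sparse, h.ratio⟩
  · rw [commSize_sub, Fintype.card_coe]
    refine le_trans ?_ (hS k)
    have h1 := h.size_lower k
    calc (S.card : ℝ) / (8 * β * K) ≤ Fintype.card V / (8 * β * K) := by gcongr
      _ = 1 / 8 * (Fintype.card V / (β * K)) := by rw [mul_assoc, mul_comm 8, ← div_div]; ring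
      _ ≤ _ := by gcongr
  · rw [commSize_sub, Fintype.card_coe]
    have h1 := h.size_upper k
    have h2 : ((S.filter fun a => z a = k).card : ℝ) ≤ commSize z k := by
      unfold commSize
      exact_mod_cast Finset.card_le_card (Finset.filter_subset_filter _ (Finset.subset_univ S))
    refine h2.trans (h1.trans (div_le_div_of_nonneg_right ?_ (Nat.cast_nonneg K)))
    nlinarith

lemma exists_mis_eq (zt z : V → Fin K) : ∃ π : Equiv.Perm (Fin K),
    ((Finset.univ.filter fun i => π (zt i) ≠ z i).card : ℝ) / Fintype.card V = mis zt z :=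
  exists_eq_ciInf_of_finite (f := fun π : Equiv.Perm (Fin K) =>
    ((Finset.univ.filter fun i => π (zt i) ≠ z i).card : ℝ) / Fintype.card V)

/-- A permutation of the labels that aligns `zt` with `z`. -/
def align (zt z : V → Fin K) : Equiv.Perm (Fin K) := (exists_mis_eq zt z).choose

lemma align_spec (zt z : V → Fin K) :
    ((Finset.univ.filter fun i => align zt z (zt i) ≠ z i).card : ℝ) / Fintype.card V = mis zt z :=
  (exists_mis_eq zt z).choose_spec

lemma card_align_le {zt z : V → Fin K} {D C : ℝ} (hD : 0 < D) (h : D * mis zt z ≤ C) :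
    ((Finset.univ.filter fun i => align zt z (zt i) ≠ z i).card : ℝ) ≤
      Fintype.card V * (C / D) := by
  rcases (Nat.eq_zero_or_pos (Fintype.card V)) with h0 | h0
  · have : ((Finset.univ.filter fun i => align zt z (zt i) ≠ z i).card) ≤ Fintype.card V :=
      Finset.card_le_univ _
    rw [h0] at this
    rw [h0, Nat.le_zero.1 this]; simp
  · have h1 : (0 : ℝ) < Fintype.card V := by exact_mod_cast h0
    have h2 := align_spec zt z
    rw [div_eq_iff h1.ne'] at h2
    rw [h2, mul_comm]
    gcongr
    rw [le_div_iff₀ hD]; linarith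

lemma mis_le_align {zh zt z : V → Fin K} : mis zh z ≤
    ((Finset.univ.filter fun i => align zt z (zh i) ≠ z i).card : ℝ) / Fintype.card V :=
  ciInf_le (f := fun π : Equiv.Perm (Fin K) =>
    ((Finset.univ.filter fun i => π (zh i) ≠ z i).card : ℝ) / Fintype.card V)
    (Set.finite_range _).bddBelow (align zt z)

end Model

/-! ### Union bound over the failures of one iteration -/

section Union

variable {V : Type} [Fintype V] [LinearOrder V] {K : ℕ} {ε ω ps d : ℝ}
  {P : Matrix (Fin K) (Fin K) ℝ} {z : V → Fin K}

lemma bP_le_add {ι : Type} [Fintype ι] {p : ι → ℝ} (hp : ∀ i, 0 ≤ p i ∧ p i ≤ 1)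
    {A B C : (ι → Bool) → Prop} (h : ∀ x, A x → ¬ B x → C x) {b c : ℝ} (hB : bP p B ≤ b)
    (hC : bP p C ≤ c) : bP p A ≤ b + c := by
  refine (bP_mono hp (B := fun x => B x ∨ C x) fun x hA => ?_).trans
    ((bP_or_le hp B C).trans (add_le_add hB hC))
  by_cases hb : B x
  · exact Or.inl hb
  · exact Or.inr (h x hA hb)

/-- Union bound for the error of one iteration. -/
lemma bP_iteration_le (h : BlockBounds ε ω ps P) {b τ₀ τ d₀ e₀ e₁ δF δS δR δC δE : ℝ}
    (hτ₀ : 0 < τ₀) (hτ : 1 ≤ τ) (hb : 0 < b)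
    (hsize : ∀ k, (Fintype.card V : ℝ) / b ≤ commSize z k)
    (hn : 4 * b ≤ Fintype.card V) (hτ₀b : 3 * τ₀ / ps ≤ Fintype.card V / (2 * b))
    (hτb : 3 * τ / ps ≤ Fintype.card V / (2 * b))
    (hd₀ : d₀ = 440 * b ^ 2 * τ₀ / Fintype.card V) (hd : d = 440 * b ^ 2 * τ / Fintype.card V)
    (SC : Clustering K) {j : V} {A B : Finset V} (hcover : ∀ a, a = j ∨ a ∈ A ∨ a ∈ B)
    (he₀ : 0 ≤ e₀) (he₁ : 0 ≤ e₁) (he : 2 * e₀ + e₁ ≤ 3 * τ₀ / ps)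
    (hF : bP (edgeP z P) (fun x => ¬ ((Finset.univ.filter fun i =>
      align (SC V (graphOf x)) z (SC V (graphOf x) i) ≠ z i).card : ℝ) ≤ e₀) ≤ δF)
    (hS : ∀ S, S = A ∨ S = B → bP (edgeP z P) (fun x => ¬ ∃ πS : Equiv.Perm (Fin K),
      ((Finset.univ.filter fun i : {v // v ∈ S} =>
        πS (SC _ (subGraph (graphOf x) S) i) ≠ z i).card : ℝ) ≤ e₁) ≤ δS)
    (hR : ∀ t, t = τ₀ ∨ t = τ → bP (edgeP z P) (fun x => ¬ Regular z P ps t x) ≤ δR)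
    (hC : ∀ S T σ, (S = A ∧ T = B) ∨ (S = B ∧ T = A) → bP (edgeP z P) (fun x =>
      ((Finset.univ.filter fun i => subLab z SC T σ x i ≠ z i).card : ℝ) ≤ 3 * τ₀ / ps ∧
      τ / ps ≤ ((S.filter fun i =>
        RowErr z P d₀ T (subLab z SC T σ x) i (row i x)).card : ℝ)) ≤ δC)
    (hE : ∀ σA σB, bP (edgeP z P) (fun x =>
      ((missSet z P d₀ SC A B σA σB j x).card : ℝ) ≤ 3 * τ / ps ∧
      FinalErr z P d (missSet z P d₀ SC A B σA σB j x) j (row j x)) ≤ δE)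
    (out : (V × V → Bool) → Fin K)
    (hout : ∀ x, ∃ y w : V → Fin K,
      IsMatched A (SC V (graphOf x)) (SC _ (subGraph (graphOf x) A)) y ∧
      IsMatched B (SC V (graphOf x)) (SC _ (subGraph (graphOf x) B)) y ∧
      (∀ i ∈ A, IsLRLabel (graphOf x) (blockEstimate (graphOf x) (SC V (graphOf x))) B y i (w i)) ∧
      (∀ i ∈ B, IsLRLabel (graphOf x) (blockEstimate (graphOf x) (SC V (graphOf x))) A y i (w i)) ∧
      IsLRLabel (graphOf x) (blockEstimate (graphOf x) w) Finset.univ w j (out x)) :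
    bP (edgeP z P) (fun x => align (SC V (graphOf x)) z (out x) ≠ z j) ≤
      δF + (δS + (δS + (δR + (δR + ((Nat.factorial K : ℝ) * δC + ((Nat.factorial K : ℝ) * δC +
        (Nat.factorial K : ℝ) * ((Nat.factorial K : ℝ) * δE))))))) := by
  have hp := edgeP_mem (z := z) h.mem
  -- The matching permutation depends on the whole graph. The union over all `K!` permutations
  -- allows the events to be bounded with a fixed one.
  have hCall : ∀ S T, (S = A ∧ T = B) ∨ (S = B ∧ T = A) → bP (edgeP z P) (fun x =>
      ∃ σ ∈ (Finset.univ : Finset (Equiv.Perm (Fin K))),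
      ((Finset.univ.filter fun i => subLab z SC T σ x i ≠ z i).card : ℝ) ≤ 3 * τ₀ / ps ∧
      τ / ps ≤ ((S.filter fun i =>
        RowErr z P d₀ T (subLab z SC T σ x) i (row i x)).card : ℝ)) ≤
      (Nat.factorial K : ℝ) * δC := by
    intro S T hST
    refine (bP_exists_le hp _ _).trans ((Finset.sum_le_sum fun σ _ => hC S T σ hST).trans ?_)
    rw [Finset.sum_const, nsmul_eq_mul, Finset.card_univ, Fintype.card_perm, Fintype.card_fin]
  have hEall : bP (edgeP z P) (fun x => ∃ σA ∈ (Finset.univ : Finset (Equiv.Perm (Fin K))),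
      ∃ σB ∈ (Finset.univ : Finset (Equiv.Perm (Fin K))),
      ((missSet z P d₀ SC A B σA σB j x).card : ℝ) ≤ 3 * τ / ps ∧
      FinalErr z P d (missSet z P d₀ SC A B σA σB j x) j (row j x)) ≤
      (Nat.factorial K : ℝ) * ((Nat.factorial K : ℝ) * δE) := by
    refine (bP_exists_le hp _ _).trans ((Finset.sum_le_sum fun σA _ =>
      (bP_exists_le hp _ _).trans (Finset.sum_le_sum fun σB _ => hE σA σB)).trans ?_)
    simp only [Finset.sum_const, nsmul_eq_mul, Finset.card_univ, Fintype.card_perm,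
      Fintype.card_fin]
    exact le_rfl
  refine bP_le_add hp (C := fun x => align (SC V (graphOf x)) z (out x) ≠ z j ∧
    ((Finset.univ.filter fun i =>
      align (SC V (graphOf x)) z (SC V (graphOf x) i) ≠ z i).card : ℝ) ≤ e₀)
    (fun x hx hnot => ⟨hx, not_not.1 hnot⟩) hF ?_
  refine bP_le_add hp (C := fun x => (align (SC V (graphOf x)) z (out x) ≠ z j ∧
    ((Finset.univ.filter fun i =>
      align (SC V (graphOf x)) z (SC V (graphOf x) i) ≠ z i).card : ℝ) ≤ e₀) ∧
      ∃ πS : Equiv.Perm (Fin K), ((Finset.univ.filter fun i : {v // v ∈ A} =>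
        πS (SC _ (subGraph (graphOf x) A) i) ≠ z i).card : ℝ) ≤ e₁)
    (fun x hx hnot => ⟨hx, not_not.1 hnot⟩) (hS A (Or.inl rfl)) ?_
  refine bP_le_add hp (C := fun x => ((align (SC V (graphOf x)) z (out x) ≠ z j ∧
    ((Finset.univ.filter fun i =>
      align (SC V (graphOf x)) z (SC V (graphOf x) i) ≠ z i).card : ℝ) ≤ e₀) ∧
      ∃ πS : Equiv.Perm (Fin K), ((Finset.univ.filter fun i : {v // v ∈ A} =>
        πS (SC _ (subGraph (graphOf x) A) i) ≠ z i).card : ℝ) ≤ e₁) ∧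
      ∃ πS : Equiv.Perm (Fin K), ((Finset.univ.filter fun i : {v // v ∈ B} =>
        πS (SC _ (subGraph (graphOf x) B) i) ≠ z i).card : ℝ) ≤ e₁)
    (fun x hx hnot => ⟨hx, not_not.1 hnot⟩) (hS B (Or.inr rfl)) ?_
  set Base : (V × V → Bool) → Prop := fun x => ((align (SC V (graphOf x)) z (out x) ≠ z j ∧
    ((Finset.univ.filter fun i =>
      align (SC V (graphOf x)) z (SC V (graphOf x) i) ≠ z i).card : ℝ) ≤ e₀) ∧
      ∃ πS : Equiv.Perm (Fin K), ((Finset.univ.filter fun i : {v // v ∈ A} =>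
        πS (SC _ (subGraph (graphOf x) A) i) ≠ z i).card : ℝ) ≤ e₁) ∧
      ∃ πS : Equiv.Perm (Fin K), ((Finset.univ.filter fun i : {v // v ∈ B} =>
        πS (SC _ (subGraph (graphOf x) B) i) ≠ z i).card : ℝ) ≤ e₁ with hBase
  refine bP_le_add hp (C := fun x => Base x ∧ Regular z P ps τ₀ x)
    (fun x hx hnot => ⟨hx, not_not.1 hnot⟩) (hR τ₀ (Or.inl rfl)) ?_
  refine bP_le_add hp (C := fun x => (Base x ∧ Regular z P ps τ₀ x) ∧ Regular z P ps τ x)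
    (fun x hx hnot => ⟨hx, not_not.1 hnot⟩) (hR τ (Or.inr rfl)) ?_
  refine bP_le_add hp (fun x hx hnot => And.intro hx hnot)
    (hCall A B (Or.inl ⟨rfl, rfl⟩)) ?_
  refine bP_le_add hp (fun x hx hnot => And.intro hx hnot)
    (hCall B A (Or.inr ⟨rfl, rfl⟩)) ?_
  refine le_trans (bP_mono hp fun x hx => ?_) hEall
  obtain ⟨⟨⟨⟨⟨⟨⟨hne, hπ⟩, πA, hπA⟩, πB, hπB⟩, hx₀⟩, hx₁⟩, hcA⟩, hcB⟩ := hx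
  obtain ⟨y, w, hmA, hmB, hwA, hwB, hk⟩ := hout x
  obtain ⟨σA, hyA, hlA⟩ := hmA.exists_subLab hπ hπA
  obtain ⟨σB, hyB, hlB⟩ := hmB.exists_subLab hπ hπB
  refine ⟨σA, Finset.mem_univ _, σB, Finset.mem_univ _, ?_⟩
  have hcA' : ((A.filter fun i =>
      RowErr z P d₀ B (subLab z SC B σB x) i (row i x)).card : ℝ) ≤ τ / ps := by
    by_contra hcon
    exact hcA ⟨σB, Finset.mem_univ _, hlB.trans he, (not_le.1 hcon).le⟩
  have hcB' : ((B.filter fun i =>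
      RowErr z P d₀ A (subLab z SC A σA x) i (row i x)).card : ℝ) ≤ τ / ps := by
    by_contra hcon
    exact hcB ⟨σA, Finset.mem_univ _, hlA.trans he, (not_le.1 hcon).le⟩
  rcases iteration_correct_or h hx₀ hx₁ hτ₀ hτ hb hsize hn hτ₀b hτb hd₀ hd SC hcover
    (hπ.trans (by linarith)) hyA hyB hcA' hcB' hwA hwB hk with h1 | h1
  · exact absurd h1 hne
  · exact h1

end Union

/-! ### Error probability of one iteration -/

section Core

variable {V : Type} [Fintype V] [LinearOrder V] {K : ℕ} {β ε ω ps : ℝ}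
  {P : Matrix (Fin K) (Fin K) ℝ} {z : V → Fin K}

/-- Each community has a positive fraction of its nodes in `S`. -/
def Spread (z : V → Fin K) (S : Finset V) : Prop :=
  ∀ m, 1 / 8 * (commSize z m : ℝ) ≤ ((S.filter fun a => z a = m).card : ℝ)

lemma bP_not_le_of_guarantee {r C : ℝ} {SC : Clustering K} (hSC : ClusteringGuarantee β ε ω r C SC)
    [Nonempty V] (hadm : Admissible β ε ω z P) :
    bP (edgeP z P) (fun x => ¬ dStar z P * mis (SC V (graphOf x)) z ≤ C) ≤
      (Fintype.card V : ℝ) ^ (-(r + 1)) := by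
  have h := hSC V z P hadm
  rw [sbmProb_eq] at h
  rw [bP_not]
  linarith

lemma BlockBounds.bP_spectral_le (h : BlockBounds ε ω ps P) {r C c D : ℝ} {SC : Clustering K}
    (hSC : ClusteringGuarantee β ε ω r C SC) [Nonempty V] (hadm : Admissible β ε ω z P)
    (hD : 0 < D) (hDs : D = dStar z P) (hC : C ≤ c) :
    bP (edgeP z P) (fun x => ¬ ((Finset.univ.filter fun i =>
      align (SC V (graphOf x)) z (SC V (graphOf x) i) ≠ z i).card : ℝ) ≤
        Fintype.card V * (c / D)) ≤ (Fintype.card V : ℝ) ^ (-(r + 1)) := by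
  refine le_trans (bP_mono (edgeP_mem (z := z) h.mem)
    (B := fun x => ¬ dStar z P * mis (SC V (graphOf x)) z ≤ C) fun x hx hcon => hx ?_)
    (bP_not_le_of_guarantee hSC hadm)
  subst hDs
  exact card_align_le hD (hcon.trans hC)

/-- The induced subgraph is a block model with at least `n / 8` nodes and information at least `c'
D`. Hence the guarantee applies to it, at the cost of constants. -/
lemma BlockBounds.bP_sub_spectral_le (h : BlockBounds ε ω ps P) {r C c c' D : ℝ}
    {SC : Clustering K} (hr : 0 < r) (hK : 2 ≤ K) (hβ : 1 < β)
    (hSC : ClusteringGuarantee (8 * β) ε ω r C SC)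
    (hV : 0 < Fintype.card V) (hadm : Admissible β ε ω z P) (hD : 0 < D) (hDs : D = dStar z P)
    (hC : C ≤ c) (hc0 : 0 ≤ c) (hc' : c' = ε / (64 * ω)) {S : Finset V} (hS : Spread z S) :
    bP (edgeP z P) (fun x => ¬ ∃ πS : Equiv.Perm (Fin K),
      ((Finset.univ.filter fun i : {v // v ∈ S} =>
        πS (SC _ (subGraph (graphOf x) S) i) ≠ z i).card : ℝ) ≤ Fintype.card V * (c / c' / D)) ≤
      8 ^ (r + 1) * (Fintype.card V : ℝ) ^ (-(r + 1)) := by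
  have hn : (0 : ℝ) < Fintype.card V := by exact_mod_cast hV
  have hcard := card_ge_of_commSize hS
  have hScard : (0 : ℝ) < S.card := by linarith
  have hle : (S.card : ℝ) ≤ Fintype.card V := by exact_mod_cast Finset.card_le_univ S
  have hne : Nonempty {v // v ∈ S} := by
    obtain ⟨v, hv⟩ := Finset.card_pos.1 (by exact_mod_cast hScard : 0 < S.card)
    exact ⟨⟨v, hv⟩⟩
  have hω := h.omega_pos
  have hε := h.eps_pos
  have hc'0 : 0 < c' := by rw [hc']; positivity
  set DS := dStar (fun v : {v // v ∈ S} => z v) P with hDS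
  have hDge : c' * D ≤ DS := by
    have := h.dStar_sub_ge hK (by norm_num) hS
    rw [hc', hDs]
    refine le_trans (le_of_eq ?_) this
    field_simp
    ring
  have hDS0 : 0 < DS := lt_of_lt_of_le (by positivity) hDge
  have hg := hSC {v // v ∈ S} (fun v => z v) P (hadm.sub hβ hS)
  rw [← sbmProb_subGraph, Fintype.card_coe] at hg
  have h1 : bP (edgeP z P) (fun x => ¬ DS * mis (SC _ (subGraph (graphOf x) S))
      (fun v : {v // v ∈ S} => z v) ≤ C) ≤ (S.card : ℝ) ^ (-(r + 1)) := by
    rw [bP_not]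
    linarith
  have h2 : (S.card : ℝ) ^ (-(r + 1)) ≤ 8 ^ (r + 1) * (Fintype.card V : ℝ) ^ (-(r + 1)) := by
    calc (S.card : ℝ) ^ (-(r + 1)) ≤ ((Fintype.card V : ℝ) / 8) ^ (-(r + 1)) :=
          Real.rpow_le_rpow_of_nonpos (by positivity) hcard (by linarith)
      _ = _ := by
        rw [Real.div_rpow hn.le (by norm_num), Real.rpow_neg (by norm_num : (0 : ℝ) ≤ 8),
          div_inv_eq_mul, mul_comm]
  refine le_trans (bP_mono (edgeP_mem (z := z) h.mem) (B := fun x => ¬ DS *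
    mis (SC _ (subGraph (graphOf x) S)) (fun v : {v // v ∈ S} => z v) ≤ C)
    fun x hx hcon => hx ?_) (h1.trans h2)
  refine ⟨align (SC _ (subGraph (graphOf x) S)) (fun v : {v // v ∈ S} => z v), ?_⟩
  refine (card_align_le hDS0 (hcon.trans hC)).trans ?_
  rw [Fintype.card_coe]
  have h3 : c / DS ≤ c / c' / D := by
    rw [div_div]
    gcongr
  gcongr

/-- The constants of the analysis: `b` bounds the number of communities, `κ` is the scale of the
admissible errors of the first step, relative to `dStar`. -/
structure Scales (ε ω b κ c E : ℝ) : Prop where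
  b_pos : 0 < b
  kappa_pos : 0 < κ
  c_eq : c = ε / (64 * ω)
  E_eq : E = (3 * (440 * b ^ 2) + 6 + 15 * (440 * b ^ 2) * ω + 15 * ω ^ 2) / ε
  -- At the largest scale `τ = κ D` the perturbation uses at most half of the exponent `c D` of the
  -- first step. The remaining fields keep the estimation error below `ps / (2 ω)` and `ε / 2`, the
  -- bad sets below half a community, and `τ` in the range of the deviation bound.
  pert : E * κ ≤ c / 2
  est_rel : 440 * b ^ 2 * κ * (ω / ε) ≤ 1 / (2 * ω)
  est_abs : 440 * b ^ 2 * κ * (ω / ε) ≤ ε / 2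
  frac : 3 * κ * (ω / ε) ≤ 1 / (2 * b)
  dev : κ * (ω / ε) ≤ 2

lemma exists_scales (ε ω b : ℝ) (hε : 0 < ε) (hω : 0 < ω) (hb : 0 < b) :
    ∃ κ c E, Scales ε ω b κ c E := by
  set c := ε / (64 * ω) with hc
  set E := (3 * (440 * b ^ 2) + 6 + 15 * (440 * b ^ 2) * ω + 15 * ω ^ 2) / ε with hE
  have hc0 : 0 < c := by positivity
  have hE0 : 0 < E := by positivity
  set u := 440 * b ^ 2 * (ω / ε) with hu
  have hu0 : 0 < u := by positivity
  set v := ω / ε with hv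
  have hv0 : 0 < v := by positivity
  set κ := min (c / 2 / E) (min (1 / (2 * ω) / u) (min (ε / 2 / u)
    (min (1 / (2 * b) / (3 * v)) (2 / v)))) with hκ
  have hκ0 : 0 < κ := by
    rw [hκ]
    refine lt_min (by positivity) (lt_min (by positivity) (lt_min (by positivity)
      (lt_min (by positivity) (by positivity))))
  have k1 : κ ≤ c / 2 / E := min_le_left _ _
  have k2 : κ ≤ 1 / (2 * ω) / u := (min_le_right _ _).trans (min_le_left _ _)
  have k3 : κ ≤ ε / 2 / u :=
    (min_le_right _ _).trans ((min_le_right _ _).trans (min_le_left _ _))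
  have k4 : κ ≤ 1 / (2 * b) / (3 * v) :=
    (min_le_right _ _).trans ((min_le_right _ _).trans ((min_le_right _ _).trans (min_le_left _ _)))
  have k5 : κ ≤ 2 / v :=
    (min_le_right _ _).trans ((min_le_right _ _).trans ((min_le_right _ _).trans
      (min_le_right _ _)))
  rw [le_div_iff₀ (by positivity)] at k1 k2 k3 k4 k5
  exact ⟨κ, c, E, hb, hκ0, hc, hE, by linarith, by rw [hu] at k2; linarith,
    by rw [hu] at k3; linarith, by linarith, k5⟩

variable {b κ c E D τ : ℝ}

lemma Scales.est_bounds (hs : Scales ε ω b κ c E) (h : BlockBounds ε ω ps P)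
    (hV : 0 < Fintype.card V) (hDn : D ≤ ω / ε * (Fintype.card V * ps)) (hτ : 0 < τ)
    (hτD : τ ≤ κ * D) :
    0 ≤ 440 * b ^ 2 * τ / Fintype.card V ∧ 440 * b ^ 2 * τ / Fintype.card V ≤ ps / (2 * ω) ∧
    440 * b ^ 2 * τ / Fintype.card V ≤ ε / 2 ∧ 3 * τ / ps ≤ Fintype.card V / (2 * b) ∧
    τ ≤ 2 * (Fintype.card V * ps) := by
  have hn : (0 : ℝ) < Fintype.card V := by exact_mod_cast hV
  set n : ℝ := (Fintype.card V : ℝ)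
  have hω := h.omega_pos
  have hε := h.eps_pos
  have hps := h.ps_pos
  have hb := hs.b_pos
  have hκ := hs.kappa_pos
  have h1 : τ ≤ κ * (ω / ε) * (n * ps) := by
    calc τ ≤ κ * D := hτD
      _ ≤ κ * (ω / ε * (n * ps)) := by gcongr
      _ = _ := by ring
  have h2 : 440 * b ^ 2 * τ / n ≤ 440 * b ^ 2 * κ * (ω / ε) * ps := by
    rw [div_le_iff₀ hn]
    calc 440 * b ^ 2 * τ ≤ 440 * b ^ 2 * (κ * (ω / ε) * (n * ps)) := by gcongr
      _ = _ := by ring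
  have hps1 : ps ≤ 1 := by linarith [h.ps_le]
  refine ⟨by positivity, ?_, ?_, ?_, ?_⟩
  · calc _ ≤ _ := h2
      _ ≤ 1 / (2 * ω) * ps := by have := hs.est_rel; gcongr
      _ = _ := by ring
  · calc _ ≤ _ := h2
      _ ≤ ε / 2 * ps := by have := hs.est_abs; gcongr
      _ ≤ _ := by nlinarith
  · rw [div_le_iff₀ hps]
    calc 3 * τ ≤ 3 * (κ * (ω / ε) * (n * ps)) := by gcongr
      _ = 3 * κ * (ω / ε) * (n * ps) := by ring
      _ ≤ 1 / (2 * b) * (n * ps) := by have := hs.frac; gcongr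
      _ = _ := by ring
  · calc τ ≤ _ := h1
      _ ≤ 2 * (n * ps) := by have := hs.dev; gcongr

/-- The first likelihood-ratio step makes few errors. -/
lemma Scales.bP_firstStep_le (hs : Scales ε ω b κ c E) (h : BlockBounds ε ω ps P)
    (hV : 0 < Fintype.card V) (hDs : D = dStar z P) (hD : 0 < D)
    (hDn : D ≤ ω / ε * (Fintype.card V * ps)) {C₂ : ℝ}
    (hnD : Fintype.card V * ps ≤ C₂ * D ^ 2) (hlarge : 256 * C₂ * K / c ^ 3 ≤ D)
    (hτ : 1 ≤ τ) (SC : Clustering K) {S T : Finset V} (hST : Disjoint S T) (hT : Spread z T)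
    (σ : Equiv.Perm (Fin K)) :
    bP (edgeP z P) (fun x =>
      ((Finset.univ.filter fun i => subLab z SC T σ x i ≠ z i).card : ℝ) ≤ 3 * (κ * D) / ps ∧
      τ / ps ≤ ((S.filter fun i => RowErr z P (440 * b ^ 2 * (κ * D) / Fintype.card V) T
        (subLab z SC T σ x) i (row i x)).card : ℝ)) ≤ Real.exp (-(c / 8 * (D / ps))) := by
  have hn : (0 : ℝ) < Fintype.card V := by exact_mod_cast hV
  set n : ℝ := (Fintype.card V : ℝ) with hn'
  have hω := h.omega_pos
  have hε := h.eps_pos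
  have hps := h.ps_pos
  have hb := hs.b_pos
  have hκ := hs.kappa_pos
  have hc : 0 < c := by rw [hs.c_eq]; positivity
  obtain ⟨hd0, hd1, hd2, -, -⟩ := hs.est_bounds h hV hDn (mul_pos hκ hD) le_rfl
  have hq : ∀ u : V → Fin K,
      ((Finset.univ.filter fun i => u i ≠ z i).card : ℝ) ≤ 3 * (κ * D) / ps →
      ∀ i ∈ S, bP (pRow z P (z i)) (RowErr z P (440 * b ^ 2 * (κ * D) / n) T u i) ≤
        K * Real.exp (-(c / 2 * D)) := by
    intro u hu i hi
    have hR := h.sum_pert_le (by positivity : 0 ≤ 440 * b ^ 2) (mul_pos hκ hD) hV rfl hd1 hu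
    rw [← hs.E_eq] at hR
    refine (h.bP_rowErr_le hd0 hd1 hd2 (M := Finset.univ.filter fun i => u i ≠ z i)
      (X := 8 * c * D) (fun a ha hm => ⟨?_, ?_⟩) (fun k hk => ?_) hR).trans ?_
    · by_contra hne
      exact hm (by simp [hne])
    · rintro rfl
      exact Finset.disjoint_left.1 hST hi ha
    · refine le_trans ?_ (h.sep_le_sum hT (z i) k)
      have h1 := h.dStar_le_sep (z := z) (Ne.symm hk)
      rw [← hDs] at h1
      calc 8 * c * D ≤ 8 * c * (ω / ε * pairSep z P ps (z i) k) := by gcongr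
        _ = _ := by rw [hs.c_eq]; field_simp; norm_num
    · gcongr
      have := mul_le_mul_of_nonneg_right hs.pert hD.le
      linarith
  -- With `s = c D / 4` the mean term is at most `n K exp (-(c D / 4))`, to be beaten by half of the
  -- gain `s / ps`. This requires `n ps ≤ C₂ D²` and large `D`.
  refine (h.bP_count_le_of_labels hST (subLab z SC T σ) (fun x x' => subLab_congr z SC T σ x x')
    (fun u => ((Finset.univ.filter fun i => u i ≠ z i).card : ℝ) ≤ 3 * (κ * D) / ps)
    (s := c / 4 * D) (by positivity) hq).trans ?_
  apply Real.exp_le_exp.2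
  have e1 : Real.exp (c / 4 * D) * (K * Real.exp (-(c / 2 * D))) =
      K * Real.exp (-(c / 4 * D)) := by
    rw [mul_left_comm, ← Real.exp_add]; congr 2; ring
  rw [e1]
  have hcardS : (S.card : ℝ) ≤ n := by
    rw [hn']; exact_mod_cast Finset.card_le_univ S
  have hexp : Real.exp (-(c / 4 * D)) ≤ 32 / (c ^ 2 * D ^ 2) := by
    rw [Real.exp_neg, inv_le_comm₀ (Real.exp_pos _) (by positivity), inv_div]
    have := Real.quadratic_le_exp_of_nonneg (by positivity : 0 ≤ c / 4 * D)
    have : (c / 4 * D) ^ 2 / 2 = c ^ 2 * D ^ 2 / 32 := by ring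
    have : 0 < c / 4 * D := by positivity
    linarith
  have hmain : (S.card : ℝ) * (K * Real.exp (-(c / 4 * D))) ≤ c / 8 * (D / ps) := by
    rw [div_le_iff₀ (by positivity)] at hlarge
    calc (S.card : ℝ) * (K * Real.exp (-(c / 4 * D))) ≤ n * (K * (32 / (c ^ 2 * D ^ 2))) := by
          gcongr
      _ = (n * ps) * (32 * K / (c ^ 2 * D ^ 2 * ps)) := by field_simp
      _ ≤ (C₂ * D ^ 2) * (32 * K / (c ^ 2 * D ^ 2 * ps)) := by gcongr
      _ = 256 * C₂ * K / (8 * c ^ 2 * ps) := by field_simp; ring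
      _ ≤ D * c ^ 3 / (8 * c ^ 2 * ps) := by gcongr
      _ = _ := by field_simp
  have h2 : c / 4 * D * (1 / ps) ≤ c / 4 * D * (τ / ps) := by gcongr
  have h3 : c / 4 * D * (1 / ps) = c / 8 * (D / ps) + c / 8 * (D / ps) := by ring
  linarith

/-- Explicit bound on the error probability of one iteration. -/
lemma Scales.bP_iteration_le (hs : Scales ε ω b κ c E) (h : BlockBounds ε ω ps P) (hK : 2 ≤ K)
    (hβ : 1 < β) (hadm : Admissible β ε ω z P)
    (hsize : ∀ k, (Fintype.card V : ℝ) / b ≤ commSize z k)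
    (hn : 4 * b ≤ Fintype.card V) (hDs : D = dStar z P) (hD : 0 < D) {r C₂ Ca Cb c₀ c₁ : ℝ}
    (hr : 0 < r) (hnD : Fintype.card V * ps ≤ C₂ * D ^ 2) (hlarge : 256 * C₂ * K / c ^ 3 ≤ D)
    (hτ : 1 ≤ τ) (hτD : τ ≤ κ * D) {SC : Clustering K}
    (hSCa : ClusteringGuarantee β ε ω r Ca SC) (hSCb : ClusteringGuarantee (8 * β) ε ω r Cb SC)
    (hCa : Ca ≤ c₀) (hc₀ : 0 ≤ c₀) (hCb : Cb ≤ c₁) (hc₁ : 0 ≤ c₁)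
    (hC₂ : C₂ * (2 * c₀ + c₁ / c) ≤ κ)
    {j : V} {A B : Finset V} (hcover : ∀ a, a = j ∨ a ∈ A ∨ a ∈ B) (hAB : Disjoint A B)
    (hjA : j ∉ A) (hjB : j ∉ B) (hA : Spread z A) (hB : Spread z B)
    (out : (V × V → Bool) → Fin K)
    (hout : ∀ x, ∃ y w : V → Fin K,
      IsMatched A (SC V (graphOf x)) (SC _ (subGraph (graphOf x) A)) y ∧
      IsMatched B (SC V (graphOf x)) (SC _ (subGraph (graphOf x) B)) y ∧
      (∀ i ∈ A, IsLRLabel (graphOf x) (blockEstimate (graphOf x) (SC V (graphOf x))) B y i (w i)) ∧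
      (∀ i ∈ B, IsLRLabel (graphOf x) (blockEstimate (graphOf x) (SC V (graphOf x))) A y i (w i)) ∧
      IsLRLabel (graphOf x) (blockEstimate (graphOf x) w) Finset.univ w j (out x)) :
    bP (edgeP z P) (fun x => align (SC V (graphOf x)) z (out x) ≠ z j) ≤
      (1 + 2 * 8 ^ (r + 1)) * (Fintype.card V : ℝ) ^ (-(r + 1)) +
      2 * (K ^ 2 * (2 * Real.exp (-(τ ^ 2 / ps / 8))) + Real.exp (-(Fintype.card V : ℝ))) +
      2 * ((Nat.factorial K : ℝ) * Real.exp (-(c / 8 * (D / ps)))) +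
      (Nat.factorial K : ℝ) * ((Nat.factorial K : ℝ) * (K * (Real.exp (E * τ) * etaStar z P))) := by
  have hnR : (0 : ℝ) < Fintype.card V := by have := hs.b_pos; linarith
  have hV : 0 < Fintype.card V := by exact_mod_cast hnR
  have : Nonempty V := Fintype.card_pos_iff.1 hV
  have hω := h.omega_pos
  have hε := h.eps_pos
  have hps := h.ps_pos
  have hκ := hs.kappa_pos
  have hc : 0 < c := by rw [hs.c_eq]; positivity
  have hDn : D ≤ ω / ε * (Fintype.card V * ps) := hDs ▸ h.dStar_le_card hK
  have hτ0 : 0 < τ := by linarith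
  obtain ⟨f0, f1, f2, f3, f4⟩ := hs.est_bounds h hV hDn (mul_pos hκ hD) le_rfl
  obtain ⟨g0, g1, g2, g3, g4⟩ := hs.est_bounds h hV hDn hτ0 hτD
  -- Spectral clustering leaves about `n / D` errors, and `n ps ≤ C₂ D²` with small `C₂` makes this
  -- a small multiple of `D / ps`.
  have he : 2 * (Fintype.card V * (c₀ / D)) + Fintype.card V * (c₁ / c / D) ≤
      3 * (κ * D) / ps := by
    have e1 : 2 * ((Fintype.card V : ℝ) * (c₀ / D)) + Fintype.card V * (c₁ / c / D) =
        Fintype.card V * ps * ((2 * c₀ + c₁ / c) / (D * ps)) := by field_simp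
    rw [e1]
    have h0 : 0 ≤ 2 * c₀ + c₁ / c := by positivity
    calc _ ≤ C₂ * D ^ 2 * ((2 * c₀ + c₁ / c) / (D * ps)) := by gcongr
      _ = C₂ * (2 * c₀ + c₁ / c) * (D / ps) := by field_simp
      _ ≤ κ * (D / ps) := by gcongr
      _ ≤ 3 * (κ * (D / ps)) := by
        have : 0 < κ * (D / ps) := by positivity
        linarith
      _ = _ := by ring
  have hreg : ∀ t, t = κ * D ∨ t = τ → bP (edgeP z P) (fun x => ¬ Regular z P ps t x) ≤
      K ^ 2 * (2 * Real.exp (-(τ ^ 2 / ps / 8))) + Real.exp (-(Fintype.card V : ℝ)) := by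
    have key : ∀ t, 1 ≤ t → τ ≤ t → t ≤ 2 * (Fintype.card V * ps) →
        bP (edgeP z P) (fun x => ¬ Regular z P ps t x) ≤
        K ^ 2 * (2 * Real.exp (-(τ ^ 2 / ps / 8))) + Real.exp (-(Fintype.card V : ℝ)) := by
      intro t ht1 ht2 ht3
      refine (bP_not_regular_le z h.symm h.mem hps h.upper ht1 ht3).trans ?_
      gcongr
    rintro t (rfl | rfl)
    · exact key _ (hτ.trans hτD) hτD f4
    · exact key _ hτ le_rfl g4
  refine (SBM.bP_iteration_le h (mul_pos hκ hD) hτ hs.b_pos hsize hn f3 g3 rfl rfl SC hcover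
    (by positivity) (by positivity) he (h.bP_spectral_le hSCa hadm hD hDs hCa)
    (δS := 8 ^ (r + 1) * (Fintype.card V : ℝ) ^ (-(r + 1))) ?_ hreg
    (δC := Real.exp (-(c / 8 * (D / ps)))) ?_
    (δE := K * (Real.exp (E * τ) * etaStar z P)) ?_ out hout).trans (le_of_eq (by ring))
  · rintro S (rfl | rfl)
    · exact h.bP_sub_spectral_le hr hK hβ hSCb hV hadm hD hDs hCb hc₁ hs.c_eq hA
    · exact h.bP_sub_spectral_le hr hK hβ hSCb hV hadm hD hDs hCb hc₁ hs.c_eq hB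
  · rintro S T σ (⟨rfl, rfl⟩ | ⟨rfl, rfl⟩)
    · exact hs.bP_firstStep_le h hV hDs hD hDn hnD hlarge hτ SC hAB hB σ
    · exact hs.bP_firstStep_le h hV hDs hD hDn hnD hlarge hτ SC hAB.symm hA σ
  · intro σA σB
    refine h.bP_final_le g0 g1 g2 j (missSet z P _ SC A B σA σB j)
      (missSet_congr SC σA σB hjA hjB)
      (fun k hk => pairAff_le_etaStar z P (Ne.symm hk)) (h.etaStar_pos hK).le fun M hM => ?_
    rw [hs.E_eq]
    exact h.sum_pert_le (by positivity) hτ0 hV rfl g1 hM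

end Core

/-! ### Exponentially small terms -/

/-- With `y = n^{1/4}`, the inequality `y ≤ (4m/a) exp (a y / (4m))` is raised to the power `4m`. -/
lemma exists_exp_neg_le_rpow {a m : ℝ} (ha : 0 < a) (hm : 0 < m) :
    ∃ C : ℝ, 0 < C ∧ ∀ n : ℝ, 1 ≤ n → Real.exp (-(a * n ^ (1 / 4 : ℝ))) ≤ C * n ^ (-m) := by
  refine ⟨(4 * m / a) ^ (4 * m), by positivity, fun n hn => ?_⟩
  have hn0 : 0 < n := by linarith
  set y := n ^ (1 / 4 : ℝ) with hy
  have hy0 : 0 < y := Real.rpow_pos_of_pos hn0 _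
  have h1 : y ≤ 4 * m / a * Real.exp (a * y / (4 * m)) := by
    have h2 := Real.add_one_le_exp (a * y / (4 * m))
    have h3 : y = 4 * m / a * (a * y / (4 * m)) := by field_simp
    calc y = 4 * m / a * (a * y / (4 * m)) := h3
      _ ≤ _ := by gcongr; linarith
  have h2 : y ^ (4 * m) ≤ (4 * m / a) ^ (4 * m) * Real.exp (a * y) := by
    calc y ^ (4 * m) ≤ (4 * m / a * Real.exp (a * y / (4 * m))) ^ (4 * m) := by gcongr
      _ = _ := by
        rw [Real.mul_rpow (by positivity) (Real.exp_pos _).le, ← Real.exp_mul]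
        congr 2; field_simp
  have h3 : y ^ (4 * m) = n ^ m := by
    rw [hy, ← Real.rpow_mul hn0.le]; congr 1; ring
  rw [Real.rpow_neg hn0.le, Real.exp_neg, ← div_eq_mul_inv, ← h3,
    inv_eq_one_div, div_le_div_iff₀ (Real.exp_pos _) (by positivity), one_mul]
  exact h2

/-! ### Choice of the error scale before the final step -/

section Tail

variable {ε ω b κ c E D C₂ n ps : ℝ}

lemma rpow_quarter_le_half (hn : 1 ≤ n) : n ^ (1 / 4 : ℝ) ≤ n ^ (1 / 2 : ℝ) :=
  Real.rpow_le_rpow_of_exponent_le hn (by norm_num)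

lemma rpow_half_le_self (hn : 1 ≤ n) : n ^ (1 / 2 : ℝ) ≤ n := by
  simpa using Real.rpow_le_rpow_of_exponent_le hn (by norm_num : (1 / 2 : ℝ) ≤ 1)

lemma rpow_half_mul_self (hn : 0 < n) : n ^ (1 / 2 : ℝ) * n ^ (1 / 2 : ℝ) = n := by
  rw [← Real.rpow_add hn]; norm_num

lemma rpow_quarter_mul_self (hn : 0 < n) :
    n ^ (1 / 4 : ℝ) * n ^ (1 / 4 : ℝ) = n ^ (1 / 2 : ℝ) := by
  rw [← Real.rpow_add hn]; norm_num

/-- The scale `τ` of the errors allowed before the final step: constant if `D` is small compared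
with the number of nodes, and of order `D` otherwise. -/
lemma Scales.exists_tau (hs : Scales ε ω b κ c E) (hε : 0 < ε) (hε1 : ε < 1) (hω : 1 < ω)
    (hC₂ : 0 < C₂) :
    ∃ a : ℝ, 0 < a ∧ ∀ n ps D η : ℝ, 1 ≤ n → 0 < ps → ps ≤ 1 → n * ps ≤ C₂ * D ^ 2 → 1 ≤ κ * D →
      0 ≤ η → η ≤ Real.exp (-D) →
      ∃ τ : ℝ, 1 ≤ τ ∧ τ ≤ κ * D ∧
        Real.exp (-(τ ^ 2 / ps / 8)) ≤ Real.exp (-(a * n ^ (1 / 4 : ℝ))) ∧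
        Real.exp (-n) ≤ Real.exp (-(a * n ^ (1 / 4 : ℝ))) ∧
        Real.exp (-(c / 8 * (D / ps))) ≤ Real.exp (-(a * n ^ (1 / 4 : ℝ))) ∧
        Real.exp (E * τ) * η ≤ Real.exp E * η + Real.exp (-(a * n ^ (1 / 4 : ℝ))) := by
  have hκ := hs.kappa_pos
  have hb := hs.b_pos
  have hc : 0 < c := by rw [hs.c_eq]; positivity
  have hc1 : c ≤ 1 := by
    rw [hs.c_eq, div_le_one (by positivity)]; linarith
  have hE : 0 ≤ E := by rw [hs.E_eq]; positivity
  set a := min (κ ^ 2 / C₂ / 8) (min (1 / C₂ / 8) (min (c / 8 / Real.sqrt C₂) (1 / 2))) with ha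
  have hsq : 0 < Real.sqrt C₂ := Real.sqrt_pos.2 hC₂
  have ha0 : 0 < a := lt_min (by positivity) (lt_min (by positivity)
    (lt_min (by positivity) (by norm_num)))
  have a1 : a ≤ κ ^ 2 / C₂ / 8 := min_le_left _ _
  have a2 : a ≤ 1 / C₂ / 8 := (min_le_right _ _).trans (min_le_left _ _)
  have a3 : a ≤ c / 8 / Real.sqrt C₂ :=
    (min_le_right _ _).trans ((min_le_right _ _).trans (min_le_left _ _))
  have a4 : a ≤ 1 / 2 :=
    (min_le_right _ _).trans ((min_le_right _ _).trans (min_le_right _ _))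
  refine ⟨a, ha0, fun n ps D η hn hps hps1 hnD hκD hη hηD => ?_⟩
  have hn0 : 0 < n := by linarith
  have q1 := rpow_quarter_le_half hn
  have q2 := rpow_half_le_self hn
  have q3 := rpow_half_mul_self hn0
  have q4 := rpow_quarter_mul_self hn0
  set y := n ^ (1 / 4 : ℝ) with hy
  set w := n ^ (1 / 2 : ℝ) with hw
  have hy0 : 0 < y := Real.rpow_pos_of_pos hn0 _
  have hw0 : 0 < w := Real.rpow_pos_of_pos hn0 _
  have hD0 : 0 < D := by
    by_contra hcon
    push Not at hcon
    nlinarith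
  have hexpn : Real.exp (-n) ≤ Real.exp (-(a * y)) := by
    apply Real.exp_le_exp.2
    nlinarith
  have hexpD : Real.exp (-(c / 8 * (D / ps))) ≤ Real.exp (-(a * y)) := by
    apply Real.exp_le_exp.2
    have h1 : w / Real.sqrt C₂ ≤ D / ps := by
      rw [div_le_div_iff₀ hsq hps]
      apply (sq_le_sq₀ (by positivity) (by positivity)).1
      rw [mul_pow, mul_pow, Real.sq_sqrt hC₂.le]
      have e : w ^ 2 = n := by rw [sq, q3]
      rw [e]
      have : n * ps ^ 2 ≤ n * ps := by nlinarith [mul_pos hn0 hps]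
      linarith
    have h2 : a * y ≤ c / 8 / Real.sqrt C₂ * w := by gcongr
    have h3 : c / 8 / Real.sqrt C₂ * w = c / 8 * (w / Real.sqrt C₂) := by ring
    have h4 : c / 8 * (w / Real.sqrt C₂) ≤ c / 8 * (D / ps) := by gcongr
    linarith
  -- If `D² ≤ √n`, then `ps ≤ C₂ / √n`, and `τ = 1` already makes `τ² / ps` large. Otherwise `D >
  -- n^{1/4}`, and `exp (E κ D) η ≤ exp (-D / 2)` is negligible.
  by_cases hcase : D ^ 2 ≤ w
  · refine ⟨1, le_rfl, hκD, ?_, hexpn, hexpD, ?_⟩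
    · apply Real.exp_le_exp.2
      have h1 : w / C₂ ≤ 1 / ps := by
        rw [div_le_div_iff₀ hC₂ hps]
        have h2 : n * ps ≤ C₂ * w := hnD.trans (by gcongr)
        have h3 : w * (w * ps) ≤ w * C₂ := by rw [← mul_assoc, q3]; linarith
        have := le_of_mul_le_mul_left h3 hw0
        linarith
      have h2 : a * y ≤ 1 / C₂ / 8 * w := by gcongr
      have h3 : 1 / C₂ / 8 * w = w / C₂ / 8 := by ring
      rw [one_pow]
      linarith
    · rw [mul_one]
      linarith [Real.exp_pos (-(a * y))]
  · push Not at hcase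
    refine ⟨κ * D, hκD, le_rfl, ?_, hexpn, hexpD, ?_⟩
    · apply Real.exp_le_exp.2
      have h1 : κ ^ 2 / C₂ * n ≤ (κ * D) ^ 2 / ps := by
        rw [div_mul_eq_mul_div, div_le_div_iff₀ hC₂ hps, mul_pow]
        calc κ ^ 2 * n * ps = κ ^ 2 * (n * ps) := by ring
          _ ≤ κ ^ 2 * (C₂ * D ^ 2) := by gcongr
          _ = _ := by ring
      have h2 : a * y ≤ κ ^ 2 / C₂ / 8 * n := by
        gcongr
        linarith
      have h3 : κ ^ 2 / C₂ / 8 * n = κ ^ 2 / C₂ * n / 8 := by ring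
      linarith
    · have hyD : y ≤ D := by
        apply (sq_le_sq₀ hy0.le hD0.le).1
        rw [sq, q4]; exact hcase.le
      have h1 : Real.exp (E * (κ * D)) * η ≤ Real.exp (-(a * y)) := by
        calc Real.exp (E * (κ * D)) * η ≤ Real.exp (E * (κ * D)) * Real.exp (-D) := by gcongr
          _ = Real.exp (E * (κ * D) - D) := by rw [← Real.exp_add]; rfl
          _ ≤ _ := by
            apply Real.exp_le_exp.2
            have h2 := mul_le_mul_of_nonneg_right hs.pert hD0.le
            nlinarith
      have h2 : 0 ≤ Real.exp E * η := by positivity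
      linarith

end Tail

/-! ### Random splitting of the nodes -/

section Split

variable {V : Type} [Fintype V]

/-- `I` contains at least a quarter of `S`. -/
def HasQuarter (S I : Finset V) : Prop := (S.card : ℝ) / 4 ≤ ((S.filter fun a => a ∈ I).card : ℝ)

/-- Exponential Markov inequality with weight `(7/10)^4` per element of `I ∩ S`, over all subsets
`I`. The numbers work because `(1 + (7/10)^4) / 2 ≤ (9/10) (7/10)`. -/
lemma card_not_hasQuarter_le (S : Finset V) :
    ((Finset.univ.filter fun I : Finset V => ¬ HasQuarter S I).card : ℝ) ≤
      2 ^ Fintype.card V * (9 / 10) ^ S.card := by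
  have h1 : ∑ I : Finset V, ((7 / 10 : ℝ) ^ 4) ^ (S.filter fun a => a ∈ I).card =
      2 ^ Fintype.card V * ((1 + (7 / 10) ^ 4) / 2) ^ S.card := by
    have h2 := Finset.prod_add (fun i : V => if i ∈ S then (7 / 10 : ℝ) ^ 4 else 1) (fun _ => 1)
      Finset.univ
    simp only [Finset.prod_const_one, mul_one, Finset.powerset_univ, Finset.prod_ite_mem,
      Finset.prod_const] at h2
    have h3 : ∀ I : Finset V, (S.filter fun a => a ∈ I) = I ∩ S := by
      intro I; ext a; simp [and_comm]
    simp only [h3]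
    rw [← h2]
    have h4 : ∀ i : V, ((if i ∈ S then (7 / 10 : ℝ) ^ 4 else 1) + 1) =
        2 * (if i ∈ S then (1 + (7 / 10 : ℝ) ^ 4) / 2 else 1) := by
      intro i; split_ifs <;> norm_num
    simp only [h4]
    rw [Finset.prod_mul_distrib, Finset.prod_const, Finset.card_univ, Finset.prod_ite_mem,
      Finset.univ_inter, Finset.prod_const]
  have h2 : ((Finset.univ.filter fun I : Finset V => ¬ HasQuarter S I).card : ℝ) *
      (7 / 10) ^ S.card ≤ ∑ I : Finset V, ((7 / 10 : ℝ) ^ 4) ^ (S.filter fun a => a ∈ I).card := by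
    calc _ = ∑ I ∈ Finset.univ.filter (fun I : Finset V => ¬ HasQuarter S I),
          (7 / 10 : ℝ) ^ S.card := by rw [Finset.sum_const, nsmul_eq_mul]
      _ ≤ ∑ I ∈ Finset.univ.filter (fun I : Finset V => ¬ HasQuarter S I),
          ((7 / 10 : ℝ) ^ 4) ^ (S.filter fun a => a ∈ I).card := by
        refine Finset.sum_le_sum fun I hI => ?_
        have hq := (Finset.mem_filter.1 hI).2
        unfold HasQuarter at hq
        push Not at hq
        rw [← pow_mul]
        apply pow_le_pow_of_le_one (by norm_num) (by norm_num)
        have : (4 : ℝ) * ((S.filter fun a => a ∈ I).card : ℝ) ≤ S.card := by linarith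
        exact_mod_cast this
      _ ≤ _ := Finset.sum_le_sum_of_subset_of_nonneg (Finset.filter_subset _ _)
          fun _ _ _ => by positivity
  rw [h1] at h2
  have h3 : ((1 + (7 / 10 : ℝ) ^ 4) / 2) ^ S.card ≤ (9 / 10) ^ S.card * (7 / 10) ^ S.card := by
    rw [← mul_pow]
    gcongr
    norm_num
  have h4 : (0 : ℝ) < (7 / 10) ^ S.card := by positivity
  refine le_of_mul_le_mul_right (h2.trans ?_) h4
  rw [mul_assoc]
  gcongr

lemma card_not_hasQuarter_compl_le (S : Finset V) :
    ((Finset.univ.filter fun I : Finset V => ¬ HasQuarter S Iᶜ).card : ℝ) ≤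
      2 ^ Fintype.card V * (9 / 10) ^ S.card := by
  refine le_trans (le_of_eq ?_) (card_not_hasQuarter_le S)
  congr 1
  refine Finset.card_bij (fun I _ => Iᶜ) (fun I hI => ?_) (fun I _ J _ h => compl_injective h)
    (fun J hJ => ⟨Jᶜ, ?_, compl_compl J⟩)
  · simpa using hI
  · simpa using hJ

/-- The central coefficient is the largest of `n + 1`. Restricting from all subsets to those of size
`⌊n/2⌋` thus costs only a factor `n + 1`. -/
lemma two_pow_le_mul_choose (n : ℕ) : (2 : ℝ) ^ n ≤ (n + 1) * (n.choose (n / 2) : ℝ) := by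
  have h : 2 ^ n ≤ (n + 1) * n.choose (n / 2) := by
    rw [← Nat.sum_range_choose]
    calc _ ≤ ∑ _m ∈ Finset.range (n + 1), n.choose (n / 2) :=
          Finset.sum_le_sum fun m _ => Nat.choose_le_middle m n
      _ = _ := by simp
  exact_mod_cast h

variable {K : ℕ}

/-- Both parts of the splitting contain a quarter of each community. -/
def Balanced (z : V → Fin K) (I : Finset V) : Prop :=
  ∀ m, HasQuarter (Finset.univ.filter fun i => z i = m) I ∧
    HasQuarter (Finset.univ.filter fun i => z i = m) Iᶜ

lemma card_not_balanced_le (z : V → Fin K) {b : ℝ}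
    (hsize : ∀ k, (Fintype.card V : ℝ) / b ≤ commSize z k) :
    ((((Finset.univ : Finset V).powersetCard (Fintype.card V / 2)).filter
      fun I => ¬ Balanced z I).card : ℝ) ≤
      2 * K * ((Fintype.card V + 1) * Real.exp (-(Fintype.card V / b / 10))) *
        ((Fintype.card V).choose (Fintype.card V / 2) : ℝ) := by
  set n := Fintype.card V with hn
  have hpow : ∀ m : Fin K, (2 : ℝ) ^ n * (9 / 10) ^ (Finset.univ.filter fun i => z i = m).card ≤
      (n + 1) * Real.exp (-(n / b / 10)) * (n.choose (n / 2) : ℝ) := by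
    intro m
    have h1 : (9 / 10 : ℝ) ^ (Finset.univ.filter fun i => z i = m).card ≤
        Real.exp (-(n / b / 10)) := by
      have h2 : (9 / 10 : ℝ) ≤ Real.exp (-(1 / 10)) := by
        have := Real.add_one_le_exp (-(1 / 10 : ℝ)); linarith
      calc _ ≤ Real.exp (-(1 / 10)) ^ (Finset.univ.filter fun i => z i = m).card := by gcongr
        _ = Real.exp (-((commSize z m : ℝ) / 10)) := by
          rw [← Real.exp_nat_mul, commSize]; congr 1; ring
        _ ≤ _ := by
          apply Real.exp_le_exp.2
          have := hsize m
          linarith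
    calc _ ≤ ((n + 1) * (n.choose (n / 2) : ℝ)) * Real.exp (-(n / b / 10)) := by
          have := two_pow_le_mul_choose n
          gcongr
      _ = _ := by ring
  have hsub : ((Finset.univ : Finset V).powersetCard (n / 2)).filter (fun I => ¬ Balanced z I) ⊆
      Finset.univ.biUnion fun m : Fin K =>
        (Finset.univ.filter fun I : Finset V =>
          ¬ HasQuarter (Finset.univ.filter fun i => z i = m) I) ∪
        (Finset.univ.filter fun I : Finset V =>
          ¬ HasQuarter (Finset.univ.filter fun i => z i = m) Iᶜ) := by
    intro I hI
    have h1 := (Finset.mem_filter.1 hI).2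
    unfold Balanced at h1
    push Not at h1
    obtain ⟨m, hm⟩ := h1
    simp only [Finset.mem_biUnion, Finset.mem_univ, true_and, Finset.mem_union, Finset.mem_filter]
    refine ⟨m, ?_⟩
    by_cases h2 : HasQuarter (Finset.univ.filter fun i => z i = m) I
    · exact Or.inr (hm h2)
    · exact Or.inl h2
  have h3 := (Finset.card_le_card hsub).trans (Finset.card_biUnion_le)
  have h4 : ((((Finset.univ : Finset V).powersetCard (n / 2)).filter
      fun I => ¬ Balanced z I).card : ℝ) ≤ ∑ _m : Fin K,
      2 * ((n + 1) * Real.exp (-(n / b / 10)) * (n.choose (n / 2) : ℝ)) := by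
    refine (Nat.cast_le (α := ℝ).2 h3).trans ?_
    push_cast
    refine Finset.sum_le_sum fun m _ => ?_
    refine (Nat.cast_le (α := ℝ).2 (Finset.card_union_le _ _)).trans ?_
    push_cast
    have h5 := (card_not_hasQuarter_le (Finset.univ.filter fun i => z i = m)).trans (hpow m)
    have h6 := (card_not_hasQuarter_compl_le (Finset.univ.filter fun i => z i = m)).trans (hpow m)
    linarith
  refine h4.trans (le_of_eq ?_)
  rw [Finset.sum_const, nsmul_eq_mul, Finset.card_univ, Fintype.card_fin]
  ring

/-- The part of `I` used in iteration `j`. -/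
def part (I : Finset V) (j : V) : Finset V := I.erase j

/-- Deleting `j` loses at most one node, and a quarter minus one is at least an eighth once the
community has 8 nodes. -/
lemma HasQuarter.part {z : V → Fin K} {I : Finset V} {m : Fin K}
    (h : HasQuarter (Finset.univ.filter fun i => z i = m) I) (h8 : (8 : ℝ) ≤ commSize z m) (j : V) :
    1 / 8 * (commSize z m : ℝ) ≤ (((part I j).filter fun a => z a = m).card : ℝ) := by
  have h1 : ((Finset.univ.filter fun i => z i = m).filter fun a => a ∈ I).card ≤
      ((SBM.part I j).filter fun a => z a = m).card + 1 := by
    refine le_trans (Finset.card_le_card (t := insert j ((SBM.part I j).filter fun a => z a = m)) ?_)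
      (Finset.card_insert_le _ _)
    intro a ha
    simp only [Finset.mem_filter, Finset.mem_univ, true_and] at ha
    simp only [Finset.mem_insert, Finset.mem_filter, SBM.part, Finset.mem_erase]
    tauto
  have h2 : (((Finset.univ.filter fun i => z i = m).filter fun a => a ∈ I).card : ℝ) ≤
      (((SBM.part I j).filter fun a => z a = m).card : ℝ) + 1 := by exact_mod_cast h1
  unfold HasQuarter at h
  change (commSize z m : ℝ) / 4 ≤ _ at h
  linarith

/-- The part of the complement of `I` used in iteration `j`. -/
def coPart (I : Finset V) (j : V) : Finset V := Iᶜ.erase j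

lemma mem_part_or_mem_coPart (I : Finset V) (j a : V) : a = j ∨ a ∈ part I j ∨ a ∈ coPart I j := by
  simp only [part, coPart, Finset.mem_erase, Finset.mem_compl]
  tauto

lemma disjoint_part_coPart (I : Finset V) (j : V) : Disjoint (part I j) (coPart I j) := by
  rw [Finset.disjoint_left]
  intro a ha hb
  simp only [part, coPart, Finset.mem_erase, Finset.mem_compl] at ha hb
  exact hb.2 ha.2

lemma Balanced.spread {z : V → Fin K} {I : Finset V} (h : Balanced z I)
    (h8 : ∀ m, (8 : ℝ) ≤ commSize z m) (j : V) :
    Spread z (SBM.part I j) ∧ Spread z (coPart I j) :=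
  ⟨fun m => (h m).1.part (h8 m) j, fun m => (h m).2.part (h8 m) j⟩

/-- Averages over the splitting, bounded through the balanced splittings. -/
lemma expect_le [LinearOrder V] {z : V → Fin K} {P : Matrix (Fin K) (Fin K) ℝ}
    (hP : ∀ k l, 0 < P k l ∧ P k l < 1) {b X : ℝ}
    (hsize : ∀ k, (Fintype.card V : ℝ) / b ≤ commSize z k)
    {f : SimpleGraph V → Finset V → ℝ} (hf1 : ∀ G I, f G I ≤ 1) (hX0 : 0 ≤ X)
    (hX : ∀ I : Finset V, I.card = Fintype.card V / 2 → Balanced z I →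
      bE (edgeP z P) (fun x => f (graphOf x) I) ≤ X) :
    expect z P f ≤ X + 2 * K * ((Fintype.card V + 1) * Real.exp (-(Fintype.card V / b / 10))) := by
  set n := Fintype.card V with hn
  have hch : (0 : ℝ) < (n.choose (n / 2) : ℝ) := by
    exact_mod_cast Nat.choose_pos (Nat.div_le_self n 2)
  unfold expect
  rw [div_le_iff₀ (by exact_mod_cast hch)]
  simp only [sum_graphProb_mul]
  have h1 : ∀ I ∈ (Finset.univ : Finset V).powersetCard (n / 2),
      bE (edgeP z P) (fun x => f (graphOf x) I) ≤ X + if Balanced z I then 0 else 1 := by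
    intro I hI
    split_ifs with hbal
    · rw [add_zero]
      exact hX I (Finset.mem_powersetCard.1 hI).2 hbal
    · have : bE (edgeP z P) (fun x => f (graphOf x) I) ≤ bE (edgeP z P) (fun _ => 1) :=
        bE_mono (edgeP_mem hP) fun x => hf1 _ _
      rw [bE_const] at this
      linarith
  refine (Finset.sum_le_sum h1).trans ?_
  rw [Finset.sum_add_distrib, Finset.sum_const, nsmul_eq_mul, Finset.card_powersetCard,
    Finset.card_univ, ← hn, add_mul]
  refine add_le_add (le_of_eq (mul_comm _ _)) ?_
  have h2 : ∑ I ∈ (Finset.univ : Finset V).powersetCard (n / 2),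
      (if Balanced z I then (0 : ℝ) else 1) =
      ((((Finset.univ : Finset V).powersetCard (n / 2)).filter fun I => ¬ Balanced z I).card : ℝ) := by
    rw [Finset.card_filter]
    push_cast
    refine Finset.sum_congr rfl fun I _ => ?_
    split_ifs <;> simp_all
  rw [h2]
  exact card_not_balanced_le z hsize

end Split

/-! ### Comparison of the error rates -/

section Rates

variable {V : Type} [Fintype V] {K : ℕ} {ε ω ps b : ℝ} {z : V → Fin K}
  {P : Matrix (Fin K) (Fin K) ℝ}

lemma abs_logOdds_eq {a b : ℝ} (ha : 0 < a) (ha1 : a < 1) (hb : 0 < b) (hb1 : b < 1) :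
    |logOdds a b| = |Real.log (a * (1 - b) / (b * (1 - a)))| := by
  rw [logOdds_eq ha ha1 hb hb1, ← inv_div, Real.log_inv, abs_neg]

lemma eq_of_logOdds_eq_zero {a b : ℝ} (ha : 0 < a) (ha1 : a < 1) (hb : 0 < b) (hb1 : b < 1)
    (h : logOdds a b = 0) : a = b := by
  have h1 : 0 < 1 - a := by linarith
  have h2 : 0 < 1 - b := by linarith
  rw [logOdds_eq ha ha1 hb hb1] at h
  have h3 := Real.eq_one_of_pos_of_log_eq_zero (by positivity) h
  rw [div_eq_one_iff_eq (by positivity)] at h3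
  linarith

lemma abs_logOdds_le_maxLogOdds (h : BlockBounds ε ω ps P) (k l : Fin K) (j : V) :
    |logOdds (pRow z P k j) (pRow z P l j)| ≤ maxLogOdds z P k l := by
  have hm : ∀ k, 0 < pRow z P k j ∧ pRow z P k j < 1 := fun k => h.mem _ _
  rw [abs_logOdds_eq (hm k).1 (hm k).2 (hm l).1 (hm l).2]
  exact le_ciSup (f := fun j : V => |Real.log (pRow z P k j * (1 - pRow z P l j) /
    (pRow z P l j * (1 - pRow z P k j)))|) (Set.finite_range _).bddAbove j

lemma BlockBounds.pairSep_pos (h : BlockBounds ε ω ps P) (hD : 0 < dStar z P) {k l : Fin K}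
    (hkl : k ≠ l) : 0 < pairSep z P ps k l := by
  have h1 := h.dStar_le_sep (z := z) hkl
  have h2 : 0 < ω / ε := div_pos h.omega_pos h.eps_pos
  exact (mul_pos_iff_of_pos_left h2).1 (hD.trans_le h1)

/-- The constant in the comparison of the affinity with the Chernoff rate. -/
def rateC (ε ω b : ℝ) : ℝ :=
  2 * (1 + 2 * (ω + 1 / ε) ^ 2 + 4 / (ε / (8 * ω)) ^ 2) / Real.sqrt (ε / (b * ω))

lemma rateC_pos (hε : 0 < ε) (hω : 0 < ω) (hb : 0 < b) : 0 < rateC ε ω b := by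
  unfold rateC; positivity

/-- The log-odds difference of a node depends only on its community. The maximum is therefore
attained on at least `n / b` nodes with one common weight, and these supply the anticoncentration.
-/
lemma BlockBounds.pairAff_le_rate (h : BlockBounds ε ω ps P) (hD : 0 < dStar z P) (hb : 0 < b)
    (hn : 0 < Fintype.card V) (hsize : ∀ k, (Fintype.card V : ℝ) / b ≤ commSize z k)
    {k l : Fin K} (hkl : k ≠ l) :
    pairAff z P k l ≤ rateC ε ω b *
      ((Real.sqrt ((Fintype.card V : ℝ) * ps) * maxLogOdds z P k l)⁻¹ *
        Real.exp (-pairInfo z P k l)) := by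
  have : Nonempty V := Fintype.card_pos_iff.1 hn
  have hn' : (0 : ℝ) < Fintype.card V := by exact_mod_cast hn
  have hω := h.omega_pos
  have hε := h.eps_pos
  have hps := h.ps_pos
  have hχ : 0 < chiSep ps (pRow z P k) (pRow z P l) := h.pairSep_pos hD hkl
  obtain ⟨j₀, hj₀⟩ := exists_eq_ciSup_of_finite (f := fun j : V =>
    |Real.log (pRow z P k j * (1 - pRow z P l j) / (pRow z P l j * (1 - pRow z P k j)))|)
  have hL : |logOdds (pRow z P k j₀) (pRow z P l j₀)| = maxLogOdds z P k l := by
    have hm : ∀ k, 0 < pRow z P k j₀ ∧ pRow z P k j₀ < 1 := fun k => h.mem _ _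
    rw [abs_logOdds_eq (hm k).1 (hm k).2 (hm l).1 (hm l).2]
    exact hj₀
  -- If the maximal log-odds difference vanished, the two rows would coincide, contrary to `D* > 0`.
  have hL0 : logOdds (pRow z P k j₀) (pRow z P l j₀) ≠ 0 := by
    intro h0
    rw [h0, abs_zero] at hL
    have heq : ∀ j, pRow z P k j = pRow z P l j := fun j =>
      eq_of_logOdds_eq_zero (h.mem _ _).1 (h.mem _ _).2 (h.mem _ _).1 (h.mem _ _).2
        (abs_nonpos_iff.1 (hL ▸ abs_logOdds_le_maxLogOdds h k l j))
    have : chiSep ps (pRow z P k) (pRow z P l) = 0 :=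
      Finset.sum_eq_zero fun j _ => by rw [heq j]; simp
    linarith
  have key := affinity_le (h.comparable z k l) hχ (Finset.univ.filter fun j => z j = z j₀)
    (L := logOdds (pRow z P k j₀) (pRow z P l j₀)) (N := Fintype.card V / b)
    (fun j hj => by
      have hj' := (Finset.mem_filter.1 hj).2
      simp only [pRow, hj']) hL0 (by positivity) (hsize (z j₀)) ⟨j₀, by simp⟩
  refine key.trans (le_of_eq ?_)
  have hsq : Real.sqrt ((Fintype.card V : ℝ) / b * (ps / ω * ε)) =
      Real.sqrt (Fintype.card V * ps) * Real.sqrt (ε / (b * ω)) := by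
    rw [← Real.sqrt_mul (by positivity)]
    congr 1
    field_simp
  rw [hL, hsq, rateC, pairInfo, div_eq_mul_inv, div_eq_mul_inv _ (Real.sqrt (ε / (b * ω)))]
  simp only [mul_inv]
  ring

/-- The total variation rate is at most a constant times the Chernoff rate. -/
lemma BlockBounds.etaStar_le_chernoffRate (h : BlockBounds ε ω (pStar P) P) (hK : 2 ≤ K)
    (hD : 0 < dStar z P) (hb : 0 < b) (hn : 0 < Fintype.card V)
    (hsize : ∀ k, (Fintype.card V : ℝ) / b ≤ commSize z k) :
    etaStar z P ≤ rateC ε ω b * chernoffRate z P := by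
  have := pairs_nonempty hK
  have hC := rateC_pos h.eps_pos h.omega_pos hb
  refine ciSup_le fun kl => (h.pairAff_le_rate hD hb hn hsize kl.2).trans ?_
  refine mul_le_mul_of_nonneg_left ?_ hC.le
  exact le_ciSup (f := fun kl : Pairs K =>
    (Real.sqrt ((Fintype.card V : ℝ) * pStar P) * maxLogOdds z P kl.1.1 kl.1.2)⁻¹ *
      Real.exp (-pairInfo z P kl.1.1 kl.1.2)) (Set.finite_range _).bddAbove kl

/-- If `D*` is at most `(1 + r/2) log n`, the total variation rate is at least of order
`n ^ (-(r + 1))`. -/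
lemma BlockBounds.rpow_le_etaStar (h : BlockBounds ε ω ps P) (hK : 2 ≤ K) (hD : 0 < dStar z P)
    {n r : ℝ} (hn : 1 ≤ n) (hr : 0 < r) (hDn : dStar z P ≤ (1 + r / 2) * Real.log n) :
    n ^ (-(r + 1)) ≤
      Real.exp (((ω + 1 / ε) ^ 2 * (8 / ε)) / (4 * (r / 2 / (1 + r / 2)))) * etaStar z P := by
  have := pairs_nonempty hK
  have hω := h.omega_pos
  have hε := h.eps_pos
  obtain ⟨kl, hkl⟩ := exists_eq_ciInf_of_finite (f := fun kl : Pairs K =>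
    pairInfo z P kl.1.1 kl.1.2)
  have hkl' : chernoffInfo (bernProd (pRow z P kl.1.1)) (bernProd (pRow z P kl.1.2)) =
    dStar z P := hkl
  have h1 := (le_affinity (h.comparable z kl.1.1 kl.1.2) (h.pairSep_pos hD kl.2)).trans
    (pairAff_le_etaStar z P kl.2)
  rw [hkl'] at h1
  set D := dStar z P with hDdef
  set θ := r / 2 / (1 + r / 2) with hθ
  have hθ0 : 0 < θ := by positivity
  have hn0 : 0 < n := by linarith
  set G := (ω + 1 / ε) ^ 2 * (8 / ε) with hG
  -- The square root term is absorbed into `θ D` plus a constant by completing a square; `θ` is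
  -- chosen so that `(1 + θ) (1 + r/2) = 1 + r`.
  have h2 : (ω + 1 / ε) * Real.sqrt (8 / ε * D) ≤ θ * D + G / (4 * θ) := by
    set y := Real.sqrt (8 / ε * D) with hy
    have hy2 : y ^ 2 = 8 / ε * D := Real.sq_sqrt (by positivity)
    have hD' : D = y ^ 2 * (ε / 8) := by rw [hy2]; field_simp
    have h3 : 0 ≤ (2 * θ * (ε / 8) * y - (ω + 1 / ε)) ^ 2 / (4 * θ * (ε / 8)) := by positivity
    have h4 : (2 * θ * (ε / 8) * y - (ω + 1 / ε)) ^ 2 / (4 * θ * (ε / 8)) =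
        θ * (y ^ 2 * (ε / 8)) + G / (4 * θ) - (ω + 1 / ε) * y := by
      rw [hG]
      generalize ω + 1 / ε = g
      field_simp
      ring
    rw [hD']
    linarith
  have h5 : (1 + θ) * D ≤ (r + 1) * Real.log n := by
    have h6 : (1 + θ) * (1 + r / 2) = r + 1 := by rw [hθ]; field_simp; ring
    calc (1 + θ) * D ≤ (1 + θ) * ((1 + r / 2) * Real.log n) := by gcongr
      _ = _ := by rw [← mul_assoc, h6]
  have h7 : n ^ (-(r + 1)) ≤ Real.exp (G / (4 * θ)) *
      Real.exp (-D - (ω + 1 / ε) * Real.sqrt (8 / ε * D)) := by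
    rw [Real.rpow_def_of_pos hn0, ← Real.exp_add]
    apply Real.exp_le_exp.2
    linarith
  exact h7.trans (mul_le_mul_of_nonneg_left h1 (Real.exp_pos _).le)

end Rates

/-! ### The error of the algorithm -/

section Algorithm

variable {ε ω b κ c E : ℝ}

/-- The assumptions on model, clustering procedure and constants in the error bounds. -/
structure Setting {V : Type} [Fintype V] {K : ℕ} (β ε ω b κ c r C₂ : ℝ) (Kmax : ℕ)
    (z : V → Fin K) (P : Matrix (Fin K) (Fin K) ℝ) (SC : Clustering K) (Csc : ℝ → ℝ) : Prop where
  two_le : 2 ≤ K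
  le_max : K ≤ Kmax
  adm : Admissible β ε ω z P
  bounds : BlockBounds ε ω (pStar P) P
  size : ∀ k, (Fintype.card V : ℝ) / b ≤ commSize z k
  card_ge : 8 * b ≤ Fintype.card V
  one_le_card : (1 : ℝ) ≤ Fintype.card V
  D_pos : 0 < dStar z P
  np_le : Fintype.card V * pStar P ≤ C₂ * dStar z P ^ 2
  D_ge : 256 * C₂ * Kmax / c ^ 3 ≤ dStar z P
  kappa_D : 1 ≤ κ * dStar z P
  guarantee : ∀ β', 1 < β' → ClusteringGuarantee β' ε ω r (Csc β') SC

variable {β r C₂ : ℝ} {Kmax : ℕ} {Csc : ℝ → ℝ}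

/-- Error probability of a single iteration, for a balanced splitting. -/
lemma Scales.exists_bP_node_le (hs : Scales ε ω b κ c E) (hβ : 1 < β) (hε : 0 < ε) (hε1 : ε < 1)
    (hω : 1 < ω) (hr : 0 < r) (hC₂0 : 0 < C₂)
    (hC₂ : C₂ * (2 * max (Csc β) 0 + max (Csc (8 * β)) 0 / c) ≤ κ) :
    ∃ C : ℝ, 0 < C ∧ ∀ (V : Type) [Fintype V] [LinearOrder V] (K : ℕ) (z : V → Fin K)
      (P : Matrix (Fin K) (Fin K) ℝ) (SC : Clustering K),
      Setting β ε ω b κ c r C₂ Kmax z P SC Csc →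
      ∀ zhat : SimpleGraph V → Finset V → V → Fin K, IsAlgorithm SC zhat →
      ∀ I : Finset V, I.card = Fintype.card V / 2 → Balanced z I → ∀ j,
      bP (edgeP z P) (fun x => align (SC V (graphOf x)) z (zhat (graphOf x) I j) ≠ z j) ≤
        C * ((Fintype.card V : ℝ) ^ (-(r + 1)) + etaStar z P) := by
  obtain ⟨a, ha, hτ⟩ := hs.exists_tau hε hε1 hω hC₂0
  obtain ⟨C', hC', hdecay⟩ := exists_exp_neg_le_rpow ha (by linarith : 0 < r + 1)
  have hb := hs.b_pos
  have hc : 0 < c := by rw [hs.c_eq]; positivity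
  set F : ℝ := (Nat.factorial Kmax : ℝ) with hF
  have hF0 : 0 < F := by rw [hF]; exact_mod_cast Nat.factorial_pos _
  refine ⟨(1 + 2 * 8 ^ (r + 1)) + (4 * Kmax ^ 2 + 2 + 2 * F + F * (F * Kmax)) * C' +
    F * (F * (Kmax * Real.exp E)), by positivity, ?_⟩
  intro V _ _ K z P SC hS zhat halg I hI hbal j
  have hB := hS.bounds
  have hη := (hB.etaStar_pos (z := z) hS.two_le).le
  obtain ⟨τ, hτ1, hτD, e1, e2, e3, e4⟩ := hτ (Fintype.card V) (pStar P) (dStar z P) (etaStar z P)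
    hS.one_le_card hB.ps_pos (by linarith [hB.ps_le]) hS.np_le hS.kappa_D hη
    (hB.etaStar_le hS.two_le)
  have hdec := hdecay (Fintype.card V) hS.one_le_card
  have h8 : ∀ m, (8 : ℝ) ≤ commSize z m := fun m =>
    ((le_div_iff₀ hb).2 hS.card_ge).trans (hS.size m)
  have hKc : (K : ℝ) ≤ Kmax := by exact_mod_cast hS.le_max
  have hFc : (Nat.factorial K : ℝ) ≤ F := by
    rw [hF]; exact_mod_cast Nat.factorial_le hS.le_max
  have key := hs.bP_iteration_le hB hS.two_le hβ hS.adm hS.size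
    (by linarith [hS.card_ge]) rfl hS.D_pos hr hS.np_le
    (le_trans (by gcongr) hS.D_ge) hτ1 hτD (hS.guarantee β hβ)
    (hS.guarantee (8 * β) (by linarith)) (le_max_left _ 0) (le_max_right _ _) (le_max_left _ 0)
    (le_max_right _ _) hC₂ (mem_part_or_mem_coPart I j) (disjoint_part_coPart I j)
    (by simp [part]) (by simp [coPart]) (hbal.spread h8 j).1 (hbal.spread h8 j).2
    (fun x => zhat (graphOf x) I j) (fun x => by
      obtain ⟨y, w, h1, h2, h3, h4, -, h6⟩ := halg (graphOf x) I hI j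
      exact ⟨y, w, h1, h2, h3, h4, h6⟩)
  refine key.trans ?_
  set nn := (Fintype.card V : ℝ) with hnn
  set t := Real.exp (-(a * nn ^ (1 / 4 : ℝ))) with ht
  have ht0 : 0 < t := Real.exp_pos _
  have hrp : 0 < nn ^ (-(r + 1)) := Real.rpow_pos_of_pos (by linarith [hS.one_le_card]) _
  have s1 : 2 * ((K : ℝ) ^ 2 * (2 * Real.exp (-(τ ^ 2 / pStar P / 8))) + Real.exp (-nn)) ≤
      2 * ((Kmax : ℝ) ^ 2 * (2 * t) + t) := by gcongr
  have s2 : 2 * ((Nat.factorial K : ℝ) * Real.exp (-(c / 8 * (dStar z P / pStar P)))) ≤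
      2 * (F * t) := by gcongr
  have s3 : (Nat.factorial K : ℝ) * ((Nat.factorial K : ℝ) *
      (K * (Real.exp (E * τ) * etaStar z P))) ≤
      F * (F * (Kmax * (Real.exp E * etaStar z P + t))) := by gcongr
  have s4 : (4 * (Kmax : ℝ) ^ 2 + 2 + 2 * F + F * (F * Kmax)) * t ≤
      (4 * (Kmax : ℝ) ^ 2 + 2 + 2 * F + F * (F * Kmax)) * (C' * nn ^ (-(r + 1))) := by gcongr
  have s5 : 0 ≤ (1 + 2 * 8 ^ (r + 1) + (4 * (Kmax : ℝ) ^ 2 + 2 + 2 * F + F * (F * Kmax)) * C') *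
      etaStar z P := by positivity
  have s6 : 0 ≤ F * (F * (Kmax * Real.exp E)) * nn ^ (-(r + 1)) := by positivity
  nlinarith

variable {V : Type} [Fintype V] {K : ℕ}

lemma mis_le_one (zh z : V → Fin K) : mis zh z ≤ 1 := by
  refine (mis_le_align (zt := zh)).trans ?_
  apply div_le_one_of_le₀ _ (Nat.cast_nonneg _)
  exact_mod_cast Finset.card_le_univ _

lemma exists_align_ne_of_mis_pos {zh zt z : V → Fin K} (h : 0 < mis zh z) :
    ∃ j ∈ Finset.univ, align zt z (zh j) ≠ z j := by
  by_contra hcon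
  push Not at hcon
  have h1 := mis_le_align (zh := zh) (zt := zt) (z := z)
  rw [Finset.filter_false_of_mem (fun j hj => not_not.2 (hcon j hj))] at h1
  simp at h1
  linarith

variable [LinearOrder V] {z : V → Fin K} {P : Matrix (Fin K) (Fin K) ℝ}

/-- The permutation aligning the initial labels is common to all iterations. Errors of single nodes
can thus be averaged although each output label comes from its own run. -/
lemma bE_mis_le (hP : ∀ k l, 0 < P k l ∧ P k l < 1) (hn : 0 < Fintype.card V)
    {zh zt : (V × V → Bool) → V → Fin K} {X : ℝ}
    (hX : ∀ j, bP (edgeP z P) (fun x => align (zt x) z (zh x j) ≠ z j) ≤ X) :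
    bE (edgeP z P) (fun x => mis (zh x) z) ≤ X := by
  have hn' : (0 : ℝ) < Fintype.card V := by exact_mod_cast hn
  have h1 : ∀ x, mis (zh x) z ≤ (Fintype.card V : ℝ)⁻¹ *
      ∑ j, if align (zt x) z (zh x j) ≠ z j then (1 : ℝ) else 0 := by
    intro x
    refine (mis_le_align (zt := zt x)).trans (le_of_eq ?_)
    rw [div_eq_inv_mul, Finset.card_filter]
    push_cast
    rfl
  refine (bE_mono (edgeP_mem hP) h1).trans ?_
  rw [bE_const_mul, bE_sum, inv_mul_le_iff₀ hn']
  refine (Finset.sum_le_sum fun j _ => (le_of_eq (by unfold bP; congr!)).trans (hX j)).trans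
    (le_of_eq ?_)
  rw [Finset.sum_const, nsmul_eq_mul, Finset.card_univ]

lemma bP_mis_pos_le (hP : ∀ k l, 0 < P k l ∧ P k l < 1)
    {zh zt : (V × V → Bool) → V → Fin K} {X : ℝ}
    (hX : ∀ j, bP (edgeP z P) (fun x => align (zt x) z (zh x j) ≠ z j) ≤ X) :
    bP (edgeP z P) (fun x => 0 < mis (zh x) z) ≤ Fintype.card V * X := by
  refine (bP_mono (edgeP_mem hP) fun x hx =>
    exists_align_ne_of_mis_pos (zt := zt x) hx).trans ?_
  refine (bP_exists_le (edgeP_mem hP) _ _).trans ?_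
  refine (Finset.sum_le_sum fun j _ => hX j).trans (le_of_eq ?_)
  rw [Finset.sum_const, nsmul_eq_mul, Finset.card_univ]

/-- Probability of an unbalanced splitting. -/
lemma exists_unbalanced_le (hb : 0 < b) (hr : 0 < r) (Kmax : ℕ) :
    ∃ C : ℝ, 0 < C ∧ ∀ (K : ℕ) (n : ℝ), K ≤ Kmax → 1 ≤ n →
      2 * K * ((n + 1) * Real.exp (-(n / b / 10))) ≤ C * n ^ (-(r + 1)) := by
  obtain ⟨C, hC, h⟩ := exists_exp_neg_le_rpow (a := 1 / (b * 10)) (m := r + 2) (by positivity)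
    (by linarith)
  refine ⟨4 * (Kmax + 1) * C, by positivity, fun K n hK hn => ?_⟩
  have hn0 : 0 < n := by linarith
  have hKc : (K : ℝ) ≤ Kmax + 1 := by
    have : (K : ℝ) ≤ Kmax := by exact_mod_cast hK
    linarith
  have h1 : Real.exp (-(n / b / 10)) ≤ C * n ^ (-(r + 2)) := by
    refine le_trans (Real.exp_le_exp.2 ?_) (h n hn)
    have h2 : n ^ (1 / 4 : ℝ) ≤ n := (rpow_quarter_le_half hn).trans (rpow_half_le_self hn)
    have h3 : n / b / 10 = 1 / (b * 10) * n := by field_simp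
    rw [h3]
    gcongr
  have h4 : n * n ^ (-(r + 2)) = n ^ (-(r + 1)) := by
    have := Real.rpow_add hn0 1 (-(r + 2))
    rw [Real.rpow_one] at this
    rw [← this]
    congr 1; ring
  calc 2 * K * ((n + 1) * Real.exp (-(n / b / 10)))
      ≤ 2 * (Kmax + 1) * ((n + n) * (C * n ^ (-(r + 2)))) := by gcongr
    _ = 4 * (Kmax + 1) * C * (n * n ^ (-(r + 2))) := by ring
    _ = _ := by rw [h4]

/-- Expected misclassification rate and probability of any misclassification. -/
lemma Scales.exists_mis_le (hs : Scales ε ω b κ c E) (hβ : 1 < β) (hε : 0 < ε) (hε1 : ε < 1)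
    (hω : 1 < ω) (hr : 0 < r) (hC₂0 : 0 < C₂)
    (hC₂ : C₂ * (2 * max (Csc β) 0 + max (Csc (8 * β)) 0 / c) ≤ κ) :
    ∃ C : ℝ, 0 < C ∧ ∀ (V : Type) [Fintype V] [LinearOrder V] (K : ℕ) (z : V → Fin K)
      (P : Matrix (Fin K) (Fin K) ℝ) (SC : Clustering K),
      Setting β ε ω b κ c r C₂ Kmax z P SC Csc →
      ∀ zhat : SimpleGraph V → Finset V → V → Fin K, IsAlgorithm SC zhat →
      expect z P (fun G I => mis (zhat G I) z) ≤
        C * ((Fintype.card V : ℝ) ^ (-(r + 1)) + etaStar z P) ∧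
      ∀ δ : ℝ, 0 < δ → prob z P (fun G I => δ ≤ mis (zhat G I) z) ≤
        C * ((Fintype.card V : ℝ) ^ (-r) + Fintype.card V * etaStar z P) := by
  obtain ⟨C, hC, hnode⟩ := hs.exists_bP_node_le (Kmax := Kmax) hβ hε hε1 hω hr hC₂0 hC₂
  obtain ⟨C', hC', hunb⟩ := exists_unbalanced_le hs.b_pos hr Kmax
  refine ⟨C + C', by positivity, ?_⟩
  intro V _ _ K z P SC hS zhat halg
  have hB := hS.bounds
  have hη := hB.etaStar_pos (z := z) hS.two_le
  have hn1 := hS.one_le_card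
  have hu := hunb K (Fintype.card V) hS.le_max hn1
  set n : ℝ := (Fintype.card V : ℝ) with hn
  have hn0 : 0 < n := by linarith
  have hncard : 0 < Fintype.card V := Nat.cast_pos.1 hn0
  have hrp : 0 < n ^ (-(r + 1)) := Real.rpow_pos_of_pos hn0 _
  have hrp' : 0 < n ^ (-r) := Real.rpow_pos_of_pos hn0 _
  have hmul : n * n ^ (-(r + 1)) = n ^ (-r) := by
    have := Real.rpow_add hn0 1 (-(r + 1))
    rw [Real.rpow_one] at this
    rw [← this]
    congr 1; ring
  constructor
  · refine (expect_le hB.mem hS.size (fun _ _ => mis_le_one _ _)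
      (X := C * (n ^ (-(r + 1)) + etaStar z P)) (by positivity) fun I hI hbal => ?_).trans ?_
    · exact bE_mis_le hB.mem hncard (hnode V K z P SC hS zhat halg I hI hbal)
    · have : 0 ≤ C' * etaStar z P := by positivity
      linarith
  · intro δ hδ
    refine (expect_le hB.mem hS.size (fun _ _ => by split_ifs <;> norm_num)
      (X := n * (C * (n ^ (-(r + 1)) + etaStar z P))) (by positivity) fun I hI hbal => ?_).trans ?_
    -- Only positivity of the threshold matters: positive misclassification already means that some
    -- node is wrong.
    · refine le_trans (bP_mono (edgeP_mem hB.mem) fun x hx => hδ.trans_le hx) ?_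
      exact bP_mis_pos_le hB.mem (hnode V K z P SC hS zhat halg I hI hbal)
    · have h1 : n ^ (-(r + 1)) ≤ n ^ (-r) :=
        Real.rpow_le_rpow_of_exponent_le hn1 (by linarith)
      have h2 : C' * n ^ (-(r + 1)) ≤ C' * n ^ (-r) := by gcongr
      have h3 : 0 ≤ C' * (n * etaStar z P) := by positivity
      have h4 : n * (C * (n ^ (-(r + 1)) + etaStar z P)) = C * (n ^ (-r) + n * etaStar z P) := by
        rw [← hmul]; ring
      linarith

lemma BlockBounds.dStar_nonneg {V : Type} [Fintype V] {K : ℕ} {ps : ℝ} {z : V → Fin K}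
    {P : Matrix (Fin K) (Fin K) ℝ} (h : BlockBounds ε ω ps P) (hK : 2 ≤ K) : 0 ≤ dStar z P := by
  have := pairs_nonempty hK
  refine le_ciInf fun kl => le_trans ?_ (le_chernoffInfo (h.comparable z kl.1.1 kl.1.2))
  have := chiSep_nonneg (h.comparable z kl.1.1 kl.1.2)
  linarith

/-- If the expected degree is large and at most of order `D*²`, all the assumptions hold. -/
lemma Scales.setting (hs : Scales ε ω b κ c E) (hε : 0 < ε) (hω : 1 < ω) (hβ : 1 < β)
    (hbK : b = β * (Kmax + 1)) (hC₂ : 0 < C₂) {D₁ : ℝ} (hD₁ : 1 ≤ D₁) (hκ : 1 / κ ≤ D₁)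
    (hC : 256 * C₂ * Kmax / c ^ 3 ≤ D₁) (hb8 : 8 * b * (ω / ε) ≤ D₁)
    {V : Type} [Fintype V] {K : ℕ} {z : V → Fin K} {P : Matrix (Fin K) (Fin K) ℝ}
    {SC : Clustering K} (hK : 2 ≤ K) (hKmax : K ≤ Kmax) (hadm : Admissible β ε ω z P)
    (hSC : ∀ β', 1 < β' → ClusteringGuarantee β' ε ω r (Csc β') SC)
    (h1 : C₂ * D₁ ^ 2 ≤ Fintype.card V * pStar P)
    (h2 : Fintype.card V * pStar P ≤ C₂ * dStar z P ^ 2) :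
    Setting β ε ω b κ c r C₂ Kmax z P SC Csc := by
  have hB := hadm.blockBounds hε hω hK
  have hb := hs.b_pos
  -- The lower bound on the expected degree acts only through this: `C₂ D₁² ≤ n p* ≤ C₂ D²` forces
  -- `D` to be large, and then `n` as well.
  have hD : D₁ ≤ dStar z P := by
    have h3 : D₁ ^ 2 ≤ dStar z P ^ 2 := le_of_mul_le_mul_left (h1.trans h2) hC₂
    exact (sq_le_sq₀ (by linarith) (hB.dStar_nonneg hK)).1 h3
  have hn : 8 * b ≤ Fintype.card V := by
    have h3 := hB.dStar_le_card (z := z) hK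
    have h4 : 8 * b * (ω / ε) ≤ (Fintype.card V : ℝ) * (ω / ε) := by
      refine (hb8.trans hD).trans (h3.trans ?_)
      have h5 : pStar P ≤ 1 := by linarith [hB.ps_le]
      have h6 : (Fintype.card V : ℝ) * pStar P ≤ Fintype.card V :=
        mul_le_of_le_one_right (Nat.cast_nonneg _) h5
      have h7 : 0 ≤ ω / ε := by positivity
      nlinarith
    exact le_of_mul_le_mul_right h4 (by positivity)
  have hK0 : (0 : ℝ) < K := by exact_mod_cast (by omega : 0 < K)
  refine ⟨hK, hKmax, hadm, hB, fun k => le_trans ?_ (hadm.size_lower k), hn, ?_, by linarith, h2,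
    hC.trans hD, ?_, hSC⟩
  · rw [hbK]
    have : (K : ℝ) ≤ Kmax + 1 := by exact_mod_cast hKmax.trans (Nat.le_succ _)
    gcongr
  · have h3 : (0 : ℝ) < Fintype.card V := by linarith
    exact_mod_cast h3
  · rw [div_le_iff₀ hs.kappa_pos] at hκ
    have := mul_le_mul_of_nonneg_right hD hs.kappa_pos.le
    linarith

end Algorithm

end SBM

end

/-! ### The main theorem: choice of constants and conclusion -/

theorem mainTheorem6 (β ε ω : ℝ) (Kmax : ℕ) (hβ : 1 < β) (hε₀ : 0 < ε) (hε₁ : ε < 1)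
    (hω : 1 < ω) (Csc : ℝ → ℝ) :
    ∃ C₁ C₂ : ℝ, 0 < C₁ ∧ 0 < C₂ ∧ ∀ r : ℝ, 0 < r → ∃ C : ℝ, 0 < C ∧
      ∀ (K n : ℕ), 2 ≤ K → K ≤ Kmax →
      ∀ (z : Fin n → Fin K) (P : Matrix (Fin K) (Fin K) ℝ), SBM.Admissible β ε ω z P →
      ∀ SC : SBM.Clustering K, SBM.IsSpectralClustering SC →
      (∀ β' : ℝ, 1 < β' → SBM.ClusteringGuarantee β' ε ω r (Csc β') SC) →
      ∀ zhat : SimpleGraph (Fin n) → Finset (Fin n) → Fin n → Fin K, SBM.IsAlgorithm SC zhat →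
      C₁ ≤ (n : ℝ) * SBM.pStar P → (n : ℝ) * SBM.pStar P ≤ C₂ * SBM.dStar z P ^ 2 →
      (SBM.dStar z P ≤ (1 + r / 2) * Real.log n →
        SBM.expect z P (fun G I => SBM.mis (zhat G I) z) ≤ C * SBM.etaStar z P ∧
        SBM.expect z P (fun G I => SBM.mis (zhat G I) z) ≤ C * SBM.chernoffRate z P) ∧
      (∀ s : ℝ, 0 < s → (1 + 2 * s) * Real.log n ≤ SBM.dStar z P →
        SBM.prob z P (fun G I => SBM.etaStar z P ≤ SBM.mis (zhat G I) z) ≤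
          C * (n : ℝ) ^ (-min r s) ∧
        SBM.prob z P (fun G I => SBM.chernoffRate z P ≤ SBM.mis (zhat G I) z) ≤
          C * (n : ℝ) ^ (-min r s)) := by
  obtain ⟨b, hbK⟩ : ∃ b : ℝ, b = β * (Kmax + 1) := ⟨_, rfl⟩
  have hb : 0 < b := by rw [hbK]; positivity
  have hω₀ : 0 < ω := by linarith
  obtain ⟨κ, c, E, hs⟩ := SBM.exists_scales ε ω b hε₀ hω₀ hb
  have hκ := hs.kappa_pos
  have hc : 0 < c := by rw [hs.c_eq]; positivity
  -- Maxima with `0` are taken because `Csc` may be negative. Neither `q` nor the scales involve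
  -- `r`, so `C₁` and `C₂` do not depend on it.
  obtain ⟨q, hq⟩ : ∃ q : ℝ, q = 2 * max (Csc β) 0 + max (Csc (8 * β)) 0 / c := ⟨_, rfl⟩
  have hq0 : 0 ≤ q := by rw [hq]; positivity
  obtain ⟨C₂, hC₂⟩ : ∃ C₂ : ℝ, C₂ = κ / (q + 1) := ⟨_, rfl⟩
  have hC₂0 : 0 < C₂ := by rw [hC₂]; positivity
  have hC₂q : C₂ * q ≤ κ := by
    rw [hC₂, div_mul_eq_mul_div, div_le_iff₀ (by positivity)]
    nlinarith
  rw [hq] at hC₂q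
  obtain ⟨D₁, hD₁⟩ : ∃ D₁ : ℝ, D₁ = 1 + 1 / κ + 256 * C₂ * Kmax / c ^ 3 + 8 * b * (ω / ε) :=
    ⟨_, rfl⟩
  have e₁ : 0 < 1 / κ := by positivity
  have e₂ : 0 ≤ 256 * C₂ * Kmax / c ^ 3 := by positivity
  have e₃ : 0 < 8 * b * (ω / ε) := by positivity
  refine ⟨C₂ * D₁ ^ 2, C₂, by rw [hD₁]; positivity, hC₂0, fun r hr => ?_⟩
  obtain ⟨M, hM, hmis⟩ := hs.exists_mis_le (Kmax := Kmax) hβ hε₀ hε₁ hω hr hC₂0 hC₂q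
  obtain ⟨G, hG⟩ : ∃ G : ℝ,
      G = Real.exp (((ω + 1 / ε) ^ 2 * (8 / ε)) / (4 * (r / 2 / (1 + r / 2)))) := ⟨_, rfl⟩
  have hG0 : 0 < G := hG ▸ Real.exp_pos _
  have hR := SBM.rateC_pos hε₀ hω₀ hb
  refine ⟨M * (G + 1) * (1 + SBM.rateC ε ω b) + 2 * M, by positivity, ?_⟩
  intro K n hK hKmax z P hadm SC _ hSC zhat halg h1 h2
  have hS := hs.setting hε₀ hω hβ hbK hC₂0 (D₁ := D₁) (by linarith) (by linarith)
    (by linarith) (by linarith) hK hKmax hadm hSC (by simpa using h1) (by simpa using h2)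
  have hB := hS.bounds
  have hn := hS.one_le_card
  obtain ⟨hexp, hprob⟩ := hmis (Fin n) K z P SC hS zhat halg
  have hη := hB.etaStar_pos (z := z) hK
  have hηρ := hB.etaStar_le_chernoffRate hK hS.D_pos hb (Nat.cast_pos.1 (zero_lt_one.trans_le hn)) hS.size
  have hρ : 0 < SBM.chernoffRate z P := (mul_pos_iff_of_pos_left hR).1 (hη.trans_le hηρ)
  rw [Fintype.card_fin] at hn hexp hprob
  have hn0 : (0 : ℝ) < n := by linarith
  refine ⟨fun hDn => ?_, fun s hs0 hDn => ?_⟩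
  -- In this range of `D*` the failure probability `n^{-(r+1)}` of spectral clustering is at most a
  -- multiple of `η*`.
  · have h3 := hB.rpow_le_etaStar hK hS.D_pos hn hr hDn
    rw [← hG] at h3
    have h4 : SBM.expect z P (fun G I => SBM.mis (zhat G I) z) ≤
        M * (G + 1) * SBM.etaStar z P := by
      refine hexp.trans ?_
      rw [mul_assoc]
      exact mul_le_mul_of_nonneg_left (by linarith) hM.le
    have h5 : M * (G + 1) * SBM.etaStar z P ≤
        M * (G + 1) * (SBM.rateC ε ω b * SBM.chernoffRate z P) :=
      mul_le_mul_of_nonneg_left hηρ (by positivity)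
    constructor
    · have h6 : 0 ≤ (M * (G + 1) * SBM.rateC ε ω b + 2 * M) * SBM.etaStar z P := by positivity
      linarith
    · have h6 : 0 ≤ (M * (G + 1) + 2 * M) * SBM.chernoffRate z P := by positivity
      linarith
  -- Here `η* ≤ exp (-D*) ≤ n^{-(1+2s)}`, and the union over `n` nodes leaves `n^{-2s}`.
  · have h3 : (n : ℝ) * SBM.etaStar z P ≤ (n : ℝ) ^ (-(2 * s)) := by
      calc (n : ℝ) * SBM.etaStar z P ≤ n * Real.exp (-SBM.dStar z P) := by
            gcongr; exact hB.etaStar_le hK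
        _ ≤ n * Real.exp (Real.log n * -(1 + 2 * s)) := by
            gcongr
            linarith
        _ = n * (n : ℝ) ^ (-(1 + 2 * s)) := by rw [← Real.rpow_def_of_pos hn0]
        _ = (n : ℝ) ^ (1 + -(1 + 2 * s)) := by rw [Real.rpow_add hn0, Real.rpow_one]
        _ = _ := by congr 1; ring
    have h4 : (n : ℝ) ^ (-(2 * s)) ≤ (n : ℝ) ^ (-min r s) :=
      Real.rpow_le_rpow_of_exponent_le hn (by linarith [min_le_right r s])
    have h5 : (n : ℝ) ^ (-r) ≤ (n : ℝ) ^ (-min r s) :=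
      Real.rpow_le_rpow_of_exponent_le hn (by linarith [min_le_left r s])
    have h6 : 0 < (n : ℝ) ^ (-min r s) := Real.rpow_pos_of_pos hn0 _
    have h7 : M * ((n : ℝ) ^ (-r) + n * SBM.etaStar z P) ≤
        (M * (G + 1) * (1 + SBM.rateC ε ω b) + 2 * M) * (n : ℝ) ^ (-min r s) := by
      have h8 : 0 ≤ M * (G + 1) * (1 + SBM.rateC ε ω b) * (n : ℝ) ^ (-min r s) := by positivity
      have h9 : M * ((n : ℝ) ^ (-r) + n * SBM.etaStar z P) ≤ M * (2 * (n : ℝ) ^ (-min r s)) :=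
        mul_le_mul_of_nonneg_left (by linarith) hM.le
      linarith
    exact ⟨(hprob _ hη).trans h7, (hprob _ hρ).trans h7⟩
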